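/- Let $\mathbb F$ be a field of characteristic $0$. A Lie conformal algebra is an $\mathbb F[\partial]$-module $\mathcal A$ with an $\mathbb F$-bilinear $\lambda$-bracket $[\cdot_\lambda\cdot]:\mathcal A\times\mathcal A\to\mathcal A[\lambda]$ such that $[\partial a_\lambda b]=-\lambda[a_\lambda b]$, $[a_\lambda\partial b]=(\partial+\lambda)[a_\lambda b]$, $[a_\lambda b]=-[b_{-\lambda-\partial}a]$ and $[a_\lambda[b_\mu c]]=[[a_\lambda b]_{\lambda+\mu}c]+[b_\mu[a_\lambda c]]$. Let $\widetilde{\mathcal{SV}}=\mathbb F[\partial]L\oplus\mathbb F[\partial]M\oplus\mathbb F[\partial]Y\oplus\mathbb F[\partial]N$ be the extended Schrödinger–Virasoro conformal algebra, that is, the free $\mathbb F[\partial]$-module with basis $L,M,Y,N$ whose non-zero $\lambda$-brackets of basis elements are $$[L_\lambda L]=(\partial+2\lambda)L,\quad [L_\lambda M]=(\partial+\lambda)M,\quad [L_\lambda Y]=(\partial+\tfrac32\lambda)Y,\quad [L_\lambda N]=(\partial+\lambda)N,$$ $$[M_\lambda L]=\lambda M,\quad [Y_\lambda L]=(\tfrac12\partial+\tfrac32\lambda)Y,\quad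 [N_\lambda L]=\lambda N,\quad [Y_\lambda Y]=(\partial+2\lambda)M,$$ $$[N_\lambda M]=2M,\quad [M_\lambda N]=-2M,\quad [N_\lambda Y]=Y,\quad [Y_\lambda N]=-Y.$$ For a Lie conformal algebra $\mathcal A$ and $q\ge 0$, let $\widetilde C^q(\mathcal A,\mathcal A)$ be the space of $\mathbb F$-linear maps $f:\mathcal A^{\otimes q}\to\mathcal A[\lambda_1,\dots,\lambda_q]$, $a_1\otimes\cdots\otimes a_q\mapsto f_{\lambda_1,\dots,\lambda_q}(a_1,\dots,a_q)$, which satisfy $$f_{\lambda_1,\dots,\lambda_q}(\dots,\partial a_i,\dots)=-\lambda_i f_{\lambda_1,\dots,\lambda_q}(\dots,a_i,\dots)$$ and are skew-symmetric under simultaneous permutations of the $a_i$ and the $\lambda_i$ (so $\widetilde C^0(\mathcal A,\mathcal A)=\mathcal A$). With the differential $$(\mathbf df)_{\lambda_1,\dots,\lambda_{q+1}}(a_1,\dots,a_{q+1})=\sum_{k}(-1)^{k+1}[{a_k}_{\lambda_k}f_{\lambda_1,\dots,\hat\lambda_k,\dots,\lambda_{q+1}}(a_1,\dots,\hat a_k,\dots,a_{q+1})]$$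 $$+\sum_{k<l}(-1)^{k+l}f_{\lambda_k+\lambda_l,\lambda_1,\dots,\hat\lambda_k,\dots,\hat\lambda_l,\dots,\lambda_{q+1}}([{a_k}_{\lambda_k}a_l],a_1,\dots,\hat a_k,\dots,\hat a_l,\dots,a_{q+1})$$ these form the basic complex, whose cohomology is the basic cohomology $\widetilde{\mathrm H}^q(\mathcal A,\mathcal A)$. The operator $(\partial f)_{\lambda_1,\dots,\lambda_q}=(\partial+\lambda_1+\dots+\lambda_q)f_{\lambda_1,\dots,\lambda_q}$ commutes with $\mathbf d$, and the cohomology of the quotient complex $\widetilde C^\bullet/\partial\widetilde C^\bullet$ is the reduced cohomology $\mathrm H^q(\mathcal A,\mathcal A)$. A Casimir element of $\mathcal A$ is a class $a+\partial\mathcal A\in\mathcal A/\partial\mathcal A$ with $[a_\lambda b]|_{\lambda=0}=0$ for all $b\in\mathcal A$. A derivation of $\mathcal A$ is an $\mathbb F[\partial]$-module endomorphism $D$ with $D([a_\lambda b])=[a_\lambda D(b)]+[D(a)_\lambda b]$ for all $a,b\in\mathcal A$; it is inner if there is $a\in\mathcal A$ with $D(b)=[a_\lambda b]|_{\lambda=0}$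 for all $b\in\mathcal A$. Theorem. For all $q\ge 0$, $$\widetilde{\mathrm H}^q(\widetilde{\mathcal{SV}},\widetilde{\mathcal{SV}})=0\quad\text{and}\quad \mathrm H^q(\widetilde{\mathcal{SV}},\widetilde{\mathcal{SV}})=0.$$ Moreover, every Casimir element of $\widetilde{\mathcal{SV}}$ is zero, and every derivation of $\widetilde{\mathcal{SV}}$ is inner. -/

import Mathlib

open scoped TensorProduct Polynomial

namespace LieConformal

noncomputable section

section Products

variable {F : Type*} [Field F] {A : Type*} [AddCommGroup A] [Module F A]
  {V : Type*} [AddCommGroup V] [Module F V] {R : Type*} [CommRing R] [Algebra F R]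

/-- Substitution `λ ↦ p`, mapping `V[λ] = F[λ] ⊗ V` to `R ⊗ V`, for an element `p` of a commutative
`F`-algebra `R`. -/
def evalLam (p : R) : F[X] ⊗[F] V →ₗ[F] R ⊗[F] V :=
  LinearMap.rTensor V (Polynomial.aeval p).toLinearMap

/-- Given a `λ`-product `a, v ↦ a_λ v` from `A × V` to `V[λ]` and `p ∈ R`, this is the `R`-bilinear
extension of `a, v ↦ a_p v` to a map from `(R ⊗ A) × (R ⊗ V)` to `R ⊗ V`. -/
def prodAt (act : A →ₗ[F] V →ₗ[F] F[X] ⊗[F] V) (p : R) :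
    R ⊗[F] A →ₗ[R] R ⊗[F] V →ₗ[R] R ⊗[F] V :=
  LinearMap.liftBaseChange R
    (((LinearMap.liftBaseChangeEquiv R (R := F) (M := V) (N := R ⊗[F] V)).toLinearMap.restrictScalars
      F) ∘ₗ (LinearMap.llcomp F V (F[X] ⊗[F] V) (R ⊗[F] V) (evalLam p)) ∘ₗ act)

theorem prodAt_tmul (act : A →ₗ[F] V →ₗ[F] F[X] ⊗[F] V) (p r s : R) (a : A) (v : V) :
    prodAt act p (r ⊗ₜ a) (s ⊗ₜ v) = r • s • evalLam p (act a v) := by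
  simp [prodAt]

/-- The substitution `λ ↦ -λ - ∂` on `V[λ]`, where `∂` acts on coefficients:
`∑ λ ^ j v_j ↦ ∑ (-λ - ∂) ^ j v_j`. -/
def reflect (D : V →ₗ[F] V) : F[X] ⊗[F] V →ₗ[F] F[X] ⊗[F] V :=
  TensorProduct.lift
    ((LinearMap.lcomp F (F[X] ⊗[F] V) (TensorProduct.mk F F[X] V 1)) ∘ₗ
      (Polynomial.aeval (R := F) (A := Module.End F (F[X] ⊗[F] V))
        (-(Algebra.lsmul F F (F[X] ⊗[F] V) (Polynomial.X : F[X])) - D.lTensor F[X])).toLinearMap)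

theorem reflect_tmul (D : V →ₗ[F] V) (p : F[X]) (v : V) :
    reflect D (p ⊗ₜ v) = Polynomial.aeval (R := F) (A := Module.End F (F[X] ⊗[F] V))
        (-(Algebra.lsmul F F (F[X] ⊗[F] V) (Polynomial.X : F[X])) - D.lTensor F[X]) p (1 ⊗ₜ v) := by
  simp [reflect]

theorem evalLam_X_smul (p : R) (x : F[X] ⊗[F] V) :
    evalLam p ((Polynomial.X : F[X]) • x) = p • evalLam p x := by
  induction x with
  | zero => simp
  | add x y hx hy => rw [smul_add, map_add, hx, hy, map_add, smul_add]
  | tmul r v => simp [evalLam, TensorProduct.smul_tmul']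

theorem evalLam_lTensor (D : V →ₗ[F] V) (p : R) (x : F[X] ⊗[F] V) :
    evalLam p (D.lTensor F[X] x) = D.baseChange R (evalLam p x) := by
  induction x with
  | zero => simp
  | add x y hx hy => simp only [map_add, hx, hy]
  | tmul r v => simp [evalLam]

theorem reflect_X_smul (D : V →ₗ[F] V) (x : F[X] ⊗[F] V) :
    reflect D ((Polynomial.X : F[X]) • x) =
      -((Polynomial.X : F[X]) • reflect D x) - D.lTensor F[X] (reflect D x) := by
  induction x with
  | zero => simp
  | add x y hx hy => simp only [smul_add, map_add, hx, hy]; abel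
  | tmul r v => simp [reflect_tmul, TensorProduct.smul_tmul']

theorem reflect_lTensor (D : V →ₗ[F] V) (x : F[X] ⊗[F] V) :
    reflect D (D.lTensor F[X] x) = D.lTensor F[X] (reflect D x) := by
  have hX : ∀ y : F[X] ⊗[F] V, D.lTensor F[X] ((Polynomial.X : F[X]) • y) =
      (Polynomial.X : F[X]) • D.lTensor F[X] y := by
    intro y
    induction y with
    | zero => simp
    | add x y hx hy => simp only [smul_add, map_add, hx, hy]
    | tmul r v => simp [TensorProduct.smul_tmul']
  induction x with
  | zero => simp
  | add x y hx hy => simp only [map_add, hx, hy]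
  | tmul r v =>
    simp only [LinearMap.lTensor_tmul, reflect_tmul]
    induction r using Polynomial.induction_on' with
    | add p q hp hq => simp only [map_add, LinearMap.add_apply, hp, hq]
    | monomial n c =>
      rw [← Polynomial.C_mul_X_pow_eq_monomial]
      simp only [map_mul, Polynomial.aeval_C, map_pow, Polynomial.aeval_X, Module.End.mul_apply,
        Module.algebraMap_end_apply, map_smul]
      congr 1
      induction n with
      | zero => simp
      | succ n ih =>
        rw [pow_succ', Module.End.mul_apply, ih, Module.End.mul_apply]
        simp [hX]

end Products

/-- The variable `λ` of `F[λ, μ]`. -/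
abbrev lam (F : Type*) [Field F] : MvPolynomial (Fin 2) F := MvPolynomial.X 0

/-- The variable `μ` of `F[λ, μ]`. -/
abbrev mu (F : Type*) [Field F] : MvPolynomial (Fin 2) F := MvPolynomial.X 1

/-- A Lie conformal algebra structure on a vector space `A` over `F`: an endomorphism `∂`, so that
`A` becomes an `F[∂]`-module, and a `λ`-bracket `A × A → A[λ] = F[λ] ⊗ A`.  The Jacobi identity is an
identity in `A[λ, μ] = F[λ, μ] ⊗ A`. -/
structure LieConformalAlgebra (F : Type*) [Field F] (A : Type*) [AddCommGroup A] [Module F A] where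
  /-- the action of `∂` -/
  der : A →ₗ[F] A
  /-- the `λ`-bracket -/
  bracket : A →ₗ[F] A →ₗ[F] F[X] ⊗[F] A
  bracket_der_left : ∀ a b, bracket (der a) b = -((Polynomial.X : F[X]) • bracket a b)
  bracket_der_right : ∀ a b,
    bracket a (der b) = der.lTensor F[X] (bracket a b) + (Polynomial.X : F[X]) • bracket a b
  skew : ∀ a b, bracket a b = -reflect der (bracket b a)
  jacobi : ∀ a b c,
    prodAt bracket (lam F) (1 ⊗ₜ a) (prodAt bracket (mu F) (1 ⊗ₜ b) (1 ⊗ₜ c)) =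
      prodAt bracket (lam F + mu F) (prodAt bracket (lam F) (1 ⊗ₜ a) (1 ⊗ₜ b)) (1 ⊗ₜ c) +
        prodAt bracket (mu F) (1 ⊗ₜ b) (prodAt bracket (lam F) (1 ⊗ₜ a) (1 ⊗ₜ c))

section Generators

variable {F : Type*} [Field F] {A : Type*} [AddCommGroup A] [Module F A]
  {V : Type*} [AddCommGroup V] [Module F V] {R : Type*} [CommRing R] [Algebra F R]
  (D : A →ₗ[F] A) (br : A →ₗ[F] A →ₗ[F] F[X] ⊗[F] A)

theorem prodAt_der_left
    (h : ∀ a b, br (D a) b = -((Polynomial.X : F[X]) • br a b)) (p : R) (x y : R ⊗[F] A) :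
    prodAt br p (D.baseChange R x) y = -(p • prodAt br p x y) := by
  induction x with
  | zero => simp
  | add x z hx hz => simp only [map_add, LinearMap.add_apply, hx, hz, smul_add]; abel
  | tmul r a =>
    induction y with
    | zero => simp
    | add x z hx hz => simp only [map_add, hx, hz, smul_add]; abel
    | tmul s b =>
      rw [LinearMap.baseChange_tmul, prodAt_tmul, prodAt_tmul, h, map_neg, evalLam_X_smul]
      module

theorem prodAt_der_right
    (h : ∀ a b, br a (D b) = D.lTensor F[X] (br a b) + (Polynomial.X : F[X]) • br a b)
    (p : R) (x y : R ⊗[F] A) :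
    prodAt br p x (D.baseChange R y) = D.baseChange R (prodAt br p x y) + p • prodAt br p x y := by
  induction x with
  | zero => simp
  | add x z hx hz => simp only [map_add, LinearMap.add_apply, hx, hz, smul_add]; abel
  | tmul r a =>
    induction y with
    | zero => simp
    | add x z hx hz => simp only [map_add, hx, hz, smul_add]; abel
    | tmul s b =>
      rw [LinearMap.baseChange_tmul, prodAt_tmul, prodAt_tmul, h, map_add, evalLam_X_smul,
        evalLam_lTensor, map_smul, map_smul]
      module

/-- A sesquilinear bracket which satisfies skew-symmetry and the Jacobi identity on a set of
generators of the `F[∂]`-module `A` defines a Lie conformal algebra. -/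
def LieConformalAlgebra.ofGenerators
    (hl : ∀ a b, br (D a) b = -((Polynomial.X : F[X]) • br a b))
    (hr : ∀ a b, br a (D b) = D.lTensor F[X] (br a b) + (Polynomial.X : F[X]) • br a b)
    (S : Set A)
    (hS : ∀ P : Submodule F A, S ⊆ P → (∀ x ∈ P, D x ∈ P) → P = ⊤)
    (hskew : ∀ a ∈ S, ∀ b ∈ S, br a b = -reflect D (br b a))
    (hjac : ∀ a ∈ S, ∀ b ∈ S, ∀ c ∈ S, ∀ l m : MvPolynomial (Fin 2) F,
      prodAt br l (1 ⊗ₜ a) (prodAt br m (1 ⊗ₜ b) (1 ⊗ₜ c)) =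
        prodAt br (l + m) (prodAt br l (1 ⊗ₜ a) (1 ⊗ₜ b)) (1 ⊗ₜ c) +
          prodAt br m (1 ⊗ₜ b) (prodAt br l (1 ⊗ₜ a) (1 ⊗ₜ c))) :
    LieConformalAlgebra F A where
  der := D
  bracket := br
  bracket_der_left := hl
  bracket_der_right := hr
  skew := by
    have h1 : ∀ b ∈ S, ∀ a, br a b = -reflect D (br b a) := by
      intro b hb
      let P : Submodule F A := LinearMap.ker (br.flip b + reflect D ∘ₗ br b)
      have hP : ∀ a, a ∈ P ↔ br a b = -reflect D (br b a) := by
        intro a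
        simp [P, LinearMap.mem_ker, eq_neg_iff_add_eq_zero]
      have : P = ⊤ := by
        refine hS P (fun a ha => (hP a).2 (hskew a ha b hb)) fun a ha => ?_
        rw [hP] at ha ⊢
        rw [hl, hr, map_add, reflect_X_smul, reflect_lTensor, ha]
        module
      intro a
      rw [← hP, this]; trivial
    intro a b
    let P : Submodule F A := LinearMap.ker (br a + reflect D ∘ₗ br.flip a)
    have hP : ∀ b, b ∈ P ↔ br a b = -reflect D (br b a) := by
      intro b
      simp [P, LinearMap.mem_ker, eq_neg_iff_add_eq_zero]
    have : P = ⊤ := by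
      refine hS P (fun b hb => (hP b).2 (h1 b hb a)) fun b hb => ?_
      rw [hP] at hb ⊢
      rw [hl, hr, hb, map_neg, map_neg, reflect_X_smul]
      module
    rw [← hP, this]; trivial
  jacobi := by
    intro a b c
    generalize lam F = l
    generalize mu F = m
    let e : A →ₗ[F] MvPolynomial (Fin 2) F ⊗[F] A := TensorProduct.mk F _ A 1
    have he : ∀ x, e (D x) = D.baseChange _ (e x) := fun x => by simp [e]
    have hJ : ∀ x y z, (prodAt br l (e x) (prodAt br m (e y) (e z)) =
        prodAt br (l + m) (prodAt br l (e x) (e y)) (e z) +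
          prodAt br m (e y) (prodAt br l (e x) (e z))) ↔
        prodAt br l (e x) (prodAt br m (e y) (e z)) -
        prodAt br (l + m) (prodAt br l (e x) (e y)) (e z) -
          prodAt br m (e y) (prodAt br l (e x) (e z)) = 0 := by
      intro x y z
      rw [sub_sub, sub_eq_zero]
    have key : ∀ Q : A → Prop, Q 0 → (∀ x y, Q x → Q y → Q (x + y)) →
        (∀ (r : F) x, Q x → Q (r • x)) → (∀ x ∈ S, Q x) → (∀ x, Q x → Q (D x)) → ∀ x, Q x := by
      intro Q h0 hadd hsm hin hD x
      let P : Submodule F A :=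
        { carrier := {x | Q x}, zero_mem' := h0, add_mem' := fun {x y} => hadd x y,
          smul_mem' := fun r x => hsm r x }
      have : P = ⊤ := hS P hin hD
      have hx : x ∈ P := by rw [this]; trivial
      exact hx
    have dl := prodAt_der_left (R := MvPolynomial (Fin 2) F) D br hl
    have dr := prodAt_der_right (R := MvPolynomial (Fin 2) F) D br hr
    suffices h : ∀ a b c, prodAt br l (e a) (prodAt br m (e b) (e c)) =
        prodAt br (l + m) (prodAt br l (e a) (e b)) (e c) +
          prodAt br m (e b) (prodAt br l (e a) (e c)) from h a b c
    have smulR : ∀ (r : F) (x : MvPolynomial (Fin 2) F ⊗[F] A),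
        r • x = (algebraMap F (MvPolynomial (Fin 2) F) r) • x := by
      intro r x; rw [algebraMap_smul]
    refine fun a => key _ ?_ ?_ ?_ ?_ ?_
    · intro c; simp
    · intro x y hx hy c
      simp only [map_add, LinearMap.add_apply, hx c, hy c]; abel
    · intro r x hx c
      simp only [map_smul, smulR, LinearMap.smul_apply, hx c, smul_add]
    · intro b hb
      refine key _ (by simp) ?_ ?_ ?_ ?_
      · intro x y hx hy
        simp only [map_add, hx, hy]; abel
      · intro r x hx
        simp only [map_smul, smulR, hx, smul_add]
      · intro c hc
        revert a
        refine key _ (by simp) ?_ ?_ (fun a ha => hjac a ha b hb c hc l m) ?_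
        · intro x y hx hy
          simp only [map_add, LinearMap.add_apply, hx, hy]; abel
        · intro r x hx
          simp only [map_smul, smulR, LinearMap.smul_apply, hx, smul_add]
        · intro x hx
          simp only [he, dl, map_neg, map_smul, LinearMap.neg_apply, LinearMap.smul_apply, hx,
            smul_add]
          module
      · intro x hx
        simp only [he, dr, map_add, map_smul, hx]
        module
    · intro b hb c
      have hb := hb c
      simp only [he, dl, dr, map_add, map_neg, map_smul, LinearMap.smul_apply,
        LinearMap.add_apply, hb]
      module

end Generators

/-- A module over a Lie conformal algebra: an `F[∂]`-module `V` with a `λ`-action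
`A × V → V[λ] = F[λ] ⊗ V`. -/
structure LCAModule {F : Type*} [Field F] {A : Type*} [AddCommGroup A] [Module F A]
    (𝔤 : LieConformalAlgebra F A) (V : Type*) [AddCommGroup V] [Module F V] where
  /-- the action of `∂` -/
  der : V →ₗ[F] V
  /-- the `λ`-action -/
  act : A →ₗ[F] V →ₗ[F] F[X] ⊗[F] V
  act_der_left : ∀ a v, act (𝔤.der a) v = -((Polynomial.X : F[X]) • act a v)
  act_der_right : ∀ a v,
    act a (der v) = der.lTensor F[X] (act a v) + (Polynomial.X : F[X]) • act a v
  act_act : ∀ a b v,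
    prodAt act (lam F) (1 ⊗ₜ a) (prodAt act (mu F) (1 ⊗ₜ b) (1 ⊗ₜ v)) -
        prodAt act (mu F) (1 ⊗ₜ b) (prodAt act (lam F) (1 ⊗ₜ a) (1 ⊗ₜ v)) =
      prodAt act (lam F + mu F) (prodAt 𝔤.bracket (lam F) (1 ⊗ₜ a) (1 ⊗ₜ b)) (1 ⊗ₜ v)

/-- The adjoint module. -/
def LieConformalAlgebra.adjoint {F : Type*} [Field F] {A : Type*} [AddCommGroup A] [Module F A]
    (𝔤 : LieConformalAlgebra F A) : LCAModule 𝔤 A where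
  der := 𝔤.der
  act := 𝔤.bracket
  act_der_left := 𝔤.bracket_der_left
  act_der_right := 𝔤.bracket_der_right
  act_act a b c := by rw [𝔤.jacobi a b c, add_sub_cancel_right]

section Cohomology

variable {F : Type*} [Field F] {A : Type*} [AddCommGroup A] [Module F A]
  {V : Type*} [AddCommGroup V] [Module F V]

/-- Substitution `λ_i ↦ s i`, mapping `V[λ_1, …, λ_q] = F[λ_1, …, λ_q] ⊗ V` to `R ⊗ V`. -/
def subst {q : ℕ} {R : Type*} [CommRing R] [Algebra F R] (s : Fin q → R) :
    MvPolynomial (Fin q) F ⊗[F] V →ₗ[F] R ⊗[F] V :=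
  LinearMap.rTensor V (MvPolynomial.aeval s).toLinearMap

/-- The linear maps `A^{⊗ q} → V[λ_1, …, λ_q]`. -/
abbrev PreCochain (F A V : Type*) [Field F] [AddCommGroup A] [Module F A] [AddCommGroup V]
    [Module F V] (q : ℕ) : Type _ :=
  MultilinearMap F (fun _ : Fin q => A) (MvPolynomial (Fin q) F ⊗[F] V)

/-- The additive group structure on cochains, with the same addition as in Mathlib; it is spelled
out so that quotients of spaces of cochains can be formed. -/
instance (q : ℕ) : AddCommGroup (PreCochain F A V q) :=
  { (inferInstance : AddCommMonoid (PreCochain F A V q)),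
    (MultilinearMap.instAddCommGroup : AddCommGroup (PreCochain F A V q)) with }

namespace LCAModule

variable {𝔤 : LieConformalAlgebra F A} (M : LCAModule 𝔤 V)

/-- The space of `q`-cochains of the basic complex. -/
def cochains (_M : LCAModule 𝔤 V) (q : ℕ) : Submodule F (PreCochain F A V q) where
  carrier := {f |
    (∀ (a : Fin q → A) (i : Fin q), f (Function.update a i (𝔤.der (a i))) =
      -((MvPolynomial.X i : MvPolynomial (Fin q) F) • f a)) ∧
    (∀ (σ : Equiv.Perm (Fin q)) (a : Fin q → A),
      subst (fun i => (MvPolynomial.X (σ i) : MvPolynomial (Fin q) F)) (f (a ∘ σ)) =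
        (Equiv.Perm.sign σ : ℤ) • f a)}
  zero_mem' := by simp
  add_mem' := by
    rintro f g ⟨hf, hf'⟩ ⟨hg, hg'⟩
    refine ⟨fun a i => ?_, fun σ a => ?_⟩
    · simp only [add_apply, hf, hg, smul_add, neg_add]
    · simp only [add_apply, map_add, hf', hg', smul_add]
  smul_mem' := by
    rintro r f ⟨hf, hf'⟩
    refine ⟨fun a i => ?_, fun σ a => ?_⟩
    · simp only [smul_apply, hf, smul_neg, smul_comm r]
    · rw [smul_apply, map_smul, hf', smul_comm]
      rfl

/-- The linear map `b ↦ f(b, w_1, …, w_n)`. -/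
def headMap {n : ℕ} (w : Fin n → A) :
    PreCochain F A V (n + 1) →ₗ[F] A →ₗ[F] MvPolynomial (Fin (n + 1)) F ⊗[F] V :=
  LinearMap.mk₂ F (fun f b => f (Fin.cons b w))
    (fun _ _ _ => rfl) (fun _ _ _ => rfl)
    (fun f b b' => f.cons_add w b b') (fun r f b => f.cons_smul w r b)

/-- The `k`-th term `(-1)^k a_{k, λ_k} f(a_0, …, â_k, …, a_q)` (with indices from `0` to `q`) of
the first sum in the differential. -/
def actTerm {q : ℕ} (f : PreCochain F A V q) (a : Fin (q + 1) → A) (k : Fin (q + 1)) :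
    MvPolynomial (Fin (q + 1)) F ⊗[F] V :=
  (-1 : ℤ) ^ (k : ℕ) •
    prodAt M.act (MvPolynomial.X k) (1 ⊗ₜ a k)
      (subst (fun i => MvPolynomial.X (k.succAbove i)) (f fun i => a (k.succAbove i)))

/-- The `(k, l)`-th term
`(-1)^(k + l) f_{λ_k + λ_l, λ_0, …}([a_{k, λ_k} a_l], a_0, …, â_k, …, â_l, …)` of the second sum in
the differential, where `k ≤ j` and `l = j + 1`; so the remaining indices, in increasing order,
are `k.succAbove (j.succAbove i)`. -/
def bracketTerm (𝔤 : LieConformalAlgebra F A) {n : ℕ} (f : PreCochain F A V (n + 1))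
    (a : Fin (n + 2) → A) (k : Fin (n + 2)) (j : Fin (n + 1)) :
    MvPolynomial (Fin (n + 2)) F ⊗[F] V :=
  (-1 : ℤ) ^ ((k : ℕ) + (j.succ : ℕ)) •
    LinearMap.liftBaseChangeEquiv (MvPolynomial (Fin (n + 2)) F)
      (subst (Fin.cons (MvPolynomial.X k + MvPolynomial.X j.succ)
          fun i => MvPolynomial.X (k.succAbove (j.succAbove i))) ∘ₗ
        headMap (fun i => a (k.succAbove (j.succAbove i))) f)
      (prodAt 𝔤.bracket (MvPolynomial.X k) (1 ⊗ₜ a k) (1 ⊗ₜ a j.succ))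

/-- The second sum in the differential; it is empty in degree zero. -/
def bracketSum (𝔤 : LieConformalAlgebra F A) : {q : ℕ} → PreCochain F A V q → (Fin (q + 1) → A) →
    MvPolynomial (Fin (q + 1)) F ⊗[F] V
  | 0, _, _ => 0
  | _ + 1, f, a => ∑ k, ∑ j, if k ≤ j.castSucc then bracketTerm 𝔤 f a k j else 0

/-- The differential `f ↦ 𝐝 f`. -/
def d (q : ℕ) : PreCochain F A V q →ₗ[F]
    ((Fin (q + 1) → A) → MvPolynomial (Fin (q + 1)) F ⊗[F] V) where
  toFun f a := (∑ k, M.actTerm f a k) + bracketSum 𝔤 f a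
  map_add' f g := by
    have h : ∀ a, bracketSum 𝔤 (f + g) a = bracketSum 𝔤 f a + bracketSum 𝔤 g a := by
      intro a
      cases q with
      | zero => simp [bracketSum]
      | succ n =>
        simp only [bracketSum, ← Finset.sum_add_distrib]
        refine Finset.sum_congr rfl fun k _ => Finset.sum_congr rfl fun j _ => ?_
        split_ifs
        · simp only [bracketTerm, map_add, LinearMap.comp_add, LinearMap.add_apply, smul_add]
        · simp
    funext a
    simp only [h, actTerm, add_apply, map_add, smul_add, Finset.sum_add_distrib,
      Pi.add_apply]
    abel
  map_smul' r f := by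
    have h : ∀ a, bracketSum 𝔤 (r • f) a = r • bracketSum 𝔤 f a := by
      intro a
      cases q with
      | zero => simp [bracketSum]
      | succ n =>
        simp only [bracketSum, Finset.smul_sum]
        refine Finset.sum_congr rfl fun k _ => Finset.sum_congr rfl fun j _ => ?_
        split_ifs
        · simp only [bracketTerm, map_smul, LinearMap.comp_smul]
          rw [← algebraMap_smul (MvPolynomial (Fin (n + 2)) F) r, map_smul, LinearMap.smul_apply,
            algebraMap_smul, smul_comm]
        · simp
    funext a
    have hp : ∀ (k : Fin (q + 1)) x, prodAt M.act (MvPolynomial.X k) (1 ⊗ₜ a k) (r • x) =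
        r • prodAt M.act (MvPolynomial.X k : MvPolynomial (Fin (q + 1)) F) (1 ⊗ₜ a k) x := by
      intro k x
      rw [← algebraMap_smul (MvPolynomial (Fin (q + 1)) F) r x, map_smul, algebraMap_smul]
    simp only [h, actTerm, smul_apply, map_smul, hp, Pi.smul_apply, smul_add,
      Finset.smul_sum, RingHom.id_apply, smul_comm r]

/-- The operator `∂^M + λ_1 + ⋯ + λ_q` on `V[λ_1, …, λ_q]`. -/
def totalDer (q : ℕ) : MvPolynomial (Fin q) F ⊗[F] V →ₗ[F] MvPolynomial (Fin q) F ⊗[F] V :=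
  M.der.lTensor (MvPolynomial (Fin q) F) +
    Algebra.lsmul F F (MvPolynomial (Fin q) F ⊗[F] V) (∑ i, MvPolynomial.X i : MvPolynomial (Fin q) F)

theorem totalDer_smul {q : ℕ} (p : MvPolynomial (Fin q) F) (x : MvPolynomial (Fin q) F ⊗[F] V) :
    M.totalDer q (p • x) = p • M.totalDer q x := by
  induction x with
  | zero => simp
  | add x y hx hy => simp only [smul_add, map_add, hx, hy]
  | tmul r v =>
    simp only [totalDer, LinearMap.add_apply, LinearMap.lTensor_tmul, Algebra.lsmul_coe,
      TensorProduct.smul_tmul', smul_eq_mul, smul_add, mul_left_comm]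

theorem subst_totalDer {q : ℕ} (σ : Equiv.Perm (Fin q)) (x : MvPolynomial (Fin q) F ⊗[F] V) :
    subst (fun i => (MvPolynomial.X (σ i) : MvPolynomial (Fin q) F)) (M.totalDer q x) =
      M.totalDer q (subst (fun i => MvPolynomial.X (σ i)) x) := by
  have hs : ∑ i, (MvPolynomial.X (σ i) : MvPolynomial (Fin q) F) = ∑ i, MvPolynomial.X i :=
    Equiv.sum_comp σ fun i => (MvPolynomial.X i : MvPolynomial (Fin q) F)
  induction x with
  | zero => simp
  | add x y hx hy => simp only [map_add, hx, hy]
  | tmul r v =>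
    have hs' : MvPolynomial.aeval (fun i => (MvPolynomial.X (σ i) : MvPolynomial (Fin q) F))
        (∑ i, MvPolynomial.X i : MvPolynomial (Fin q) F) = ∑ i, MvPolynomial.X i := by
      simp only [map_sum, MvPolynomial.aeval_X, hs]
    simp only [totalDer]
    generalize (∑ i, MvPolynomial.X i : MvPolynomial (Fin q) F) = p at *
    simp only [subst, LinearMap.add_apply, LinearMap.lTensor_tmul, Algebra.lsmul_coe,
      TensorProduct.smul_tmul', smul_eq_mul, map_add, LinearMap.rTensor_tmul,
      AlgHom.toLinearMap_apply, map_mul, hs']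

/-- The action of `∂` on the basic `q`-cochains, `f ↦ (∂^M + λ_1 + ⋯ + λ_q) f`. -/
def derCochain (q : ℕ) : M.cochains q →ₗ[F] M.cochains q where
  toFun f := ⟨(M.totalDer q).compMultilinearMap f.1, by
    refine ⟨fun a i => ?_, fun σ a => ?_⟩
    · simp only [LinearMap.compMultilinearMap_apply, f.2.1 a i, map_neg, totalDer_smul]
    · simp only [LinearMap.compMultilinearMap_apply, subst_totalDer, f.2.2 σ a, map_zsmul]⟩
  map_add' f g := by ext a; simp
  map_smul' r f := by ext a; simp

/-- A cochain as a function. -/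
def toFunₗ (F A V : Type*) [Field F] [AddCommGroup A] [Module F A] [AddCommGroup V] [Module F V]
    (q : ℕ) : PreCochain F A V q →ₗ[F] ((Fin q → A) → MvPolynomial (Fin q) F ⊗[F] V) where
  toFun f := ⇑f
  map_add' _ _ := rfl
  map_smul' _ _ := rfl

/-- Basic `q`-cocycles: cochains `f` with `𝐝 f = 0`. -/
def basicCocycles (q : ℕ) : Submodule F (PreCochain F A V q) :=
  M.cochains q ⊓ LinearMap.ker (M.d q)

/-- Basic `q`-coboundaries: cochains of the form `𝐝 g` for a `(q - 1)`-cochain `g`. -/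
def basicCoboundaries : (q : ℕ) → Submodule F (PreCochain F A V q)
  | 0 => ⊥
  | q + 1 => M.cochains (q + 1) ⊓ ((M.cochains q).map (M.d q)).comap (toFunₗ F A V (q + 1))

/-- The basic cohomology: cocycles modulo coboundaries. -/
abbrev BasicCohomology (q : ℕ) : Type _ :=
  M.basicCocycles q ⧸ (M.basicCoboundaries q).submoduleOf (M.basicCocycles q)

/-- The reduced `q`-cochains, that is, basic cochains modulo the image of `∂`. -/
abbrev ReducedCochains (q : ℕ) : Type _ := M.cochains q ⧸ LinearMap.range (M.derCochain q)

/-- The functions `∂ h` for `q`-cochains `h`. -/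
def derFunctions (q : ℕ) : Submodule F ((Fin q → A) → MvPolynomial (Fin q) F ⊗[F] V) :=
  LinearMap.range (toFunₗ F A V q ∘ₗ (M.cochains q).subtype ∘ₗ M.derCochain q)

/-- Reduced `q`-cocycles: classes of cochains `f` such that `𝐝 f = ∂ h` for a
`(q + 1)`-cochain `h`. -/
def reducedCocycles (q : ℕ) : Submodule F (M.ReducedCochains q) :=
  (((M.derFunctions (q + 1)).comap (M.d q)).submoduleOf (M.cochains q)).map (Submodule.mkQ _)

/-- Reduced `q`-coboundaries: classes of the basic `q`-coboundaries. -/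
def reducedCoboundaries (q : ℕ) : Submodule F (M.ReducedCochains q) :=
  ((M.basicCoboundaries q).submoduleOf (M.cochains q)).map (Submodule.mkQ _)

/-- The reduced cohomology: reduced cocycles modulo reduced coboundaries. -/
abbrev ReducedCohomology (q : ℕ) : Type _ :=
  M.reducedCocycles q ⧸ (M.reducedCoboundaries q).submoduleOf (M.reducedCocycles q)

end LCAModule

namespace LieConformalAlgebra

variable (𝔤 : LieConformalAlgebra F A)

/-- The operator `ad a : b ↦ [a_λ b]|_{λ = 0}`. -/
def ad : A →ₗ[F] A →ₗ[F] A :=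
  𝔤.bracket.compr₂ ((TensorProduct.lid F A).toLinearMap ∘ₗ evalLam (0 : F))

/-- The space of Casimir elements: the classes in `A / ∂A` of those `a` with
`[a_λ A]|_{λ = 0} = 0`. -/
def casimir : Submodule F (A ⧸ LinearMap.range 𝔤.der) :=
  (LinearMap.ker 𝔤.ad).map (Submodule.mkQ _)

/-- A derivation: an `F[∂]`-linear map `D` with `D [a_λ b] = [(D a)_λ b] + [a_λ (D b)]`. -/
def IsDerivation (D : A →ₗ[F] A) : Prop :=
  (∀ a, D (𝔤.der a) = 𝔤.der (D a)) ∧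
    ∀ a b, D.lTensor F[X] (𝔤.bracket a b) = 𝔤.bracket (D a) b + 𝔤.bracket a (D b)

/-- An inner derivation: a map of the form `ad a`. -/
def IsInner (D : A →ₗ[F] A) : Prop := ∃ a, D = 𝔤.ad a

end LieConformalAlgebra

end Cohomology

section ExtendedSchrodingerVirasoro

/-- The generators of the extended Schrödinger-Virasoro conformal algebra. -/
inductive ESVGen
  | L
  | M
  | Y
  | N
  deriving DecidableEq

instance : Fintype ESVGen where
  elems := {.L, .M, .Y, .N}
  complete := by intro g; cases g <;> decide

variable (F : Type*) [Field F]

/-- The free `F[∂]`-module `F[∂]L ⊕ F[∂]M ⊕ F[∂]Y ⊕ F[∂]N`; the variable of `F[X]` is `∂`. -/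
abbrev ESV : Type _ := ESVGen → F[X]

namespace ESV

/-- The action of `∂`. -/
def der : ESV F →ₗ[F] ESV F := Algebra.lsmul F F (ESV F) (Polynomial.X : F[X])

/-- The basis of the free `F[∂]`-module. -/
def gen (g : ESVGen) : ESV F := Pi.single g 1

/-- The element `(α ∂ + β λ + γ) g` of `F[λ] ⊗ (F[∂]L ⊕ F[∂]M ⊕ F[∂]Y ⊕ F[∂]N)`. -/
def lin (α β γ : F) (g : ESVGen) : F[X] ⊗[F] ESV F :=
  α • ((1 : F[X]) ⊗ₜ der F (gen F g)) + β • ((Polynomial.X : F[X]) ⊗ₜ gen F g) +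
    γ • ((1 : F[X]) ⊗ₜ gen F g)

/-- The table of the `λ`-brackets of the generators. -/
def table : ESVGen → ESVGen → F[X] ⊗[F] ESV F
  | .L, .L => lin F 1 2 0 .L
  | .L, .M => lin F 1 1 0 .M
  | .L, .Y => lin F 1 (3 / 2) 0 .Y
  | .M, .L => lin F 0 1 0 .M
  | .Y, .L => lin F (1 / 2) (3 / 2) 0 .Y
  | .Y, .Y => lin F 1 2 0 .M
  | .L, .N => lin F 1 1 0 .N
  | .N, .L => lin F 0 1 0 .N
  | .N, .M => lin F 0 0 2 .M
  | .M, .N => lin F 0 0 (-2) .M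
  | .N, .Y => lin F 0 0 1 .Y
  | .Y, .N => lin F 0 0 (-1) .Y
  | _, _ => 0

/-- Multiplication by `λ`. -/
def mulLam : Module.End F (F[X] ⊗[F] ESV F) := Algebra.lsmul F F _ (Polynomial.X : F[X])

/-- The operator `∂ + λ`. -/
def derAddLam : Module.End F (F[X] ⊗[F] ESV F) := (der F).lTensor F[X] + mulLam F

/-- The `λ`-bracket: `[p(∂)g _λ q(∂)h] = p(-λ) q(∂ + λ) [g_λ h]` for generators `g` and `h`. -/
def bracket : ESV F →ₗ[F] ESV F →ₗ[F] F[X] ⊗[F] ESV F :=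
  LinearMap.mk₂ F
    (fun a b => ∑ g, ∑ h, Polynomial.aeval (-mulLam F) (a g)
      (Polynomial.aeval (derAddLam F) (b h) (table F g h)))
    (fun a a' b => by simp [Finset.sum_add_distrib])
    (fun r a b => by simp [Finset.smul_sum])
    (fun a b b' => by simp [Finset.sum_add_distrib])
    (fun r a b => by simp [Finset.smul_sum])

theorem bracket_apply (a b : ESV F) :
    bracket F a b = ∑ g, ∑ h, Polynomial.aeval (-mulLam F) (a g)
      (Polynomial.aeval (derAddLam F) (b h) (table F g h)) := rfl

theorem commute_aeval (p : F[X]) (x : F[X] ⊗[F] ESV F) :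
    derAddLam F (Polynomial.aeval (-mulLam F) p x) =
      Polynomial.aeval (-mulLam F) p (derAddLam F x) := by
  have hX : ∀ y : F[X] ⊗[F] ESV F, (der F).lTensor F[X] ((Polynomial.X : F[X]) • y) =
      (Polynomial.X : F[X]) • (der F).lTensor F[X] y := by
    intro y
    induction y with
    | zero => simp
    | add x y hx hy => simp only [smul_add, map_add, hx, hy]
    | tmul r v => simp [TensorProduct.smul_tmul']
  have h1 : Commute (derAddLam F) (-mulLam F) := by
    rw [commute_iff_eq]
    refine LinearMap.ext fun y => ?_
    simp [derAddLam, mulLam, hX, add_comm]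
  have h2 : Commute (derAddLam F) (Polynomial.aeval (-mulLam F) p) := by
    rw [commute_iff_eq]
    induction p using Polynomial.induction_on' with
    | add p q hp hq => rw [map_add, mul_add, add_mul, hp, hq]
    | monomial n c =>
      rw [← Polynomial.C_mul_X_pow_eq_monomial, map_mul, Polynomial.aeval_C, map_pow,
        Polynomial.aeval_X, Algebra.algebraMap_eq_smul_one, smul_mul_assoc, one_mul,
        mul_smul_comm, smul_mul_assoc, (h1.pow_right n).eq]
  exact LinearMap.congr_fun h2.eq x

theorem bracket_der_left (a b : ESV F) :
    bracket F (der F a) b = -((Polynomial.X : F[X]) • bracket F a b) := by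
  simp [bracket_apply, der, mulLam, Finset.smul_sum]

theorem bracket_der_right (a b : ESV F) :
    bracket F a (der F b) =
      (der F).lTensor F[X] (bracket F a b) + (Polynomial.X : F[X]) • bracket F a b := by
  have : bracket F a (der F b) = derAddLam F (bracket F a b) := by
    simp only [bracket_apply, map_sum, commute_aeval]
    simp [der]
  rw [this]; rfl

theorem bracket_gen (g h : ESVGen) : bracket F (gen F g) (gen F h) = table F g h := by
  rw [bracket_apply, Finset.sum_eq_single g, Finset.sum_eq_single h]
  · simp [gen]
  · intro k _ hk; simp [gen, Pi.single_eq_of_ne hk]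
  · simp
  · intro k _ hk; simp [gen, Pi.single_eq_of_ne hk]
  · simp

theorem skew_gen [CharZero F] (g h : ESVGen) : table F g h = -reflect (der F) (table F h g) := by
  have hr : ∀ (α β γ : F) (k : ESVGen),
      reflect (der F) (lin F α β γ k) = lin F (α - β) (-β) γ k := by
    intro α β γ k
    have hX : (Polynomial.X : F[X]) ⊗ₜ[F] gen F k = (Polynomial.X : F[X]) • (1 ⊗ₜ gen F k) := by
      rw [TensorProduct.smul_tmul', smul_eq_mul, mul_one]
    simp only [lin, hX, map_add, map_smul, reflect_X_smul, reflect_tmul, map_one,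
      LinearMap.lTensor_tmul, Module.End.one_apply]
    module
  have hn : ∀ (α β γ : F) (k : ESVGen), -lin F α β γ k = lin F (-α) (-β) (-γ) k := by
    intro α β γ k
    simp only [lin]
    module
  cases g <;> cases h <;> simp only [table, hr, hn, map_zero, neg_zero] <;> congr 1 <;> norm_num

theorem generate (P : Submodule F (ESV F)) (h : Set.range (gen F) ⊆ P)
    (hD : ∀ x ∈ P, der F x ∈ P) : P = ⊤ := by
  rw [eq_top_iff]
  rintro x -
  have h1 : ∀ (p : F[X]) (g : ESVGen), p • gen F g ∈ P := by
    intro p g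
    induction p using Polynomial.induction_on' with
    | add p q hp hq => rw [add_smul]; exact P.add_mem hp hq
    | monomial n c =>
      rw [← Polynomial.smul_X_eq_monomial, smul_assoc]
      refine P.smul_mem c ?_
      induction n with
      | zero => simpa using h ⟨g, rfl⟩
      | succ n ih =>
        rw [pow_succ', mul_smul]
        exact hD _ ih
  have : x = ∑ g, x g • gen F g := by
    ext1 k
    simp [gen, Finset.sum_apply, Pi.single_apply]
  rw [this]
  exact P.sum_mem fun g _ => h1 _ g

theorem evalLam_lin {R : Type*} [CommRing R] [Algebra F R] (p : R) (α β γ : F) (g : ESVGen) :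
    evalLam p (lin F α β γ g) =
      algebraMap F R α • ((1 : R) ⊗ₜ[F] der F (gen F g)) + (algebraMap F R β * p) • (1 ⊗ₜ gen F g) +
        algebraMap F R γ • ((1 : R) ⊗ₜ gen F g) := by
  simp [lin, evalLam, mul_smul, TensorProduct.smul_tmul']

/-- The brackets of the generators in an `R`-module `W`, with `T` for `∂`, `p` for `λ` and `s` for
`1 / 2`. -/
def absTable {R W : Type*} [CommRing R] [AddCommGroup W] [Module R W] (T : W →ₗ[R] W)
    (e : ESVGen → W) (s p : R) : ESVGen → ESVGen → W
  | .L, .L => T (e .L) + (2 * p) • e .L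
  | .L, .M => T (e .M) + p • e .M
  | .L, .Y => T (e .Y) + (3 * s * p) • e .Y
  | .M, .L => p • e .M
  | .Y, .L => s • T (e .Y) + (3 * s * p) • e .Y
  | .Y, .Y => T (e .M) + (2 * p) • e .M
  | .L, .N => T (e .N) + p • e .N
  | .N, .L => p • e .N
  | .N, .M => (2 : R) • e .M
  | .M, .N => (-2 : R) • e .M
  | .N, .Y => e .Y
  | .Y, .N => -e .Y
  | _, _ => 0

set_option maxHeartbeats 1000000 in
theorem abs_jacobi {R W : Type*} [CommRing R] [AddCommGroup W] [Module R W] (T : W →ₗ[R] W)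
    (e : ESVGen → W) (s l m : R) (hs : 2 * s = 1) (P : R → W →ₗ[R] W →ₗ[R] W)
    (hl : ∀ p x y, P p (T x) y = -(p • P p x y))
    (hr : ∀ p x y, P p x (T y) = T (P p x y) + p • P p x y)
    (he : ∀ p g h, P p (e g) (e h) = absTable T e s p g h) (a b c : ESVGen) :
    P l (e a) (P m (e b) (e c)) =
      P (l + m) (P l (e a) (e b)) (e c) + P m (e b) (P l (e a) (e c)) := by
  cases a <;> cases b <;> cases c <;>
    simp only [he, hl, hr, absTable, map_add, map_neg, map_smul, map_zero,
      LinearMap.add_apply, LinearMap.smul_apply, LinearMap.neg_apply,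
      LinearMap.zero_apply, smul_zero, add_zero, zero_add, neg_zero]
  all_goals match_scalars <;> grind

theorem jacobi_gen [CharZero F] (a b c : ESVGen) (l m : MvPolynomial (Fin 2) F) :
    prodAt (bracket F) l (1 ⊗ₜ gen F a) (prodAt (bracket F) m (1 ⊗ₜ gen F b) (1 ⊗ₜ gen F c)) =
      prodAt (bracket F) (l + m) (prodAt (bracket F) l (1 ⊗ₜ gen F a) (1 ⊗ₜ gen F b))
        (1 ⊗ₜ gen F c) +
      prodAt (bracket F) m (1 ⊗ₜ gen F b)
        (prodAt (bracket F) l (1 ⊗ₜ gen F a) (1 ⊗ₜ gen F c)) := by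
  have h3 : algebraMap F (MvPolynomial (Fin 2) F) (3 / 2) = 3 * algebraMap F _ (1 / 2) := by
    rw [← map_ofNat (algebraMap F (MvPolynomial (Fin 2) F)), ← map_mul]
    congr 1; ring
  refine abs_jacobi ((der F).baseChange _) (fun g => 1 ⊗ₜ gen F g)
    (algebraMap F (MvPolynomial (Fin 2) F) (1 / 2)) l m ?_ (prodAt (bracket F))
    (prodAt_der_left (der F) (bracket F) (bracket_der_left F))
    (prodAt_der_right (der F) (bracket F) (bracket_der_right F)) ?_ a b c
  · rw [← map_ofNat (algebraMap F (MvPolynomial (Fin 2) F)), ← map_mul, mul_one_div,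
      div_self two_ne_zero, map_one]
  · intro p g h
    rw [prodAt_tmul, bracket_gen, one_smul, one_smul]
    cases g <;> cases h
    all_goals
      simp only [table, absTable, evalLam_lin, LinearMap.baseChange_tmul, map_one, map_zero,
        zero_smul, zero_mul, one_mul, one_smul, add_zero, zero_add, map_ofNat, map_neg, h3]
    all_goals module

end ESV

/-- The extended Schrödinger-Virasoro conformal algebra. -/
def esv (F : Type*) [Field F] [CharZero F] : LieConformalAlgebra F (ESV F) :=
  LieConformalAlgebra.ofGenerators (ESV.der F) (ESV.bracket F) (ESV.bracket_der_left F)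
    (ESV.bracket_der_right F) (Set.range (ESV.gen F)) (ESV.generate F)
    (by
      rintro _ ⟨g, rfl⟩ _ ⟨h, rfl⟩
      rw [ESV.bracket_gen, ESV.bracket_gen, ESV.skew_gen])
    (by
      rintro _ ⟨a, rfl⟩ _ ⟨b, rfl⟩ _ ⟨c, rfl⟩ l m
      exact ESV.jacobi_gen F a b c l m)

end ExtendedSchrodingerVirasoro
end
end LieConformal

/-! Basic cohomology. Contraction ι with an element a at a parameter λ_0, and the Lie derivative ℒ
along a, satisfy Cartan's formula dι + ιd = ℒ (`cartan_fam`). Taking the coefficient of λ_0^n shows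
that each mode `lieDer a n` is homotopic to zero (`contract_dPre`). For the modes L_(1) and N_(0)
the Lie derivative is diagonal: the coefficient of λ^n ∂^k c in the value of a cochain on a tuple w
of generators is multiplied by a conformal weight, respectively a charge, depending only on (w, n,
c, k). A given cochain involves finitely many eigenvalues, so a polynomial in the Lie derivative
projects it to the zero eigenspace, and every cocycle of positive degree is cohomologous to one of
weight and charge zero (`exists_isWeightZero`).

On such cocycles there is an explicit inverse of d up to a scalar. Let h be contraction with M_(0)
followed by the matrix unit M ↦ N, minus contraction with Y_(1) followed by the matrix unit M ↦ Y
(`homotopy`). Then d h f = -2 f for every cocycle f of weight and charge zero and positive degree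
(`dPre_homotopy`). The proof is an induction on the degree. Since h anticommutes with contractions,
Cartan's formula and the induction hypothesis show that the contractions of d h f + 2 f with L_(1)
and N_(0) vanish. Counting weights and charges, a cochain of weight and charge zero killed by these
two contractions can be non-zero only on permutations of (L), (L, M), (L, Y) and (L, Y, Y)
(`IsReduced.le_three`, `eq_zero_of_isWeightZero`). On these four tuples the identity is computed by
hand (`dPre_homotopy_L`, `dPre_homotopy_LM`, `dPre_homotopy_LY`, `dPre_homotopy_LYY`). In degree
zero there is nothing of weight zero, all weights being positive.

Reduced cohomology. The operator ∂ commutes with d and is injective on cochains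
(`totalDer_injective`), so the vanishing follows by a chase along the exact sequence of basic
cochains, multiplication by ∂, and reduced cochains. The chase needs d² = 0, which is itself deduced
from Cartan's formula (`dPre_dPre`).

Casimir elements and derivations. The operator a_(0) depends only on the constant coefficients of a,
all of which can be read off from it. A derivation D satisfies D(L)_(0) = 0 because L_(0) = ∂, so
D(L) = ∂u; comparing D with L_(1), N_(0) and Y_(0) then determines all coefficients of D on
generators.

To handle parameters such as λ_0 + λ_i uniformly, cochains are extended to families of multilinear
maps over an arbitrary commutative algebra S, with parameters in S; identities of cochains are
coefficients of identities of families. -/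

namespace LieConformal

noncomputable section

/-! ### Extension of scalars and evaluation of cochains at arbitrary parameters. -/

section Extension

variable {F : Type*} [Field F] {A : Type*} [AddCommGroup A] [Module F A]
  {V : Type*} [AddCommGroup V] [Module F V]
  {S : Type*} [CommRing S] [Algebra F S] {S' : Type*} [CommRing S'] [Algebra F S']

/-- A property of families in `S ⊗ A` which is closed under sums and scalar multiples in each
argument holds if it holds for families in `A`. -/
theorem tensor_family_induction {q : ℕ} {P : (Fin q → S ⊗[F] A) → Prop}
    (pure : ∀ w : Fin q → A, P fun i => 1 ⊗ₜ w i)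
    (add : ∀ W i x y, P (Function.update W i x) → P (Function.update W i y) →
      P (Function.update W i (x + y)))
    (smul : ∀ W i (r : S) x, P (Function.update W i x) → P (Function.update W i (r • x)))
    (W : Fin q → S ⊗[F] A) : P W := by
  suffices h : ∀ (I : Finset (Fin q)) (W : Fin q → S ⊗[F] A),
      (∀ i ∉ I, ∃ a : A, W i = 1 ⊗ₜ a) → P W from h Finset.univ W (by simp)
  intro I
  induction I using Finset.induction_on with
  | empty =>
    intro W hW
    choose w hw using fun i => hW i (by simp)
    rw [show W = fun i => 1 ⊗ₜ w i from funext hw]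
    exact pure w
  | insert a I ha ih =>
    intro W hW
    have key : ∀ x : S ⊗[F] A, P (Function.update W a x) := by
      have h1 : ∀ b : A, P (Function.update W a (1 ⊗ₜ b)) := by
        intro b
        refine ih _ fun i hi => ?_
        by_cases hia : i = a
        · subst hia; exact ⟨b, by simp⟩
        · rw [Function.update_of_ne hia]
          exact hW i (by simp [hia, hi])
      intro x
      induction x with
      | zero => simpa using smul W a 0 _ (h1 0)
      | add x y hx hy => exact add W a x y hx hy
      | tmul r b =>
        have := smul W a r _ (h1 b)
        rwa [TensorProduct.smul_tmul', smul_eq_mul, mul_one] at this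
    simpa using key (W a)

theorem tensor_multilinear_ext {q : ℕ} {N : Type*} [AddCommMonoid N] [Module S N]
    {f g : MultilinearMap S (fun _ : Fin q => S ⊗[F] A) N}
    (h : ∀ w : Fin q → A, f (fun i => 1 ⊗ₜ w i) = g fun i => 1 ⊗ₜ w i) : f = g := by
  ext W
  induction W using tensor_family_induction with
  | pure w => exact h w
  | add W i x y hx hy => rw [f.map_update_add, g.map_update_add, hx, hy]
  | smul W i r x hx => rw [f.map_update_smul, g.map_update_smul, hx]

/-- `LinearMap.liftBaseChange` in `mlExt` needs compatible actions of F and S on its target, a space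
of S-multilinear maps. -/
instance {q : ℕ} : IsScalarTower F S
    (MultilinearMap S (fun _ : Fin q => S ⊗[F] A) (S ⊗[F] V)) :=
  ⟨fun r s f => MultilinearMap.ext fun W => smul_assoc r s (f W)⟩

/-- The `S`-multilinear extension of a multilinear map on `A` to `S ⊗ A`. -/
def mlExt : (q : ℕ) → MultilinearMap F (fun _ : Fin q => A) (S ⊗[F] V) →ₗ[F]
    MultilinearMap S (fun _ : Fin q => S ⊗[F] A) (S ⊗[F] V)
  | 0 =>
    { toFun := fun f => MultilinearMap.constOfIsEmpty S _ (f default)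
      map_add' := fun f g => by ext; simp
      map_smul' := fun r f => by ext; simp }
  | q + 1 =>
    { toFun := fun f => (LinearMap.liftBaseChange S (mlExt q ∘ₗ f.curryLeft)).uncurryLeft
      map_add' := fun f g => by
        refine tensor_multilinear_ext fun w => ?_
        have h : (f + g).curryLeft (w 0) = f.curryLeft (w 0) + g.curryLeft (w 0) := rfl
        simp [h]
      map_smul' := fun r f => by
        refine tensor_multilinear_ext fun w => ?_
        have h : (r • f).curryLeft (w 0) = r • f.curryLeft (w 0) := rfl
        simp [h] }

theorem mlExt_tmul : (q : ℕ) → (f : MultilinearMap F (fun _ : Fin q => A) (S ⊗[F] V)) →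
    (w : Fin q → A) → mlExt q f (fun i => (1 : S) ⊗ₜ w i) = f w
  | 0, f, w => congrArg f (Subsingleton.elim _ _)
  | q + 1, f, w => by
    have h : Fin.tail (fun i => (1 : S) ⊗ₜ[F] w i) = fun i => 1 ⊗ₜ w i.succ := rfl
    simp only [mlExt, LinearMap.coe_mk, AddHom.coe_mk, LinearMap.uncurryLeft_apply,
      LinearMap.liftBaseChange_tmul, h, one_smul, LinearMap.comp_apply, mlExt_tmul q,
      MultilinearMap.curryLeft_apply]
    congr 1
    exact Fin.cons_self_tail w

/-- The linear map `S ⊗ V → S' ⊗ V` induced by a linear map `S → S'`. -/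
def mapT (V : Type*) [AddCommGroup V] [Module F V] (c : S →ₗ[F] S') : S ⊗[F] V →ₗ[F] S' ⊗[F] V :=
  c.rTensor V

@[simp]
theorem mapT_tmul (c : S →ₗ[F] S') (r : S) (v : V) : mapT V c (r ⊗ₜ v) = c r ⊗ₜ v := rfl

theorem mapT_algHom_smul (φ : S →ₐ[F] S') (r : S) (x : S ⊗[F] V) :
    mapT V φ.toLinearMap (r • x) = φ r • mapT V φ.toLinearMap x := by
  induction x with
  | zero => simp
  | add x y hx hy => simp only [smul_add, map_add, hx, hy]
  | tmul r v => simp [TensorProduct.smul_tmul']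

/-- The hypothesis `hc` says that c is S-linear when S' is an S-module through φ. The intended case
is the inclusion φ of F[λ_1, …, λ_q] into F[λ_0, …, λ_q], with c the coefficient of a power of λ_0.
-/
theorem mapT_coef_smul (φ : S →ₐ[F] S') (c : S' →ₗ[F] S) (hc : ∀ k x, c (φ k * x) = k * c x)
    (r : S) (x : S' ⊗[F] V) : mapT V c (φ r • x) = r • mapT V c x := by
  induction x with
  | zero => simp
  | add x y hx hy => simp only [smul_add, map_add, hx, hy]
  | tmul r v => simp [TensorProduct.smul_tmul', hc]

theorem mapT_evalLam (φ : S →ₐ[F] S') (p : S) (x : F[X] ⊗[F] V) :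
    mapT V φ.toLinearMap (evalLam p x) = evalLam (φ p) x := by
  induction x with
  | zero => simp
  | add x y hx hy => simp only [map_add, hx, hy]
  | tmul r v => simp [evalLam, Polynomial.aeval_algHom_apply]

theorem mapT_prodAt (φ : S →ₐ[F] S') (act : A →ₗ[F] V →ₗ[F] F[X] ⊗[F] V) (p : S)
    (x : S ⊗[F] A) (y : S ⊗[F] V) :
    mapT V φ.toLinearMap (prodAt act p x y) =
      prodAt act (φ p) (mapT A φ.toLinearMap x) (mapT V φ.toLinearMap y) := by
  induction x with
  | zero => simp
  | add x z hx hz => simp only [map_add, LinearMap.add_apply, hx, hz]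
  | tmul r a =>
    induction y with
    | zero => simp
    | add x z hx hz => simp only [map_add, hx, hz]
    | tmul s b =>
      simp only [prodAt_tmul, mapT_algHom_smul, mapT_evalLam, mapT_tmul, AlgHom.toLinearMap_apply]

theorem mapT_coef_evalLam (φ : S →ₐ[F] S') (c : S' →ₗ[F] S) (hc : ∀ k x, c (φ k * x) = k * c x)
    (p : S) (s : S') (x : F[X] ⊗[F] V) :
    mapT V c (s • evalLam (φ p) x) = c s • evalLam p x := by
  induction x with
  | zero => simp
  | add x y hx hy => simp only [map_add, smul_add, hx, hy]
  | tmul r v =>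
    simp [evalLam, Polynomial.aeval_algHom_apply, TensorProduct.smul_tmul', mul_comm s, hc,
      mul_comm (c s)]

/-- The parameter and the first argument come from S, so the product acts on y through S-linear
operations, and c passes through. -/
theorem mapT_coef_prodAt (φ : S →ₐ[F] S') (c : S' →ₗ[F] S) (hc : ∀ k x, c (φ k * x) = k * c x)
    (act : A →ₗ[F] V →ₗ[F] F[X] ⊗[F] V) (p : S) (x : S ⊗[F] A) (y : S' ⊗[F] V) :
    mapT V c (prodAt act (φ p) (mapT A φ.toLinearMap x) y) = prodAt act p x (mapT V c y) := by
  induction x with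
  | zero => simp
  | add x z hx hz => simp only [map_add, LinearMap.add_apply, hx, hz]
  | tmul r a =>
    induction y with
    | zero => simp
    | add x z hx hz => simp only [map_add, hx, hz]
    | tmul s b =>
      simp only [prodAt_tmul, mapT_tmul, AlgHom.toLinearMap_apply, mapT_coef_smul φ c hc,
        mapT_coef_evalLam φ c hc]

/-- The `S`-multilinear extension of `w ↦ f_s(w)`. -/
def ev {q : ℕ} (f : PreCochain F A V q) (s : Fin q → S) :
    MultilinearMap S (fun _ : Fin q => S ⊗[F] A) (S ⊗[F] V) :=
  mlExt q ((subst s).compMultilinearMap f)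

theorem ev_tmul {q : ℕ} (f : PreCochain F A V q) (s : Fin q → S) (w : Fin q → A) :
    ev f s (fun i => 1 ⊗ₜ w i) = subst s (f w) := mlExt_tmul q _ w

theorem ev_add {q : ℕ} (f g : PreCochain F A V q) (s : Fin q → S) :
    ev (f + g) s = ev f s + ev g s := by
  simp only [ev, ← map_add]
  congr 1
  ext
  simp

theorem ev_smul {q : ℕ} (r : F) (f : PreCochain F A V q) (s : Fin q → S) :
    ev (r • f) s = r • ev f s := by
  simp only [ev, ← map_smul]
  congr 1
  ext
  simp

theorem mapT_subst {q : ℕ} (φ : S →ₐ[F] S') (s : Fin q → S) (x : MvPolynomial (Fin q) F ⊗[F] V) :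
    mapT V φ.toLinearMap (subst s x) = subst (φ ∘ s) x := by
  induction x with
  | zero => simp
  | add x y hx hy => simp only [map_add, hx, hy]
  | tmul r v =>
    simp only [subst, LinearMap.rTensor_tmul, AlgHom.toLinearMap_apply, mapT_tmul]
    congr 1
    rw [← AlgHom.comp_apply, MvPolynomial.comp_aeval]
    rfl

/-- Naturality in S: a statement about independent variables can be specialised to any parameters.
-/
theorem mapT_ev {q : ℕ} (φ : S →ₐ[F] S') (f : PreCochain F A V q) (s : Fin q → S)
    (W : Fin q → S ⊗[F] A) :
    mapT V φ.toLinearMap (ev f s W) = ev f (φ ∘ s) fun i => mapT A φ.toLinearMap (W i) := by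
  have hu : ∀ (W : Fin q → S ⊗[F] A) i x,
      (fun j => mapT A φ.toLinearMap (Function.update W i x j)) =
        Function.update (fun j => mapT A φ.toLinearMap (W j)) i (mapT A φ.toLinearMap x) := by
    intro W i x
    funext j
    exact Function.apply_update (fun _ => mapT A φ.toLinearMap) W i x j
  induction W using tensor_family_induction with
  | pure w => simp only [ev_tmul, mapT_tmul, AlgHom.toLinearMap_apply, map_one, mapT_subst]
  | add W i x y hx hy =>
    rw [hu] at hx hy
    rw [MultilinearMap.map_update_add, map_add, hx, hy, hu, map_add, MultilinearMap.map_update_add]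
  | smul W i r x hx =>
    rw [hu] at hx
    rw [MultilinearMap.map_update_smul, mapT_algHom_smul, hx, hu, mapT_algHom_smul,
      MultilinearMap.map_update_smul]

end Extension

/-! ### The differential on families. -/

section FormalDifferential

variable {F : Type*} [Field F] {A : Type*} [AddCommGroup A] [Module F A]
  {V : Type*} [AddCommGroup V] [Module F V] {𝔤 : LieConformalAlgebra F A} (M : LCAModule 𝔤 V)
  {S : Type*} [CommRing S] [Algebra F S] {S' : Type*} [CommRing S'] [Algebra F S']

/-- Families of multilinear maps which depend on `q` parameters in `S`. -/
abbrev Family (F A V S : Type*) [Field F] [AddCommGroup A] [Module F A] [AddCommGroup V]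
    [Module F V] [CommRing S] [Algebra F S] (q : ℕ) : Type _ :=
  (Fin q → S) → MultilinearMap S (fun _ : Fin q => S ⊗[F] A) (S ⊗[F] V)

/-- The map `W ↦ (W_k)_{s_k} E(W_0, …, Ŵ_k, …)` for a `λ`-product. -/
def actFam (act : A →ₗ[F] V →ₗ[F] F[X] ⊗[F] V) {q : ℕ} (E : Family F A V S q) (s : Fin (q + 1) → S)
    (k : Fin (q + 1)) : MultilinearMap S (fun _ : Fin (q + 1) => S ⊗[F] A) (S ⊗[F] V) :=
  LinearMap.uncurryMid k
    { toFun := fun X => (prodAt act (s k) X).compMultilinearMap (E (s ∘ k.succAbove))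
      map_add' := fun X Y => by ext; simp
      map_smul' := fun r X => by ext; simp }

theorem actFam_apply (act : A →ₗ[F] V →ₗ[F] F[X] ⊗[F] V) {q : ℕ} (E : Family F A V S q)
    (s : Fin (q + 1) → S) (k : Fin (q + 1)) (W : Fin (q + 1) → S ⊗[F] A) :
    actFam act E s k W = prodAt act (s k) (W k) (E (s ∘ k.succAbove) (W ∘ k.succAbove)) := rfl

/-- The map `W ↦ E_{s_k + s_l, …}([W_k, W_l], W_0, …, Ŵ_k, …, Ŵ_l, …)`, with `l` the `j`-th index
different from `k`. -/
def brFam (br : A →ₗ[F] A →ₗ[F] F[X] ⊗[F] A) {n : ℕ} (E : Family F A V S (n + 1))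
    (s : Fin (n + 2) → S) (k : Fin (n + 2)) (j : Fin (n + 1)) :
    MultilinearMap S (fun _ : Fin (n + 2) => S ⊗[F] A) (S ⊗[F] V) :=
  LinearMap.uncurryMid k
    { toFun := fun X => LinearMap.uncurryMid j
        ((E (Fin.cons (s k + s (k.succAbove j))
          (s ∘ k.succAbove ∘ j.succAbove))).curryLeft ∘ₗ prodAt br (s k) X)
      map_add' := fun X Y => by ext; simp [LinearMap.uncurryMid_apply]
      map_smul' := fun r X => by ext; simp [LinearMap.uncurryMid_apply] }

theorem brFam_apply (br : A →ₗ[F] A →ₗ[F] F[X] ⊗[F] A) {n : ℕ} (E : Family F A V S (n + 1))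
    (s : Fin (n + 2) → S) (k : Fin (n + 2)) (j : Fin (n + 1)) (W : Fin (n + 2) → S ⊗[F] A) :
    brFam br E s k j W = E (Fin.cons (s k + s (k.succAbove j)) (s ∘ k.succAbove ∘ j.succAbove))
      (Fin.cons (prodAt br (s k) (W k) (W (k.succAbove j))) (W ∘ k.succAbove ∘ j.succAbove)) := rfl

/-- The second sum in the differential of a family. -/
def brSumFam (br : A →ₗ[F] A →ₗ[F] F[X] ⊗[F] A) : {q : ℕ} → Family F A V S q → Family F A V S (q + 1)
  | 0, _, _ => 0
  | n + 1, E, s => ∑ k : Fin (n + 2), ∑ j : Fin (n + 1), if k ≤ j.castSucc then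
      (-1 : ℤ) ^ ((k : ℕ) + (j.succ : ℕ)) • brFam br E s k j else 0

/-- The differential of a family. -/
def dFam {q : ℕ} (E : Family F A V S q) : Family F A V S (q + 1) := fun s =>
  (∑ k : Fin (q + 1), (-1 : ℤ) ^ (k : ℕ) • actFam M.act E s k) + brSumFam 𝔤.bracket E s

theorem dFam_zero_apply (E : Family F A V S 0) (s : Fin 1 → S) (W : Fin 1 → S ⊗[F] A) :
    dFam M E s W = actFam M.act E s 0 W := by
  simp [dFam, brSumFam]

theorem dFam_succ_apply {q : ℕ} (E : Family F A V S (q + 1)) (s : Fin (q + 2) → S)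
    (W : Fin (q + 2) → S ⊗[F] A) :
    dFam M E s W = (∑ k : Fin (q + 2), (-1 : ℤ) ^ (k : ℕ) • actFam M.act E s k W) +
      ∑ k : Fin (q + 2), ∑ j : Fin (q + 1), if k ≤ j.castSucc then
        (-1 : ℤ) ^ ((k : ℕ) + (j.succ : ℕ)) • brFam 𝔤.bracket E s k j W else 0 := by
  simp only [dFam, brSumFam, add_apply, sum_apply, smul_apply]
  congr 1
  refine Finset.sum_congr rfl fun k _ => Finset.sum_congr rfl fun j _ => ?_
  split_ifs <;> rfl

/-- For k ≤ j the second index j + 1 of a bracket term is the j-th index different from k, which is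
how families record it. -/
theorem succ_eq_succAbove {n : ℕ} {k : Fin (n + 2)} {j : Fin (n + 1)} (h : k ≤ j.castSucc) :
    j.succ = k.succAbove j := (Fin.succAbove_of_le_castSucc k j h).symm

/-- Both sides are linear over the polynomial ring in the bracket z, so they need only be compared
on pure tensors, where each evaluates f on a tuple from A. -/
theorem bracketTerm_eq {n : ℕ} (f : PreCochain F A V (n + 1)) (w : Fin (n + 2) → A)
    (k : Fin (n + 2)) (j : Fin (n + 1)) (h : k ≤ j.castSucc) :
    LCAModule.bracketTerm 𝔤 f w k j = (-1 : ℤ) ^ ((k : ℕ) + (j.succ : ℕ)) •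
      brFam 𝔤.bracket (ev f) (fun i => (MvPolynomial.X i : MvPolynomial (Fin (n + 2)) F)) k j
        (fun i => 1 ⊗ₜ w i) := by
  rw [LCAModule.bracketTerm, brFam_apply, succ_eq_succAbove h]
  congr 1
  generalize prodAt 𝔤.bracket (MvPolynomial.X k : MvPolynomial (Fin (n + 2)) F) (1 ⊗ₜ[F] w k)
    (1 ⊗ₜ[F] w (k.succAbove j)) = z
  have hz : ∀ (s : Fin (n + 1) → MvPolynomial (Fin (n + 2)) F) (w' : Fin n → A),
      LinearMap.liftBaseChangeEquiv (MvPolynomial (Fin (n + 2)) F)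
        (subst s ∘ₗ LCAModule.headMap w' f) z =
      ev f s (Fin.cons z fun i => 1 ⊗ₜ w' i) := by
    intro s w'
    induction z with
    | zero =>
      rw [map_zero]
      exact ((ev f s).map_coord_zero 0 (by simp)).symm
    | add x y hx hy => rw [map_add, hx, hy, MultilinearMap.cons_add]
    | tmul r b =>
      have h1 : (Fin.cons (1 ⊗ₜ[F] b) fun i => 1 ⊗ₜ w' i :
          Fin (n + 1) → MvPolynomial (Fin (n + 2)) F ⊗[F] A) =
          fun i => 1 ⊗ₜ (Fin.cons b w' : Fin (n + 1) → A) i := by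
        funext i
        cases i using Fin.cases <;> rfl
      have h2 : r ⊗ₜ[F] b = r • (1 ⊗ₜ[F] b) := by simp [TensorProduct.smul_tmul']
      rw [h2, map_smul, MultilinearMap.cons_smul, h1, ev_tmul]
      simp [LCAModule.headMap]
  exact hz _ _

theorem d_apply {q : ℕ} (f : PreCochain F A V q) (w : Fin (q + 1) → A) :
    M.d q f w = dFam M (ev f) (fun i => (MvPolynomial.X i : MvPolynomial (Fin (q + 1)) F))
      (fun i => 1 ⊗ₜ w i) := by
  have h1 : ∀ k, M.actTerm f w k = (-1 : ℤ) ^ (k : ℕ) • actFam M.act (ev f)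
      (fun i => (MvPolynomial.X i : MvPolynomial (Fin (q + 1)) F)) k (fun i => 1 ⊗ₜ w i) := by
    intro k
    rw [actFam_apply, LCAModule.actTerm]
    congr 2
    exact (ev_tmul f _ _).symm
  change (∑ k, M.actTerm f w k) + LCAModule.bracketSum 𝔤 f w = _
  cases q with
  | zero =>
    rw [dFam_zero_apply]
    simp [LCAModule.bracketSum, h1]
  | succ n =>
    have h2 : ∀ (k : Fin (n + 2)) (j : Fin (n + 1)),
        (if k ≤ j.castSucc then LCAModule.bracketTerm 𝔤 f w k j else 0) =
        if k ≤ j.castSucc then (-1 : ℤ) ^ ((k : ℕ) + (j.succ : ℕ)) •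
          brFam 𝔤.bracket (ev f) (fun i => (MvPolynomial.X i : MvPolynomial (Fin (n + 2)) F)) k j
            (fun i => 1 ⊗ₜ w i) else 0 := by
      intro k j
      by_cases h : k ≤ j.castSucc
      · rw [if_pos h, if_pos h, bracketTerm_eq f w k j h]
      · rw [if_neg h, if_neg h]
    rw [dFam_succ_apply, Finset.sum_congr rfl fun k _ => h1 k]
    refine congrArg₂ (· + ·) rfl ?_
    exact Finset.sum_congr rfl fun k _ => Finset.sum_congr rfl fun j _ => h2 k j

theorem mapT_dFam (φ : S →ₐ[F] S') {q : ℕ} {E : Family F A V S q} {E' : Family F A V S' q}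
    (h : ∀ s W, mapT V φ.toLinearMap (E s W) =
      E' (fun i => φ (s i)) fun i => mapT A φ.toLinearMap (W i))
    (s : Fin (q + 1) → S) (W : Fin (q + 1) → S ⊗[F] A) :
    mapT V φ.toLinearMap (dFam M E s W) =
      dFam M E' (fun i => φ (s i)) fun i => mapT A φ.toLinearMap (W i) := by
  have h1 : ∀ k, mapT V φ.toLinearMap (actFam M.act E s k W) =
      actFam M.act E' (fun i => φ (s i)) k fun i => mapT A φ.toLinearMap (W i) := by
    intro k
    rw [actFam_apply, mapT_prodAt, h]
    rfl
  cases q with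
  | zero => rw [dFam_zero_apply, dFam_zero_apply, h1]
  | succ n =>
    rw [dFam_succ_apply, dFam_succ_apply]
    simp only [map_add, map_sum, map_zsmul, h1]
    congr 1
    refine Finset.sum_congr rfl fun k _ => Finset.sum_congr rfl fun j _ => ?_
    split_ifs
    · rw [map_zsmul, brFam_apply, h, brFam_apply, ← mapT_prodAt, ← map_add]
      congr 2
      · congr 1
        funext i
        cases i using Fin.cases <;> rfl
      · funext i
        cases i using Fin.cases <;> rfl
    · exact map_zero _

/-- Parameters and arguments all come from S, so only the values of E' involve S', and every term of
the differential is S-linear in those values. -/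
theorem coef_dFam (φ : S →ₐ[F] S') (c : S' →ₗ[F] S) (hc : ∀ k x, c (φ k * x) = k * c x) {q : ℕ}
    {E : Family F A V S q} {E' : Family F A V S' q}
    (h : ∀ s W, mapT V c (E' (fun i => φ (s i)) fun i => mapT A φ.toLinearMap (W i)) = E s W)
    (s : Fin (q + 1) → S) (W : Fin (q + 1) → S ⊗[F] A) :
    mapT V c (dFam M E' (fun i => φ (s i)) fun i => mapT A φ.toLinearMap (W i)) =
      dFam M E s W := by
  have h1 : ∀ k, mapT V c (actFam M.act E' (fun i => φ (s i)) k
      fun i => mapT A φ.toLinearMap (W i)) = actFam M.act E s k W := by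
    intro k
    rw [actFam_apply, mapT_coef_prodAt φ c hc, actFam_apply, ← h]
    rfl
  cases q with
  | zero => rw [dFam_zero_apply, dFam_zero_apply, h1]
  | succ n =>
    rw [dFam_succ_apply, dFam_succ_apply]
    simp only [map_add, map_sum, map_zsmul, h1]
    congr 1
    refine Finset.sum_congr rfl fun k _ => Finset.sum_congr rfl fun j _ => ?_
    split_ifs
    · rw [map_zsmul, brFam_apply, brFam_apply, ← mapT_prodAt, ← map_add, ← h]
      congr 3
      · congr 1
        funext i
        cases i using Fin.cases <;> rfl
      · funext i
        cases i using Fin.cases <;> rfl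
    · exact map_zero _

/-- The differential of a cochain, as a multilinear map. -/
def dPre {q : ℕ} (f : PreCochain F A V q) : PreCochain F A V (q + 1) :=
  ((dFam M (ev f) fun i => (MvPolynomial.X i : MvPolynomial (Fin (q + 1)) F)).restrictScalars
    F).compLinearMap fun _ => TensorProduct.mk F _ A 1

theorem dPre_apply {q : ℕ} (f : PreCochain F A V q) (w : Fin (q + 1) → A) :
    dPre M f w = M.d q f w := (d_apply M f w).symm

/-- The differential of f is defined at the generic point, with the variables as parameters;
substituting λ_i ↦ s_i and using naturality gives it at every s. -/
theorem ev_dPre {q : ℕ} (f : PreCochain F A V q) : (ev (dPre M f) : Family F A V S (q + 1)) =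
    dFam M (ev f) := by
  funext s
  refine tensor_multilinear_ext fun w => ?_
  rw [ev_tmul, dPre_apply, d_apply]
  have h := mapT_dFam M (MvPolynomial.aeval s : MvPolynomial (Fin (q + 1)) F →ₐ[F] S)
    (E := ev f) (E' := ev f) (fun s W => mapT_ev _ f s W) (fun i => MvPolynomial.X i)
    (fun i => 1 ⊗ₜ w i)
  simp only [MvPolynomial.aeval_X, mapT_tmul, AlgHom.toLinearMap_apply, map_one] at h
  exact h

end FormalDifferential

end
end LieConformal

namespace LieConformal

noncomputable section

/-! ### The Lie derivative and Cartan's formula for families. -/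

section Cartan

variable {F : Type*} [Field F] {A : Type*} [AddCommGroup A] [Module F A]
  {V : Type*} [AddCommGroup V] [Module F V] {𝔤 : LieConformalAlgebra F A} (M : LCAModule 𝔤 V)
  {S : Type*} [CommRing S] [Algebra F S] {S' : Type*} [CommRing S'] [Algebra F S']

theorem tmul_eq_smul_one_tmul (r : S) (v : V) : r ⊗ₜ[F] v = r • (1 ⊗ₜ[F] v) := by
  rw [TensorProduct.smul_tmul', smul_eq_mul, mul_one]

/-- The module axiom lives over F[λ, μ]. Substituting λ ↦ t and μ ↦ p, and extending S-linearly in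
the three arguments, moves it to arbitrary parameters. -/
theorem LCAModule.act_act_prodAt (t p : S) (Z X : S ⊗[F] A) (v : S ⊗[F] V) :
    prodAt M.act t Z (prodAt M.act p X v) =
      prodAt M.act (t + p) (prodAt 𝔤.bracket t Z X) v +
        prodAt M.act p X (prodAt M.act t Z v) := by
  have h : ∀ a b u, prodAt M.act t (1 ⊗ₜ a) (prodAt M.act p (1 ⊗ₜ b) (1 ⊗ₜ u)) =
      prodAt M.act (t + p) (prodAt 𝔤.bracket t (1 ⊗ₜ a) (1 ⊗ₜ b)) (1 ⊗ₜ u) +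
        prodAt M.act p (1 ⊗ₜ b) (prodAt M.act t (1 ⊗ₜ a) (1 ⊗ₜ u)) := by
    intro a b u
    have h := congrArg (mapT V (MvPolynomial.aeval ![t, p] : MvPolynomial (Fin 2) F →ₐ[F]
      S).toLinearMap) (M.act_act a b u)
    simp only [map_sub, mapT_prodAt, mapT_tmul, AlgHom.toLinearMap_apply, map_one, lam, mu,
      MvPolynomial.aeval_X, map_add, Matrix.cons_val_zero, Matrix.cons_val_one] at h
    rw [← h]
    abel
  induction Z with
  | zero => simp
  | add x y hx hy => simp only [map_add, LinearMap.add_apply, hx, hy]; abel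
  | tmul r a =>
    induction X with
    | zero => simp
    | add x y hx hy => simp only [map_add, LinearMap.add_apply, hx, hy]; abel
    | tmul r' b =>
      induction v with
      | zero => simp
      | add x y hx hy => simp only [map_add, hx, hy]; abel
      | tmul r'' u =>
        rw [tmul_eq_smul_one_tmul r, tmul_eq_smul_one_tmul r', tmul_eq_smul_one_tmul r'']
        simp only [map_smul, LinearMap.smul_apply, h, smul_add, smul_comm r r']

/-- The contraction of a family with `Z` at the parameter `t`. -/
def contractFam (t : S) (Z : S ⊗[F] A) {q : ℕ} (E : Family F A V S (q + 1)) : Family F A V S q :=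
  fun s => (E (Fin.cons t s)).curryLeft Z

theorem contractFam_apply (t : S) (Z : S ⊗[F] A) {q : ℕ} (E : Family F A V S (q + 1))
    (s : Fin q → S) (W : Fin q → S ⊗[F] A) :
    contractFam t Z E s W = E (Fin.cons t s) (Fin.cons Z W) := rfl

/-- The Lie derivative of a family along `Z` at the parameter `t`. -/
def lieFam (t : S) (Z : S ⊗[F] A) {q : ℕ} (E : Family F A V S q) : Family F A V S q :=
  fun s => (prodAt M.act t Z).compMultilinearMap (E s) -
    ∑ i, (E (Function.update s i (t + s i))).compLinearMap
      (Function.update (fun _ => LinearMap.id) i (prodAt 𝔤.bracket t Z))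

theorem lieFam_apply (t : S) (Z : S ⊗[F] A) {q : ℕ} (E : Family F A V S q)
    (s : Fin q → S) (W : Fin q → S ⊗[F] A) :
    lieFam M t Z E s W = prodAt M.act t Z (E s W) -
      ∑ i, E (Function.update s i (t + s i))
        (Function.update W i (prodAt 𝔤.bracket t Z (W i))) := by
  simp only [lieFam, sub_apply, sum_apply, MultilinearMap.compLinearMap_apply,
    LinearMap.compMultilinearMap_apply]
  congr 1
  refine Finset.sum_congr rfl fun i _ => congrArg _ (funext fun j => ?_)
  by_cases h : j = i
  · subst h; simp
  · simp [Function.update_of_ne h]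

theorem update_succAbove_comp {α : Type*} {n : ℕ} (f : Fin (n + 1) → α) (k : Fin (n + 1))
    (j : Fin n) (x : α) : Function.update f (k.succAbove j) x ∘ k.succAbove =
      Function.update (f ∘ k.succAbove) j x :=
  Function.update_comp_eq_of_injective f Fin.succAbove_right_injective j x

theorem update_self_comp_succAbove {α : Type*} {n : ℕ} (f : Fin (n + 1) → α) (k : Fin (n + 1))
    (x : α) : Function.update f k x ∘ k.succAbove = f ∘ k.succAbove :=
  Function.update_comp_eq_of_notMem_range f x (by simp)

/-- The slot k summand of the Lie derivative is the bracket term of the module identity for t and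
s_k; the other slots lie inside E. -/
theorem lieFam_actFam (t : S) (Z : S ⊗[F] A) {q : ℕ} (E : Family F A V S q)
    (s : Fin (q + 1) → S) (k : Fin (q + 1)) (W : Fin (q + 1) → S ⊗[F] A) :
    lieFam M t Z (fun s => actFam M.act E s k) s W = actFam M.act (lieFam M t Z E) s k W := by
  rw [lieFam_apply, Fin.sum_univ_succAbove _ k, actFam_apply, actFam_apply, actFam_apply,
    lieFam_apply, map_sub, map_sum, update_self_comp_succAbove, update_self_comp_succAbove,
    Function.update_self, Function.update_self, M.act_act_prodAt]
  simp only [actFam_apply, update_succAbove_comp,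
    Function.update_of_ne (Fin.ne_succAbove k _)]
  simp only [Function.comp_apply]
  abel

/-- The Jacobi identity merges the summands of the two bracketed slots into the bracket of Z with
[W_k, W_l], whose parameter is t + s_k + s_l in each case. -/
theorem lieFam_brFam (t : S) (Z : S ⊗[F] A) {q : ℕ} (E : Family F A V S (q + 1))
    (s : Fin (q + 2) → S) (k : Fin (q + 2)) (j : Fin (q + 1)) (W : Fin (q + 2) → S ⊗[F] A) :
    lieFam M t Z (fun s => brFam 𝔤.bracket E s k j) s W =
      brFam 𝔤.bracket (lieFam M t Z E) s k j W := by
  have hc : ∀ x, Function.update s k x ∘ k.succAbove ∘ j.succAbove = s ∘ k.succAbove ∘ j.succAbove :=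
    fun x => congrArg (· ∘ j.succAbove) (update_self_comp_succAbove s k x)
  have hc' : ∀ x, Function.update W k x ∘ k.succAbove ∘ j.succAbove =
      W ∘ k.succAbove ∘ j.succAbove :=
    fun x => congrArg (· ∘ j.succAbove) (update_self_comp_succAbove W k x)
  have hc1 : ∀ x, Function.update s (k.succAbove j) x ∘ k.succAbove ∘ j.succAbove =
      s ∘ k.succAbove ∘ j.succAbove := by
    intro x
    rw [← Function.comp_assoc, update_succAbove_comp, update_self_comp_succAbove,
      Function.comp_assoc]
  have hc1' : ∀ x, Function.update W (k.succAbove j) x ∘ k.succAbove ∘ j.succAbove =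
      W ∘ k.succAbove ∘ j.succAbove := by
    intro x
    rw [← Function.comp_assoc, update_succAbove_comp, update_self_comp_succAbove,
      Function.comp_assoc]
  have hc2 : ∀ i x, Function.update s (k.succAbove (j.succAbove i)) x ∘ k.succAbove ∘ j.succAbove =
      Function.update (s ∘ k.succAbove ∘ j.succAbove) i x := by
    intro i x
    rw [← Function.comp_assoc, update_succAbove_comp, update_succAbove_comp, Function.comp_assoc]
  have hc2' : ∀ i x, Function.update W (k.succAbove (j.succAbove i)) x ∘ k.succAbove ∘ j.succAbove =
      Function.update (W ∘ k.succAbove ∘ j.succAbove) i x := by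
    intro i x
    rw [← Function.comp_assoc, update_succAbove_comp, update_succAbove_comp, Function.comp_assoc]
  have hne : ∀ i, j ≠ j.succAbove i := fun i => Fin.ne_succAbove j i
  have jac := 𝔤.adjoint.act_act_prodAt t (s k) Z (W k) (W (k.succAbove j))
  change prodAt 𝔤.bracket t Z (prodAt 𝔤.bracket (s k) (W k) (W (k.succAbove j))) =
    prodAt 𝔤.bracket (t + s k) (prodAt 𝔤.bracket t Z (W k)) (W (k.succAbove j)) +
      prodAt 𝔤.bracket (s k) (W k) (prodAt 𝔤.bracket t Z (W (k.succAbove j))) at jac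
  rw [lieFam_apply, Fin.sum_univ_succAbove _ k, Fin.sum_univ_succAbove _ j, brFam_apply,
    brFam_apply (E := lieFam M t Z E), lieFam_apply, Fin.sum_univ_succ]
  simp only [brFam_apply, hc, hc1, hc2, hc', hc1', hc2', Function.update_self,
    Function.update_of_ne (Fin.ne_succAbove k _), Function.update_of_ne (Fin.succAbove_ne k _),
    (Fin.succAbove_right_injective (p := k)).ne (hne _),
    Function.update_of_ne ((Fin.succAbove_right_injective (p := k)).ne (hne _)), ← add_assoc,
    Fin.cons_zero, Fin.cons_succ, Fin.update_cons_zero, ← Fin.cons_update, jac,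
    MultilinearMap.cons_add, add_left_comm (s k) t]
  rw [add_comm t (s k)]
  simp only [Function.comp_apply]

theorem zsmul_multilinear_apply {q : ℕ} (r : ℤ)
    (f : MultilinearMap S (fun _ : Fin q => S ⊗[F] A) (S ⊗[F] V)) (W : Fin q → S ⊗[F] A) :
    (r • f) W = r • f W := rfl

/-- The commutation holds term by term. It needs neither skew-symmetry nor d² = 0, which is later
deduced from it. -/
theorem lieFam_dFam (t : S) (Z : S ⊗[F] A) {q : ℕ} (E : Family F A V S q) :
    lieFam M t Z (dFam M E) = dFam M (lieFam M t Z E) := by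
  funext s
  ext W
  have hadd : ∀ {n : ℕ} (G G' : Family F A V S n) s W,
      lieFam M t Z (fun s => G s + G' s) s W = lieFam M t Z G s W + lieFam M t Z G' s W := by
    intro n G G' s W
    simp only [lieFam_apply, add_apply, map_add, Finset.sum_add_distrib]
    abel
  have hsmul : ∀ {n : ℕ} (r : ℤ) (G : Family F A V S n) s W,
      lieFam M t Z (fun s => r • G s) s W = r • lieFam M t Z G s W := by
    intro n r G s W
    simp only [lieFam_apply, zsmul_multilinear_apply, map_zsmul, Finset.smul_sum, smul_sub]
  have hzero : ∀ {n : ℕ} s W, lieFam M t Z (fun _ => 0 : Family F A V S n) s W = 0 := by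
    intro n s W
    simp [lieFam_apply]
  have hsum : ∀ {n : ℕ} {ι : Type} (I : Finset ι) (G : ι → Family F A V S n) s W,
      lieFam M t Z (fun s => ∑ i ∈ I, G i s) s W = ∑ i ∈ I, lieFam M t Z (G i) s W := by
    intro n ι I G s W
    induction I using Finset.cons_induction with
    | empty => simpa using hzero s W
    | cons a I ha ih => simp only [Finset.sum_cons, hadd, ih]
  unfold dFam
  rw [hadd, hsum]
  simp only [hsmul, lieFam_actFam, add_apply, sum_apply, zsmul_multilinear_apply]
  congr 1
  cases q with
  | zero => exact hzero s W
  | succ n =>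
    refine (hsum Finset.univ (fun k s => ∑ j : Fin (n + 1), if k ≤ j.castSucc then
      (-1 : ℤ) ^ ((k : ℕ) + (j.succ : ℕ)) • brFam 𝔤.bracket E s k j else 0) s W).trans ?_
    simp only [hsum, brSumFam, sum_apply]
    refine Finset.sum_congr rfl fun k _ => Finset.sum_congr rfl fun j _ => ?_
    by_cases h : k ≤ j.castSucc
    · simp only [if_pos h, hsmul, lieFam_brFam, zsmul_multilinear_apply]
    · simp only [if_neg h, hzero, zero_apply]

/-- Skew-symmetry of a family under simultaneous permutations of parameters and arguments. -/
def SkewFam {q : ℕ} (E : Family F A V S q) : Prop :=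
  ∀ (σ : Equiv.Perm (Fin q)) s W, E (s ∘ σ) (W ∘ σ) = (Equiv.Perm.sign σ : ℤ) • E s W

theorem skewFam_ev {q : ℕ} {f : PreCochain F A V q} (hf : f ∈ M.cochains q) :
    SkewFam (ev f : Family F A V S q) := by
  intro σ s W
  have h : (ev f (s ∘ σ)).domDomCongr σ = (Equiv.Perm.sign σ : ℤ) • ev f s := by
    refine tensor_multilinear_ext fun w => ?_
    change ev f (s ∘ σ) (fun i => 1 ⊗ₜ (w ∘ σ) i) =
      (Equiv.Perm.sign σ : ℤ) • ev f s (fun i => 1 ⊗ₜ w i)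
    rw [ev_tmul]
    rw [ev_tmul, ← map_zsmul, ← hf.2 σ w]
    generalize f (w ∘ σ) = y
    induction y with
    | zero => simp
    | add x y hx hy => simp only [map_add, hx, hy]
    | tmul r v =>
      simp only [subst, LinearMap.rTensor_tmul, AlgHom.toLinearMap_apply]
      congr 1
      rw [← AlgHom.comp_apply, MvPolynomial.comp_aeval]
      simp only [MvPolynomial.aeval_X]
      rfl
  exact congrArg (fun g => g W) h

/-- Replacing the k-th entry and moving it to the front is a cycle, of sign (-1)^k; this is the
origin of the signs in the differential. -/
theorem cons_comp_succAbove_eq {α : Type*} {q : ℕ} (f : Fin (q + 1) → α) (k : Fin (q + 1)) (x : α) :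
    (Fin.cons x (f ∘ k.succAbove) : Fin (q + 1) → α) =
      Function.update f k x ∘ k.cycleRange.symm := by
  funext i
  cases i using Fin.cases with
  | zero => simp [Fin.cycleRange_symm_zero]
  | succ i =>
    rw [Fin.cons_succ, Function.comp_apply, Function.comp_apply, Fin.cycleRange_symm_succ,
      Function.update_of_ne (Fin.succAbove_ne k i)]

theorem SkewFam.cons_succAbove {q : ℕ} {E : Family F A V S (q + 1)} (hE : SkewFam E)
    (s : Fin (q + 1) → S) (W : Fin (q + 1) → S ⊗[F] A) (k : Fin (q + 1)) (t : S) (Z : S ⊗[F] A) :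
    E (Fin.cons t (s ∘ k.succAbove)) (Fin.cons Z (W ∘ k.succAbove)) =
      (-1 : ℤ) ^ (k : ℕ) • E (Function.update s k t) (Function.update W k Z) := by
  rw [cons_comp_succAbove_eq, cons_comp_succAbove_eq, hE, Equiv.Perm.sign_symm,
    Fin.sign_cycleRange]
  simp

theorem cons_cons_comp_one_succAbove {α : Type*} {q : ℕ} (f : Fin q → α) (x y z : α) :
    (Fin.cons x ((Fin.cons y (Fin.cons z f) : Fin (q + 2) → α) ∘ (1 : Fin (q + 2)).succAbove) :
      Fin (q + 2) → α) = Fin.cons x (Fin.cons y f) := by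
  funext i
  cases i using Fin.cases with
  | zero => rfl
  | succ i => cases i using Fin.cases <;> rfl

theorem SkewFam.swap_cons {q : ℕ} {E : Family F A V S (q + 2)} (hE : SkewFam E) (s : Fin q → S)
    (W : Fin q → S ⊗[F] A) (t t' : S) (Z Z' : S ⊗[F] A) :
    E (Fin.cons t (Fin.cons t' s)) (Fin.cons Z (Fin.cons Z' W)) =
      -E (Fin.cons t' (Fin.cons t s)) (Fin.cons Z' (Fin.cons Z W)) := by
  have h := hE.cons_succAbove (Fin.cons t' (Fin.cons t s)) (Fin.cons Z' (Fin.cons Z W)) 1 t Z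
  rw [cons_cons_comp_one_succAbove, cons_cons_comp_one_succAbove,
    show Function.update (Fin.cons t' (Fin.cons t s) : Fin (q + 2) → S) 1 t =
      Fin.cons t' (Fin.cons t s) from Function.update_eq_self_iff.2 rfl,
    show Function.update (Fin.cons Z' (Fin.cons Z W) : Fin (q + 2) → S ⊗[F] A) 1 Z =
      Fin.cons Z' (Fin.cons Z W) from Function.update_eq_self_iff.2 rfl] at h
  rw [h]
  simp

theorem cons_comp_succ_succAbove {α : Type*} {q : ℕ} (f : Fin (q + 1) → α) (x : α)
    (k : Fin (q + 1)) : (Fin.cons x f : Fin (q + 2) → α) ∘ k.succ.succAbove =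
      Fin.cons x (f ∘ k.succAbove) := by
  funext i
  cases i using Fin.cases <;> simp

/-- Cartan's formula. -/
theorem cartan_fam {q : ℕ} {E : Family F A V S (q + 1)} (hE : SkewFam E) (t : S) (Z : S ⊗[F] A)
    (s : Fin (q + 1) → S) (W : Fin (q + 1) → S ⊗[F] A) :
    dFam M E (Fin.cons t s) (Fin.cons Z W) + dFam M (contractFam t Z E) s W =
      lieFam M t Z E s W := by
  have h0 : actFam M.act E (Fin.cons t s) 0 (Fin.cons Z W) = prodAt M.act t Z (E s W) := rfl
  have h1 : ∀ k : Fin (q + 1), actFam M.act E (Fin.cons t s) k.succ (Fin.cons Z W) =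
      actFam M.act (contractFam t Z E) s k W := by
    intro k
    rw [actFam_apply, actFam_apply, contractFam_apply, cons_comp_succ_succAbove,
      cons_comp_succ_succAbove]
    rfl
  -- The bracket terms with k = 0 pair Z with each W_j. Moving the bracket from the front to slot j
  -- costs (-1)^j, which against the sign (-1)^(j + 1) of the differential leaves the -1 of the Lie
  -- derivative.
  have h2 : ∀ j : Fin (q + 1), brFam 𝔤.bracket E (Fin.cons t s) 0 j (Fin.cons Z W) =
      (-1 : ℤ) ^ (j : ℕ) • E (Function.update s j (t + s j))
        (Function.update W j (prodAt 𝔤.bracket t Z (W j))) := by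
    intro j
    rw [← hE.cons_succAbove]
    rfl
  rw [dFam_succ_apply, lieFam_apply, Fin.sum_univ_succ, Fin.sum_univ_succ
    (n := q + 1) (f := fun k => ∑ j : Fin (q + 1), _)]
  simp only [h0, h1, h2, Fin.zero_le, if_true, Fin.val_zero, pow_zero, one_smul, Fin.val_succ,
    zero_add, smul_smul, ← pow_add]
  have hodd : ∀ j : ℕ, (-1 : ℤ) ^ (j + 1 + j) = -1 := fun j => Odd.neg_one_pow ⟨j, by ring⟩
  have hsucc : ∀ k : Fin (q + 1), (-1 : ℤ) ^ ((k : ℕ) + 1) = -(-1) ^ (k : ℕ) := fun k => by ring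
  simp only [hodd, hsucc, neg_smul, one_smul,
    Finset.sum_neg_distrib]
  cases q with
  | zero =>
    have h3 : ∀ (x : Fin 1) (y : Fin 1), ¬ x.succ ≤ y.castSucc := by decide
    rw [dFam_zero_apply]
    simp [h3]
    abel
  | succ n =>
    -- In the remaining bracket terms Z stands directly behind the bracket. The transposition that
    -- brings it to the front gives the sign by which they cancel against the differential of the
    -- contraction.
    have h4 : ∀ (k : Fin (n + 2)) (j : Fin (n + 1)),
        brFam 𝔤.bracket E (Fin.cons t s) k.succ j.succ (Fin.cons Z W) =
          -brFam 𝔤.bracket (contractFam t Z E) s k j W := by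
      intro k j
      rw [brFam_apply, brFam_apply, contractFam_apply]
      rw [← Function.comp_assoc, cons_comp_succ_succAbove, cons_comp_succ_succAbove,
        ← Function.comp_assoc, cons_comp_succ_succAbove, cons_comp_succ_succAbove,
        Function.comp_assoc, Function.comp_assoc]
      simp only [Fin.succ_succAbove_succ, Fin.cons_succ]
      rw [hE.swap_cons]
    have h5 : ∀ k : Fin (n + 2), ¬ k.succ ≤ (0 : Fin (n + 2)).castSucc := by
      intro k
      simp [Fin.le_def]
    have h6 : ∀ (k : Fin (n + 2)) (j : Fin (n + 1)),
        k.succ ≤ j.succ.castSucc ↔ k ≤ j.castSucc := by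
      intro k j
      simp [Fin.le_def]
    rw [dFam_succ_apply]
    have h7 : ∀ k : Fin (n + 2), (∑ j : Fin (n + 2), if k.succ ≤ j.castSucc then
        (-1 : ℤ) ^ ((k : ℕ) + 1 + ((j : ℕ) + 1)) •
          brFam 𝔤.bracket E (Fin.cons t s) k.succ j (Fin.cons Z W) else 0) =
        -∑ j : Fin (n + 1), if k ≤ j.castSucc then
          (-1 : ℤ) ^ ((k : ℕ) + (j.succ : ℕ)) •
            brFam 𝔤.bracket (contractFam t Z E) s k j W else 0 := by
      intro k
      rw [Fin.sum_univ_succ, if_neg (h5 k), zero_add, ← Finset.sum_neg_distrib]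
      refine Finset.sum_congr rfl fun j _ => ?_
      simp only [h6, h4]
      split_ifs
      · rw [Fin.val_succ, smul_neg, show (k : ℕ) + 1 + ((j : ℕ) + 1 + 1) = k + (j + 1) + 2 by ring,
          pow_add _ _ 2]
        simp
      · simp
    rw [Finset.sum_congr rfl fun k _ => h7 k, Finset.sum_neg_distrib]
    abel

end Cartan
end
end LieConformal

namespace LieConformal

noncomputable section

/-! ### Coefficients of λ_0: modes of contractions and of Lie derivatives. -/

section Coefficients

variable {F : Type*} [Field F] {A : Type*} [AddCommGroup A] [Module F A]
  {V : Type*} [AddCommGroup V] [Module F V] {𝔤 : LieConformalAlgebra F A} (M : LCAModule 𝔤 V)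
  {S : Type*} [CommRing S] [Algebra F S] {S' : Type*} [CommRing S'] [Algebra F S']

/-- The coefficient of the `n`-th power of the first variable. -/
def headCoeff (F : Type*) [Field F] {q : ℕ} (n : ℕ) :
    MvPolynomial (Fin (q + 1)) F →ₗ[F] MvPolynomial (Fin q) F :=
  (Polynomial.lcoeff (MvPolynomial (Fin q) F) n).restrictScalars F ∘ₗ
    (MvPolynomial.finSuccEquiv F q).toLinearMap

/-- The inclusion of `F[λ_1, …, λ_q]` into `F[λ_0, …, λ_q]`. -/
abbrev tailHom (F : Type*) [Field F] (q : ℕ) :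
    MvPolynomial (Fin q) F →ₐ[F] MvPolynomial (Fin (q + 1)) F := MvPolynomial.rename Fin.succ

theorem finSuccEquiv_tailHom {q : ℕ} (p : MvPolynomial (Fin q) F) :
    MvPolynomial.finSuccEquiv F q (tailHom F q p) = Polynomial.C p := by
  induction p using MvPolynomial.induction_on with
  | C r => simp [MvPolynomial.finSuccEquiv_apply]
  | add x y hx hy => simp only [map_add, hx, hy]
  | mul_X x i hx =>
    simp only [map_mul, hx, MvPolynomial.rename_X, MvPolynomial.finSuccEquiv_X_succ]

theorem headCoeff_tailHom_mul {q : ℕ} (n : ℕ) (k : MvPolynomial (Fin q) F)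
    (x : MvPolynomial (Fin (q + 1)) F) :
    headCoeff F n (tailHom F q k * x) = k * headCoeff F n x := by
  simp [headCoeff, -MvPolynomial.finSuccEquiv_rename_finSuccEquiv, finSuccEquiv_tailHom]

/-- The substitution fixes λ_0 and changes only the other variables. Viewed as polynomials in λ_0,
both sides come from algebra homomorphisms that agree on the variables. -/
theorem headCoeff_aeval_cons {q m : ℕ} (n : ℕ) (s : Fin q → MvPolynomial (Fin m) F)
    (p : MvPolynomial (Fin (q + 1)) F) :
    headCoeff F n (MvPolynomial.aeval (Fin.cons (MvPolynomial.X 0) fun i => tailHom F m (s i) :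
      Fin (q + 1) → MvPolynomial (Fin (m + 1)) F) p) = MvPolynomial.aeval s (headCoeff F n p) := by
  have h : ((MvPolynomial.finSuccEquiv F m).toAlgHom.comp
      (MvPolynomial.aeval (Fin.cons (MvPolynomial.X 0) fun i => tailHom F m (s i) :
        Fin (q + 1) → MvPolynomial (Fin (m + 1)) F))) =
      (Polynomial.mapAlgHom (MvPolynomial.aeval s)).comp
        (MvPolynomial.finSuccEquiv F q).toAlgHom := by
    refine MvPolynomial.algHom_ext fun i => ?_
    cases i using Fin.cases with
    | zero => simp [MvPolynomial.finSuccEquiv_X_zero]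
    | succ i =>
      change MvPolynomial.finSuccEquiv F m (MvPolynomial.aeval _ (MvPolynomial.X i.succ)) =
        Polynomial.mapAlgHom (MvPolynomial.aeval s)
          (MvPolynomial.finSuccEquiv F q (MvPolynomial.X i.succ))
      rw [MvPolynomial.aeval_X, Fin.cons_succ, finSuccEquiv_tailHom,
        MvPolynomial.finSuccEquiv_X_succ]
      simp
  have h1 := congrArg (fun r => r.coeff n) (AlgHom.congr_fun h p)
  simpa [headCoeff] using h1

/-- The variables `λ_1, …, λ_q` of `F[λ_0, …, λ_q]`. -/
abbrev tailVars (F : Type*) [Field F] (q : ℕ) : Fin q → MvPolynomial (Fin (q + 1)) F :=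
  fun i => MvPolynomial.X i.succ

/-- The cochain whose values are the coefficients of the `n`-th power of the first variable. -/
def coefPre {q : ℕ} (n : ℕ) (g : MultilinearMap (MvPolynomial (Fin (q + 1)) F)
    (fun _ : Fin q => MvPolynomial (Fin (q + 1)) F ⊗[F] A) (MvPolynomial (Fin (q + 1)) F ⊗[F] V)) :
    PreCochain F A V q :=
  (mapT V (headCoeff F n)).compMultilinearMap
    ((g.restrictScalars F).compLinearMap fun _ => TensorProduct.mk F _ A 1)

theorem coefPre_apply {q : ℕ} (n : ℕ) (g : MultilinearMap (MvPolynomial (Fin (q + 1)) F)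
    (fun _ : Fin q => MvPolynomial (Fin (q + 1)) F ⊗[F] A) (MvPolynomial (Fin (q + 1)) F ⊗[F] V))
    (w : Fin q → A) : coefPre n g w = mapT V (headCoeff F n) (g fun i => 1 ⊗ₜ w i) := rfl

theorem mapT_headCoeff_aeval {q m : ℕ} (n : ℕ) (s : Fin q → MvPolynomial (Fin m) F)
    (x : MvPolynomial (Fin (q + 1)) F ⊗[F] V) :
    mapT V (headCoeff F n) (mapT V (MvPolynomial.aeval (Fin.cons (MvPolynomial.X 0)
      fun i => tailHom F m (s i) : Fin (q + 1) → MvPolynomial (Fin (m + 1)) F)).toLinearMap x) =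
      subst s (mapT V (headCoeff F n) x) := by
  induction x with
  | zero => simp
  | add x y hx hy => simp only [map_add, hx, hy]
  | tmul r v =>
    simp only [mapT_tmul, AlgHom.toLinearMap_apply, subst, LinearMap.rTensor_tmul,
      headCoeff_aeval_cons]

/-- The coefficients at the generic tail variables determine those at all parameters free of λ_0:
`h` supplies the substitution on tuples from A, and taking a coefficient is linear over the ring of
tail variables. -/
theorem ev_coefPre {q m : ℕ} (n : ℕ) {E : Family F A V (MvPolynomial (Fin (q + 1)) F) q}
    {E' : Family F A V (MvPolynomial (Fin (m + 1)) F) q} (s : Fin q → MvPolynomial (Fin m) F)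
    (h : ∀ w : Fin q → A, mapT V (MvPolynomial.aeval (Fin.cons (MvPolynomial.X 0)
      fun i => tailHom F m (s i) : Fin (q + 1) → MvPolynomial (Fin (m + 1)) F)).toLinearMap
        (E (tailVars F q) fun i => 1 ⊗ₜ w i) = E' (fun i => tailHom F m (s i)) fun i => 1 ⊗ₜ w i)
    (W : Fin q → MvPolynomial (Fin m) F ⊗[F] A) :
    mapT V (headCoeff F n) (E' (fun i => tailHom F m (s i))
      fun i => mapT A (tailHom F m).toLinearMap (W i)) = ev (coefPre n (E (tailVars F q))) s W := by
  have hu : ∀ (W : Fin q → MvPolynomial (Fin m) F ⊗[F] A) i x,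
      (fun j => mapT A (tailHom F m).toLinearMap (Function.update W i x j)) =
        Function.update (fun j => mapT A (tailHom F m).toLinearMap (W j)) i
          (mapT A (tailHom F m).toLinearMap x) := by
    intro W i x
    funext j
    exact Function.apply_update (fun _ => mapT A (tailHom F m).toLinearMap) W i x j
  induction W using tensor_family_induction with
  | pure w =>
    simp only [mapT_tmul, AlgHom.toLinearMap_apply, map_one]
    rw [← h, mapT_headCoeff_aeval, ev_tmul, coefPre_apply]
  | add W i x y hx hy =>
    rw [hu] at hx hy
    rw [hu, map_add, MultilinearMap.map_update_add, map_add, hx, hy,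
      MultilinearMap.map_update_add]
  | smul W i r x hx =>
    rw [hu] at hx
    rw [hu, mapT_algHom_smul, MultilinearMap.map_update_smul,
      mapT_coef_smul _ _ (headCoeff_tailHom_mul n), hx, MultilinearMap.map_update_smul]

theorem subst_X {q : ℕ} (x : MvPolynomial (Fin q) F ⊗[F] V) :
    subst (fun i => (MvPolynomial.X i : MvPolynomial (Fin q) F)) x = x := by
  induction x with
  | zero => simp
  | add x y hx hy => simp only [map_add, hx, hy]
  | tmul r v => simp [subst]

/-- The `n`-th coefficient of the contraction of a cochain with `a`. -/
def contract (a : A) (n : ℕ) {q : ℕ} : PreCochain F A V (q + 1) →ₗ[F] PreCochain F A V q where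
  toFun f := coefPre n (contractFam (MvPolynomial.X 0) (1 ⊗ₜ a) (ev f) (tailVars F q))
  map_add' f g := by ext w; simp [coefPre_apply, contractFam_apply, ev_add]
  map_smul' r f := by ext w; simp [coefPre_apply, contractFam_apply, ev_smul]

theorem cons_tmul {q : ℕ} (a : A) (w : Fin q → A) :
    (Fin.cons (1 ⊗ₜ a) fun i => 1 ⊗ₜ w i : Fin (q + 1) → S ⊗[F] A) =
      fun i => 1 ⊗ₜ (Fin.cons a w : Fin (q + 1) → A) i := by
  funext i
  cases i using Fin.cases <;> rfl

theorem contract_apply (a : A) (n : ℕ) {q : ℕ} (f : PreCochain F A V (q + 1)) (w : Fin q → A) :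
    contract a n f w = mapT V (headCoeff F n) (f (Fin.cons a w)) := by
  change coefPre n _ w = _
  have h : (Fin.cons (MvPolynomial.X 0) (tailVars F q) : Fin (q + 1) → MvPolynomial _ F) =
      fun i => MvPolynomial.X i := by
    funext i
    cases i using Fin.cases <;> rfl
  rw [coefPre_apply, contractFam_apply, cons_tmul, ev_tmul, h, subst_X]

/-- The `n`-th coefficient of the Lie derivative of a cochain along `a`. -/
def lieDer (a : A) (n : ℕ) {q : ℕ} : PreCochain F A V q →ₗ[F] PreCochain F A V q where
  toFun f := coefPre n (lieFam M (MvPolynomial.X 0) (1 ⊗ₜ a) (ev f) (tailVars F q))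
  map_add' f g := by
    ext w
    simp only [coefPre_apply, lieFam_apply, ev_add, add_apply, map_add, map_sub,
      Finset.sum_add_distrib]
    abel
  map_smul' r f := by
    ext w
    have h : ∀ x, prodAt M.act (MvPolynomial.X 0 : MvPolynomial (Fin (q + 1)) F) (1 ⊗ₜ a) (r • x) =
        r • prodAt M.act (MvPolynomial.X 0) (1 ⊗ₜ a) x := by
      intro x
      rw [← algebraMap_smul (MvPolynomial (Fin (q + 1)) F) r x, map_smul, algebraMap_smul]
    simp only [coefPre_apply, lieFam_apply, ev_smul, smul_apply, map_sub, map_smul, h,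
      ← Finset.smul_sum, smul_sub, RingHom.id_apply]

theorem lieDer_apply (a : A) (n : ℕ) {q : ℕ} (f : PreCochain F A V q) (w : Fin q → A) :
    lieDer M a n f w = mapT V (headCoeff F n)
      (lieFam M (MvPolynomial.X 0) (1 ⊗ₜ a) (ev f) (tailVars F q) fun i => 1 ⊗ₜ w i) := rfl

theorem mapT_contractFam (φ : S →ₐ[F] S') (t : S) (Z : S ⊗[F] A) {q : ℕ}
    (f : PreCochain F A V (q + 1)) (s : Fin q → S) (W : Fin q → S ⊗[F] A) :
    mapT V φ.toLinearMap (contractFam t Z (ev f) s W) =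
      contractFam (φ t) (mapT A φ.toLinearMap Z) (ev f) (fun i => φ (s i))
        fun i => mapT A φ.toLinearMap (W i) := by
  rw [contractFam_apply, mapT_ev, contractFam_apply]
  congr 2
  · funext i
    cases i using Fin.cases <;> rfl
  · funext i
    cases i using Fin.cases <;> rfl

theorem mapT_lieFam (φ : S →ₐ[F] S') (t : S) (Z : S ⊗[F] A) {q : ℕ}
    (f : PreCochain F A V q) (s : Fin q → S) (W : Fin q → S ⊗[F] A) :
    mapT V φ.toLinearMap (lieFam M t Z (ev f) s W) =
      lieFam M (φ t) (mapT A φ.toLinearMap Z) (ev f) (fun i => φ (s i))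
        fun i => mapT A φ.toLinearMap (W i) := by
  rw [lieFam_apply, lieFam_apply, map_sub, map_sum, mapT_prodAt, mapT_ev]
  congr 1
  refine Finset.sum_congr rfl fun i _ => ?_
  rw [mapT_ev, ← mapT_prodAt, ← map_add]
  congr 2
  · funext j
    exact Function.apply_update (fun _ => φ) s i _ j
  · funext j
    exact Function.apply_update (fun _ => mapT A φ.toLinearMap) W i _ j

theorem aeval_cons_tailVars {q m : ℕ} (s : Fin q → MvPolynomial (Fin m) F) (i : Fin q) :
    MvPolynomial.aeval (Fin.cons (MvPolynomial.X 0) fun i => tailHom F m (s i) :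
      Fin (q + 1) → MvPolynomial (Fin (m + 1)) F) (tailVars F q i) = tailHom F m (s i) := by
  simp [tailVars]

theorem ev_contract (a : A) (n : ℕ) {q m : ℕ} (f : PreCochain F A V (q + 1))
    (s : Fin q → MvPolynomial (Fin m) F) (W : Fin q → MvPolynomial (Fin m) F ⊗[F] A) :
    mapT V (headCoeff F n) (contractFam (MvPolynomial.X 0) (1 ⊗ₜ a) (ev f)
      (fun i => tailHom F m (s i)) fun i => mapT A (tailHom F m).toLinearMap (W i)) =
      ev (contract a n f) s W := by
  refine ev_coefPre n (E := contractFam (MvPolynomial.X 0) (1 ⊗ₜ a) (ev f)) s (fun w => ?_) W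
  rw [mapT_contractFam]
  simp only [aeval_cons_tailVars, mapT_tmul, AlgHom.toLinearMap_apply, map_one,
    MvPolynomial.aeval_X, Fin.cons_zero, Fin.cons_succ]

theorem ev_lieDer (a : A) (n : ℕ) {q m : ℕ} (f : PreCochain F A V q)
    (s : Fin q → MvPolynomial (Fin m) F) (W : Fin q → MvPolynomial (Fin m) F ⊗[F] A) :
    mapT V (headCoeff F n) (lieFam M (MvPolynomial.X 0) (1 ⊗ₜ a) (ev f)
      (fun i => tailHom F m (s i)) fun i => mapT A (tailHom F m).toLinearMap (W i)) =
      ev (lieDer M a n f) s W := by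
  refine ev_coefPre n (E := lieFam M (MvPolynomial.X 0) (1 ⊗ₜ a) (ev f)) s (fun w => ?_) W
  rw [mapT_lieFam]
  simp only [aeval_cons_tailVars, mapT_tmul, AlgHom.toLinearMap_apply, map_one,
    MvPolynomial.aeval_X, Fin.cons_zero, Fin.cons_succ]

theorem coef_dFam_tail (n : ℕ) {q : ℕ} {E : Family F A V (MvPolynomial (Fin (q + 1)) F) q}
    {E' : Family F A V (MvPolynomial (Fin (q + 2)) F) q}
    (h : ∀ s W, mapT V (headCoeff F n) (E' (fun i => tailHom F _ (s i))
      fun i => mapT A (tailHom F _).toLinearMap (W i)) = E s W) (w : Fin (q + 1) → A) :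
    mapT V (headCoeff F n) (dFam M E' (tailVars F _) fun i => 1 ⊗ₜ w i) =
      dFam M E (fun i => MvPolynomial.X i) fun i => 1 ⊗ₜ w i := by
  rw [← coef_dFam M (tailHom F _) (headCoeff F n) (headCoeff_tailHom_mul n) h]
  simp only [MvPolynomial.rename_X, mapT_tmul, AlgHom.toLinearMap_apply, map_one]

theorem lieDer_dPre (a : A) (n : ℕ) {q : ℕ} (f : PreCochain F A V q) :
    lieDer M a n (dPre M f) = dPre M (lieDer M a n f) := by
  ext w : 1
  rw [lieDer_apply, ev_dPre, lieFam_dFam, dPre_apply, d_apply]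
  exact coef_dFam_tail M n (ev_lieDer M a n f) w

theorem contract_dPre_apply (a : A) (n : ℕ) {q : ℕ} (f : PreCochain F A V q) (w : Fin q → A) :
    contract a n (dPre M f) w = mapT V (headCoeff F n) (dFam M (ev f)
      (Fin.cons (MvPolynomial.X 0) (tailVars F q)) (Fin.cons (1 ⊗ₜ a) fun i => 1 ⊗ₜ w i)) := by
  change coefPre n _ w = _
  rw [coefPre_apply, contractFam_apply, ev_dPre]

theorem dPre_contract_apply (a : A) (n : ℕ) {q : ℕ} (f : PreCochain F A V (q + 1))
    (w : Fin (q + 1) → A) :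
    dPre M (contract a n f) w = mapT V (headCoeff F n) (dFam M
      (contractFam (MvPolynomial.X 0) (1 ⊗ₜ a) (ev f)) (tailVars F _) fun i => 1 ⊗ₜ w i) := by
  rw [dPre_apply, d_apply]
  exact (coef_dFam_tail M n (ev_contract a n f) w).symm

/-- The coefficient of λ_0^n in Cartan's formula. It makes every mode of a Lie derivative
null-homotopic, which is the source of all coboundaries before the homotopy enters. -/
theorem contract_dPre (a : A) (n : ℕ) {q : ℕ} {f : PreCochain F A V (q + 1)}
    (hf : f ∈ M.cochains (q + 1)) :
    contract a n (dPre M f) + dPre M (contract a n f) = lieDer M a n f := by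
  ext w : 1
  rw [add_apply, contract_dPre_apply, dPre_contract_apply, ← map_add,
    cartan_fam M (skewFam_ev M hf), lieDer_apply]

/-- A 0-cochain cannot be contracted, so Cartan's formula has a single term. -/
theorem contract_dPre_zero (a : A) (n : ℕ) (f : PreCochain F A V 0) :
    contract a n (dPre M f) = lieDer M a n f := by
  ext w : 1
  rw [contract_dPre_apply, lieDer_apply, dFam_zero_apply, lieFam_apply, Fin.sum_univ_zero, sub_zero]
  rfl

/-- The extension of scalars of `R : V → V`, applied to the values of a family. -/
def postFam (R : V →ₗ[F] V) {q : ℕ} (E : Family F A V S q) : Family F A V S q :=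
  fun s => (R.baseChange S).compMultilinearMap (E s)

theorem postFam_apply (R : V →ₗ[F] V) {q : ℕ} (E : Family F A V S q) (s : Fin q → S)
    (W : Fin q → S ⊗[F] A) : postFam R E s W = R.baseChange S (E s W) := rfl

/-- The linear map `R`, applied to the coefficients of the values of a cochain. -/
def post (R : V →ₗ[F] V) {q : ℕ} : PreCochain F A V q →ₗ[F] PreCochain F A V q where
  toFun f := (R.lTensor (MvPolynomial (Fin q) F)).compMultilinearMap f
  map_add' f g := by ext; simp
  map_smul' r f := by ext; simp

theorem post_apply (R : V →ₗ[F] V) {q : ℕ} (f : PreCochain F A V q) (w : Fin q → A) :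
    post R f w = R.lTensor _ (f w) := rfl

theorem mapT_baseChange (R : V →ₗ[F] V) (c : S →ₗ[F] S') (x : S ⊗[F] V) :
    mapT V c (R.baseChange S x) = R.baseChange S' (mapT V c x) := by
  induction x with
  | zero => simp
  | add x y hx hy => simp only [map_add, hx, hy]
  | tmul r v => simp

theorem ev_post (R : V →ₗ[F] V) {q : ℕ} (f : PreCochain F A V q) :
    (ev (post R f) : Family F A V S q) = postFam R (ev f) := by
  funext s
  refine tensor_multilinear_ext fun w => ?_
  rw [ev_tmul, post_apply, postFam_apply, ev_tmul]
  exact mapT_baseChange R (MvPolynomial.aeval s).toLinearMap (f w)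

/-- The `λ`-product `a, v ↦ a_λ (R v) - R (a_λ v)`. -/
def commAct (R : V →ₗ[F] V) : A →ₗ[F] V →ₗ[F] F[X] ⊗[F] V :=
  LinearMap.mk₂ F (fun a v => M.act a (R v) - R.lTensor F[X] (M.act a v))
    (fun a b v => by simp only [map_add, LinearMap.add_apply]; abel)
    (fun r a v => by simp only [map_smul, LinearMap.smul_apply, smul_sub])
    (fun a v u => by simp only [map_add]; abel)
    (fun r a v => by simp only [map_smul, smul_sub])

theorem prodAt_commAct (R : V →ₗ[F] V) (p : S) (x : S ⊗[F] A) (y : S ⊗[F] V) :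
    prodAt (commAct M R) p x y =
      prodAt M.act p x (R.baseChange S y) - R.baseChange S (prodAt M.act p x y) := by
  induction x with
  | zero => simp
  | add x z hx hz => simp only [map_add, LinearMap.add_apply, hx, hz]; abel
  | tmul r a =>
    induction y with
    | zero => simp
    | add x z hx hz => simp only [map_add, hx, hz]; abel
    | tmul s b =>
      simp only [LinearMap.baseChange_tmul, prodAt_tmul, commAct, LinearMap.mk₂_apply,
        map_sub, map_smul, smul_sub,
        evalLam_lTensor]

/-- The bracket terms only change the arguments of E, so R commutes with them; the defect comes from
the action terms alone. -/
theorem dFam_postFam (R : V →ₗ[F] V) {q : ℕ} (E : Family F A V S q) (s : Fin (q + 1) → S)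
    (W : Fin (q + 1) → S ⊗[F] A) :
    dFam M (postFam R E) s W = R.baseChange S (dFam M E s W) +
      ∑ k : Fin (q + 1), (-1 : ℤ) ^ (k : ℕ) • actFam (commAct M R) E s k W := by
  have h : ∀ k, actFam M.act (postFam R E) s k W =
      R.baseChange S (actFam M.act E s k W) + actFam (commAct M R) E s k W := by
    intro k
    rw [actFam_apply, actFam_apply, actFam_apply, prodAt_commAct, postFam_apply]
    abel
  cases q with
  | zero => simp only [dFam_zero_apply, h]; simp
  | succ n =>
    simp only [dFam_succ_apply, h, smul_add, Finset.sum_add_distrib, map_add, map_sum, map_zsmul]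
    have h1 : ∀ (k : Fin (n + 2)) (j : Fin (n + 1)), brFam 𝔤.bracket (postFam R E) s k j W =
        R.baseChange S (brFam 𝔤.bracket E s k j W) := fun k j => rfl
    simp only [h1, apply_ite (R.baseChange S), map_zsmul, map_zero]
    abel

/-- The operator `[𝐝, R ∘ ι_Z]`, up to the terms in which `𝐝` is applied to the family. -/
def homFam (R : V →ₗ[F] V) (t : S) (Z : S ⊗[F] A) {q : ℕ} (E : Family F A V S q) (s : Fin q → S)
    (W : Fin q → S ⊗[F] A) : S ⊗[F] V :=
  R.baseChange S (lieFam M t Z E s W) +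
    ∑ i, prodAt (commAct M R) (s i) (W i) (E (Function.update s i t) (Function.update W i Z))

theorem cartan_post (R : V →ₗ[F] V) {q : ℕ} {E : Family F A V S (q + 1)} (hE : SkewFam E) (t : S)
    (Z : S ⊗[F] A) (s : Fin (q + 1) → S) (W : Fin (q + 1) → S ⊗[F] A) :
    R.baseChange S (dFam M E (Fin.cons t s) (Fin.cons Z W)) +
      dFam M (postFam R (contractFam t Z E)) s W = homFam M R t Z E s W := by
  rw [dFam_postFam, ← add_assoc, ← map_add, cartan_fam M hE, homFam]
  congr 1
  refine Finset.sum_congr rfl fun k _ => ?_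
  -- The sign (-1)^k of the action term meets the (-1)^k from moving Z into slot k, and they cancel.
  rw [actFam_apply, contractFam_apply, hE.cons_succAbove, map_zsmul, smul_smul, ← mul_pow]
  simp

/-- For a cocycle this removes the differential: what remains uses only the values of f with one
argument changed. It serves both to evaluate the homotopy and to see that its differential is a
cochain. -/
theorem dPre_post_contract (R : V →ₗ[F] V) (a : A) (n : ℕ) {q : ℕ} {f : PreCochain F A V (q + 1)}
    (hf : f ∈ M.cochains (q + 1)) (hd : dPre M f = 0) (w : Fin (q + 1) → A) :
    dPre M (post R (contract a n f)) w = mapT V (headCoeff F n)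
      (homFam M R (MvPolynomial.X 0) (1 ⊗ₜ a) (ev f) (tailVars F _) fun i => 1 ⊗ₜ w i) := by
  have h := contract_dPre_apply M a n f w
  rw [hd, map_zero, zero_apply] at h
  rw [← cartan_post M R (skewFam_ev M hf), map_add, mapT_baseChange, ← h, map_zero, zero_add,
    dPre_apply, d_apply, ev_post]
  refine (coef_dFam_tail M n (fun s W => ?_) w).symm
  rw [postFam_apply, mapT_baseChange, ev_contract]
  rfl

end Coefficients
end
end LieConformal

namespace LieConformal

noncomputable section

/-! ### Stability of the basic complex under these operations, and d² = 0. -/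

section Membership

variable {F : Type*} [Field F] {A : Type*} [AddCommGroup A] [Module F A]
  {V : Type*} [AddCommGroup V] [Module F V] {𝔤 : LieConformalAlgebra F A} (M : LCAModule 𝔤 V)
  {S : Type*} [CommRing S] [Algebra F S] {S' : Type*} [CommRing S'] [Algebra F S']

/-- Sesquilinearity of a family. -/
def SesqFam (D : A →ₗ[F] A) {q : ℕ} (E : Family F A V S q) : Prop :=
  ∀ s W i x, E s (Function.update W i (D.baseChange S x)) = -(s i • E s (Function.update W i x))

theorem sesqFam_ev {q : ℕ} {f : PreCochain F A V q} (hf : f ∈ M.cochains q) :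
    SesqFam 𝔤.der (ev f : Family F A V S q) := by
  intro s W i x
  have hs : ∀ y : MvPolynomial (Fin q) F ⊗[F] V,
      subst s ((MvPolynomial.X i : MvPolynomial (Fin q) F) • y) = s i • subst s y := by
    intro y
    have := mapT_algHom_smul (V := V) (MvPolynomial.aeval s : MvPolynomial (Fin q) F →ₐ[F] S)
      (MvPolynomial.X i) y
    rwa [MvPolynomial.aeval_X] at this
  -- Inserting ∂ in slot i through T turns sesquilinearity into an equality of S-multilinear maps,
  -- which can be checked on tuples from A.
  let T : Fin q → S ⊗[F] A →ₗ[S] S ⊗[F] A :=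
    Function.update (fun _ => LinearMap.id) i (𝔤.der.baseChange S)
  have hT : ∀ (W : Fin q → S ⊗[F] A) (W' : Fin q → S ⊗[F] A) j,
      T j (W j) = Function.update W i (𝔤.der.baseChange S (W i)) j := by
    intro W _ j
    by_cases h : j = i
    · subst h; simp [T]
    · simp [T, Function.update_of_ne h]
  have h : (ev f s).compLinearMap T = -(s i • ev f s) := by
    refine tensor_multilinear_ext fun w => ?_
    rw [MultilinearMap.compLinearMap_apply, neg_apply, smul_apply, ev_tmul, ← hs, ← map_neg,
      ← hf.1 w i, ← ev_tmul]
    refine congrArg _ (funext fun j => (hT (fun j => 1 ⊗ₜ w j) W j).trans ?_)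
    by_cases h : j = i
    · subst h; simp
    · simp [Function.update_of_ne h]
  have h1 := congrArg (fun g => g (Function.update W i x)) h
  simp only [MultilinearMap.compLinearMap_apply, neg_apply, smul_apply] at h1
  rw [← h1]
  refine congrArg _ (funext fun j => ?_)
  rw [hT _ W]
  simp

/-- A criterion for the cochain of coefficients of a family to belong to the basic complex. -/
theorem mem_cochains_of_headCoeff (n : ℕ) {q : ℕ} {g : PreCochain F A V q}
    (E : (Fin q → MvPolynomial (Fin (q + 1)) F) → (Fin q → MvPolynomial (Fin (q + 1)) F ⊗[F] A) →
      MvPolynomial (Fin (q + 1)) F ⊗[F] V)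
    (hg : ∀ w, g w = mapT V (headCoeff F n) (E (tailVars F q) fun i => 1 ⊗ₜ w i))
    (hsesq : ∀ s W i x, E s (Function.update W i (𝔤.der.baseChange _ x)) =
      -(s i • E s (Function.update W i x)))
    (hskew : ∀ (σ : Equiv.Perm (Fin q)) s W,
      E (s ∘ σ) (W ∘ σ) = (Equiv.Perm.sign σ : ℤ) • E s W)
    (hnat : ∀ (φ : MvPolynomial (Fin (q + 1)) F →ₐ[F] MvPolynomial (Fin (q + 1)) F)
      (_ : φ (MvPolynomial.X 0) = MvPolynomial.X 0) s W, mapT V φ.toLinearMap (E s W) =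
        E (fun i => φ (s i)) fun i => mapT A φ.toLinearMap (W i)) :
    g ∈ M.cochains q := by
  constructor
  · intro a i
    have h : (fun j => (1 : MvPolynomial (Fin (q + 1)) F) ⊗ₜ[F] Function.update a i (𝔤.der (a i)) j) =
        Function.update (fun j => 1 ⊗ₜ a j) i (𝔤.der.baseChange _ (1 ⊗ₜ a i)) := by
      funext j
      by_cases h : j = i
      · subst h; simp
      · simp [Function.update_of_ne h]
    rw [hg, hg, h, hsesq, Function.update_eq_self, map_neg]
    have := mapT_coef_smul (V := V) (tailHom F q) (headCoeff F n) (headCoeff_tailHom_mul n)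
      (MvPolynomial.X i) (E (tailVars F q) fun i => 1 ⊗ₜ a i)
    rw [MvPolynomial.rename_X] at this
    rw [this]
  · intro σ a
    rw [hg, hg, ← mapT_headCoeff_aeval, hnat, ← map_zsmul, ← hskew]
    · congr 2
      · funext i
        rw [aeval_cons_tailVars]
        simp
      · funext i
        simp
    · simp

theorem mapT_homFam (φ : S →ₐ[F] S') (R : V →ₗ[F] V) (t : S) (Z : S ⊗[F] A) {q : ℕ}
    (f : PreCochain F A V q) (s : Fin q → S) (W : Fin q → S ⊗[F] A) :
    mapT V φ.toLinearMap (homFam M R t Z (ev f) s W) =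
      homFam M R (φ t) (mapT A φ.toLinearMap Z) (ev f) (fun i => φ (s i))
        fun i => mapT A φ.toLinearMap (W i) := by
  rw [homFam, map_add, mapT_baseChange, mapT_lieFam, homFam, map_sum]
  congr 1
  refine Finset.sum_congr rfl fun i _ => ?_
  rw [mapT_prodAt, mapT_ev]
  congr 3
  · funext j
    exact Function.apply_update (fun _ => φ) s i _ j
  · funext j
    exact Function.apply_update (fun _ => mapT A φ.toLinearMap) W i _ j

theorem prodAt_commAct_der_left (R : V →ₗ[F] V) (p : S) (x : S ⊗[F] A) (y : S ⊗[F] V) :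
    prodAt (commAct M R) p (𝔤.der.baseChange S x) y = -(p • prodAt (commAct M R) p x y) := by
  have h : ∀ (x : S ⊗[F] A) (y : S ⊗[F] V),
      prodAt M.act p (𝔤.der.baseChange S x) y = -(p • prodAt M.act p x y) := by
    intro x y
    induction x with
    | zero => simp
    | add x z hx hz => simp only [map_add, LinearMap.add_apply, hx, hz, smul_add]; abel
    | tmul r a =>
      induction y with
      | zero => simp
      | add x z hx hz => simp only [map_add, hx, hz, smul_add]; abel
      | tmul s b =>
        rw [LinearMap.baseChange_tmul, prodAt_tmul, prodAt_tmul, M.act_der_left, map_neg,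
          evalLam_X_smul]
        module
  rw [prodAt_commAct, prodAt_commAct, h, h, map_neg, map_smul, smul_sub]
  abel

/-- In slot i, moving ∂ out of the bracket gives ∂ + t, and E turns this ∂ into -(t + s_i), so -s_i
remains. In the other summands the parameter of slot i is unchanged. -/
theorem lieFam_sesq {q : ℕ} {E : Family F A V S q} (hE : SesqFam 𝔤.der E) (t : S) (Z : S ⊗[F] A) :
    SesqFam 𝔤.der (lieFam M t Z E) := by
  intro s W i x
  rw [lieFam_apply, lieFam_apply, hE, map_neg, map_smul, smul_sub, neg_sub', Finset.smul_sum,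
    ← Finset.sum_neg_distrib]
  congr 1
  refine Finset.sum_congr rfl fun j _ => ?_
  by_cases h : j = i
  · subst h
    simp only [Function.update_self, Function.update_idem]
    rw [prodAt_der_right 𝔤.der 𝔤.bracket 𝔤.bracket_der_right, MultilinearMap.map_update_add, hE,
      MultilinearMap.map_update_smul, Function.update_self]
    module
  · simp only [Function.update_of_ne h]
    rw [Function.update_comm (Ne.symm h), Function.update_comm (Ne.symm h), hE,
      Function.update_of_ne (Ne.symm h)]

theorem homFam_sesq (R : V →ₗ[F] V) {q : ℕ} {E : Family F A V S q} (hE : SesqFam 𝔤.der E) (t : S)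
    (Z : S ⊗[F] A) (s : Fin q → S) (W : Fin q → S ⊗[F] A) (i : Fin q) (x : S ⊗[F] A) :
    homFam M R t Z E s (Function.update W i (𝔤.der.baseChange _ x)) =
      -(s i • homFam M R t Z E s (Function.update W i x)) := by
  rw [homFam, homFam, lieFam_sesq M hE, map_neg, map_smul, smul_add, neg_add, Finset.smul_sum,
    ← Finset.sum_neg_distrib]
  congr 1
  refine Finset.sum_congr rfl fun j _ => ?_
  by_cases h : j = i
  · subst h
    simp only [Function.update_self, Function.update_idem, prodAt_commAct_der_left]
  · simp only [Function.update_of_ne h]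
    rw [Function.update_comm (Ne.symm h), Function.update_comm (Ne.symm h), hE,
      Function.update_of_ne (Ne.symm h), map_neg, map_smul]

theorem homFam_skew (R : V →ₗ[F] V) {q : ℕ} {E : Family F A V S q} (hE : SkewFam E) (t : S)
    (Z : S ⊗[F] A) (σ : Equiv.Perm (Fin q)) (s : Fin q → S) (W : Fin q → S ⊗[F] A) :
    homFam M R t Z E (s ∘ σ) (W ∘ σ) = (Equiv.Perm.sign σ : ℤ) • homFam M R t Z E s W := by
  have hs : ∀ (i : Fin q) (x : S),
      Function.update (s ∘ σ) i x = Function.update s (σ i) x ∘ σ := by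
    intro i x
    exact (Function.update_comp_eq_of_injective s σ.injective i x).symm
  have hW : ∀ (i : Fin q) x, Function.update (W ∘ σ) i x = Function.update W (σ i) x ∘ σ := by
    intro i x
    exact (Function.update_comp_eq_of_injective W σ.injective i x).symm
  simp only [homFam, lieFam_apply, hs, hW, hE σ, map_zsmul, Function.comp_apply]
  rw [Equiv.sum_comp σ fun i => (Equiv.Perm.sign σ : ℤ) • E (Function.update s i (t + s i))
      (Function.update W i (prodAt 𝔤.bracket t Z (W i))),
    Equiv.sum_comp σ fun i => (Equiv.Perm.sign σ : ℤ) • prodAt (commAct M R) (s i) (W i)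
      (E (Function.update s i t) (Function.update W i Z))]
  rcases Int.units_eq_one_or (Equiv.Perm.sign σ) with h | h
  · simp [h]
  · simp only [h, Units.val_neg, Units.val_one, neg_smul, one_smul, Finset.sum_neg_distrib,
      map_sub, map_neg]
    abel

theorem mem_cochains_of_homFam (R : V →ₗ[F] V) (a : A) (n : ℕ) {q : ℕ} {f g : PreCochain F A V q}
    (hf : f ∈ M.cochains q)
    (hg : ∀ w, g w = mapT V (headCoeff F n)
      (homFam M R (MvPolynomial.X 0) (1 ⊗ₜ a) (ev f) (tailVars F q) fun i => 1 ⊗ₜ w i)) :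
    g ∈ M.cochains q := by
  refine mem_cochains_of_headCoeff M n _ hg (homFam_sesq M R (sesqFam_ev M hf) _ _)
    (homFam_skew M R (skewFam_ev M hf) _ _) fun φ hφ s W => ?_
  rw [mapT_homFam, hφ]
  simp

/-- With R the identity the commutator terms of `homFam` vanish and the Lie derivative is left. -/
theorem lieDer_mem (a : A) (n : ℕ) {q : ℕ} {f : PreCochain F A V q} (hf : f ∈ M.cochains q) :
    lieDer M a n f ∈ M.cochains q := by
  refine mem_cochains_of_homFam M LinearMap.id a n hf fun w => ?_
  rw [lieDer_apply, homFam]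
  simp [prodAt_commAct]

theorem contract_mem (a : A) (n : ℕ) {q : ℕ} {f : PreCochain F A V (q + 1)}
    (hf : f ∈ M.cochains (q + 1)) : contract a n f ∈ M.cochains q := by
  refine mem_cochains_of_headCoeff M n (fun s W => contractFam (MvPolynomial.X 0) (1 ⊗ₜ a) (ev f) s W)
    (fun w => rfl) (fun s W i x => ?_) (fun σ s W => ?_) fun φ hφ s W => ?_
  · simp only [contractFam_apply, Fin.cons_update]
    rw [sesqFam_ev M hf, Fin.cons_succ]
  -- The permutation `decomposeFin.symm (0, σ)` fixes 0, where the contracted element sits, and acts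
  -- as σ on the successors.
  · have h : Equiv.Perm.sign (Equiv.Perm.decomposeFin.symm (0, σ)) = Equiv.Perm.sign σ := by
      simp
    rw [contractFam_apply, contractFam_apply, ← h, ← skewFam_ev M hf]
    congr 2
    · funext i
      cases i using Fin.cases <;> simp
    · funext i
      cases i using Fin.cases <;> simp
  · rw [mapT_contractFam, hφ]
    simp

theorem post_mem (R : V →ₗ[F] V) {q : ℕ} {f : PreCochain F A V q} (hf : f ∈ M.cochains q) :
    post R f ∈ M.cochains q := by
  constructor
  · intro a i
    rw [post_apply, hf.1, map_neg, post_apply]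
    exact congrArg _ ((R.baseChange (MvPolynomial (Fin q) F)).map_smul _ _)
  · intro σ a
    rw [post_apply, post_apply, ← map_zsmul, ← hf.2]
    exact mapT_baseChange R (MvPolynomial.aeval _).toLinearMap _

/-- Skew-symmetry and sesquilinearity are read off from `homFam`, not from the sums that define the
differential. -/
theorem dPre_post_contract_mem (R : V →ₗ[F] V) (a : A) (n : ℕ) {q : ℕ}
    {f : PreCochain F A V (q + 1)} (hf : f ∈ M.cochains (q + 1)) (hd : dPre M f = 0) :
    dPre M (post R (contract a n f)) ∈ M.cochains (q + 1) :=
  mem_cochains_of_homFam M R a n hf (dPre_post_contract M R a n hf hd)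

/-- Coordinates with respect to an F-basis of V reduce this to polynomials, which are determined by
their coefficients in λ_0. -/
theorem headCoeff_ext {q : ℕ} {x y : MvPolynomial (Fin (q + 1)) F ⊗[F] V}
    (h : ∀ n, mapT V (headCoeff F n) x = mapT V (headCoeff F n) y) : x = y := by
  classical
  let b := Module.Basis.ofVectorSpace F V
  have hc : ∀ (n : ℕ) (x : MvPolynomial (Fin (q + 1)) F ⊗[F] V) i,
      TensorProduct.equivFinsuppOfBasisRight b (mapT V (headCoeff F n) x) i =
        headCoeff F n (TensorProduct.equivFinsuppOfBasisRight b x i) := by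
    intro n x i
    induction x with
    | zero => simp
    | add x y hx hy => simp only [map_add, Finsupp.add_apply, hx, hy]
    | tmul r v => simp [TensorProduct.equivFinsuppOfBasisRight_apply_tmul_apply]
  refine (TensorProduct.equivFinsuppOfBasisRight b).injective (Finsupp.ext fun i => ?_)
  refine (MvPolynomial.finSuccEquiv F q).injective (Polynomial.ext fun n => ?_)
  have := hc n x i
  rw [h, hc] at this
  exact this.symm

theorem dPre_add {q : ℕ} (f g : PreCochain F A V q) : dPre M (f + g) = dPre M f + dPre M g := by
  ext w : 1
  rw [add_apply, dPre_apply, dPre_apply, dPre_apply, map_add]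
  rfl

theorem dPre_smul {q : ℕ} (r : F) (f : PreCochain F A V q) : dPre M (r • f) = r • dPre M f := by
  ext w : 1
  rw [smul_apply, dPre_apply, dPre_apply, map_smul]
  rfl

/-- The differential squares to zero on basic cochains. -/
theorem dPre_dPre {q : ℕ} : ∀ {f : PreCochain F A V q} {g : PreCochain F A V (q + 1)},
    f ∈ M.cochains q → g ∈ M.cochains (q + 1) → dPre M f = g → dPre M g = 0 := by
  -- A multilinear map is determined by its contractions, so it suffices to contract d g. Cartan's
  -- formula then lowers the degree.
  have key : ∀ {q : ℕ} (g : PreCochain F A V (q + 1)),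
      (∀ a n, contract a n g = 0) → g = 0 := by
    intro q g h
    ext w : 1
    rw [← Fin.cons_self_tail w, zero_apply]
    refine headCoeff_ext fun n => ?_
    rw [← contract_apply, h, map_zero, zero_apply]
  induction q with
  | zero =>
    intro f g hf hg hfg
    refine key _ fun a n => ?_
    have h1 := contract_dPre M a n hg
    have h2 := contract_dPre_zero M a n f
    rw [hfg] at h2
    rw [h2, ← lieDer_dPre, hfg] at h1
    exact add_eq_right.1 h1
  | succ q ih =>
    intro f g hf hg hfg
    refine key _ fun a n => ?_
    have h1 := contract_dPre M a n hg
    have h2 := contract_dPre M a n hf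
    rw [hfg] at h2
    -- By Cartan's formula d ι f = ℒ f - ι g, which is a cochain; the induction hypothesis gives d ι
    -- g = d ℒ f = ℒ g, whence ι d g = 0.
    have h3 := ih (f := contract a n f) (contract_mem M a n hf)
      (sub_mem (lieDer_mem M a n hf) (contract_mem M a n hg)) (eq_sub_of_add_eq' h2)
    have h4 : dPre M (contract a n g) = dPre M (lieDer M a n f) := by
      have h5 := congrArg (dPre M) (sub_add_cancel (lieDer M a n f) (contract a n g))
      rwa [dPre_add, h3, zero_add] at h5
    rw [h4, ← lieDer_dPre, hfg] at h1
    exact add_eq_right.1 h1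

end Membership
end
end LieConformal

namespace LieConformal

noncomputable section

/-! ### Coordinates on the free module and modes of the λ-action. -/

section Coordinates

variable {F : Type*} [Field F] {S : Type*} [CommRing S] [Algebra F S]
  {S' : Type*} [CommRing S'] [Algebra F S']

/-- The coefficient of `∂^k c`. -/
def ESV.coord (c : ESVGen) (k : ℕ) : ESV F →ₗ[F] F :=
  Polynomial.lcoeff F k ∘ₗ LinearMap.proj c

@[simp]
theorem ESV.coord_apply (c : ESVGen) (k : ℕ) (v : ESV F) : ESV.coord c k v = (v c).coeff k := rfl

/-- The coefficient of `∂^k c` of an element of `S ⊗ ESV F`. -/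
def polyCoord (c : ESVGen) (k : ℕ) : S ⊗[F] ESV F →ₗ[S] S :=
  LinearMap.liftBaseChange S ((Algebra.linearMap F S) ∘ₗ ESV.coord c k)

theorem polyCoord_tmul (c : ESVGen) (k : ℕ) (r : S) (v : ESV F) :
    polyCoord c k (r ⊗ₜ v) = r * algebraMap F S ((v c).coeff k) := by
  simp [polyCoord]

theorem polyCoord_ext {x y : S ⊗[F] ESV F} (h : ∀ c k, polyCoord c k x = polyCoord c k y) :
    x = y := by
  classical
  let b := Pi.basis (fun _ : ESVGen => Polynomial.basisMonomials F)
  have hb : ∀ (x : S ⊗[F] ESV F) i,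
      TensorProduct.equivFinsuppOfBasisRight b x i = polyCoord i.1 i.2 x := by
    intro x i
    induction x with
    | zero => simp
    | add x y hx hy => simp only [map_add, Finsupp.add_apply, hx, hy]
    | tmul r v =>
      rw [TensorProduct.equivFinsuppOfBasisRight_apply_tmul_apply, polyCoord_tmul,
        Pi.basis_repr, Algebra.smul_def, mul_comm]
      rfl
  refine (TensorProduct.equivFinsuppOfBasisRight b).injective (Finsupp.ext fun i => ?_)
  rw [hb, hb, h]

theorem polyCoord_mapT (f : S →ₗ[F] S') (c : ESVGen) (k : ℕ) (x : S ⊗[F] ESV F) :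
    polyCoord c k (mapT _ f x) = f (polyCoord c k x) := by
  induction x with
  | zero => simp
  | add x y hx hy => simp only [map_add, hx, hy]
  | tmul r v =>
    rw [mapT_tmul, polyCoord_tmul, polyCoord_tmul, mul_comm, mul_comm r, ← Algebra.smul_def,
      ← Algebra.smul_def, map_smul]

theorem polyCoord_subst {q : ℕ} (s : Fin q → S) (c : ESVGen) (k : ℕ)
    (x : MvPolynomial (Fin q) F ⊗[F] ESV F) :
    polyCoord c k (subst s x) = MvPolynomial.aeval s (polyCoord c k x) :=
  polyCoord_mapT (MvPolynomial.aeval s).toLinearMap c k x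

theorem polyCoord_lTensor (R : ESV F →ₗ[F] ESV F) (c c' : ESVGen) (k k' : ℕ) (r : F)
    (h : ∀ v, (R v c).coeff k = r * (v c').coeff k') (x : S ⊗[F] ESV F) :
    polyCoord c k (R.lTensor S x) = r • polyCoord c' k' x := by
  induction x with
  | zero => simp
  | add x y hx hy => simp only [map_add, smul_add, hx, hy]
  | tmul s v =>
    rw [LinearMap.lTensor_tmul, polyCoord_tmul, polyCoord_tmul, h, map_mul, Algebra.smul_def]
    ring

variable {A : Type*} [AddCommGroup A] [Module F A] {V : Type*} [AddCommGroup V] [Module F V]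

/-- The operator `a_{(n)}` up to the factor `n!`: the coefficient of `λ^n` of `a_λ v`. -/
def actCoeff (act : A →ₗ[F] V →ₗ[F] F[X] ⊗[F] V) (n : ℕ) (a : A) : V →ₗ[F] V :=
  (TensorProduct.lid F V).toLinearMap ∘ₗ (Polynomial.lcoeff F n).rTensor V ∘ₗ act a

theorem headCoeff_aeval_X (n q : ℕ) (p : F[X]) :
    headCoeff F n (Polynomial.aeval (MvPolynomial.X 0 : MvPolynomial (Fin (q + 1)) F) p) =
      MvPolynomial.C (p.coeff n) := by
  induction p using Polynomial.induction_on' with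
  | add x y hx hy => simp only [map_add, hx, hy, Polynomial.coeff_add]
  | monomial m c =>
    have h : MvPolynomial.finSuccEquiv F q (MvPolynomial.C c) = Polynomial.C (MvPolynomial.C c) := by
      simp [MvPolynomial.finSuccEquiv_apply]
    have h' : algebraMap F (MvPolynomial (Fin (q + 1)) F) c = MvPolynomial.C c := rfl
    simp only [headCoeff, Polynomial.aeval_monomial, LinearMap.comp_apply, h']
    simp [h, MvPolynomial.finSuccEquiv_X_zero, Polynomial.coeff_X_pow, Polynomial.coeff_monomial,
      apply_ite (MvPolynomial.C (σ := Fin q)), eq_comm]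

/-- Since y does not involve λ_0, the powers of λ_0 come only from the product. -/
theorem headCoeff_prodAt (act : A →ₗ[F] V →ₗ[F] F[X] ⊗[F] V) (n : ℕ) {q : ℕ} (a : A)
    (y : MvPolynomial (Fin q) F ⊗[F] V) :
    mapT V (headCoeff F n) (prodAt act (MvPolynomial.X 0) (1 ⊗ₜ a)
      (mapT V (tailHom F q).toLinearMap y)) = (actCoeff act n a).lTensor _ y := by
  induction y with
  | zero => simp
  | add x y hx hy => simp only [map_add, hx, hy]
  | tmul r v =>
    rw [mapT_tmul, AlgHom.toLinearMap_apply, prodAt_tmul, one_smul, LinearMap.lTensor_tmul,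
      mapT_coef_smul _ _ (headCoeff_tailHom_mul n), actCoeff]
    simp only [LinearMap.comp_apply]
    induction act a v with
    | zero => simp
    | add x y hx hy => simp only [map_add, smul_add, hx, hy, TensorProduct.tmul_add]
    | tmul p u =>
      simp only [evalLam, LinearMap.rTensor_tmul, AlgHom.toLinearMap_apply, mapT_tmul,
        headCoeff_aeval_X, LinearEquiv.coe_coe, TensorProduct.lid_tmul, Polynomial.lcoeff_apply,
        TensorProduct.smul_tmul', TensorProduct.tmul_smul, smul_eq_mul]
      rw [mul_comm, MvPolynomial.C_mul']

theorem actCoeff_zero_der {D : V →ₗ[F] V} {act : A →ₗ[F] V →ₗ[F] F[X] ⊗[F] V}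
    (h : ∀ a b, act a (D b) = D.lTensor F[X] (act a b) + (Polynomial.X : F[X]) • act a b)
    (a : A) (v : V) : actCoeff act 0 a (D v) = D (actCoeff act 0 a v) := by
  simp only [actCoeff, LinearMap.comp_apply, h]
  induction act a v with
  | zero => simp
  | add x y hx hy => simp only [map_add, smul_add] at hx hy ⊢; rw [← hx, ← hy]; abel
  | tmul p u => simp [TensorProduct.smul_tmul']

theorem actCoeff_succ_der {D : V →ₗ[F] V} {act : A →ₗ[F] V →ₗ[F] F[X] ⊗[F] V}
    (h : ∀ a b, act a (D b) = D.lTensor F[X] (act a b) + (Polynomial.X : F[X]) • act a b)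
    (n : ℕ) (a : A) (v : V) :
    actCoeff act (n + 1) a (D v) = D (actCoeff act (n + 1) a v) + actCoeff act n a v := by
  simp only [actCoeff, LinearMap.comp_apply, h]
  induction act a v with
  | zero => simp
  | add x y hx hy =>
    simp only [map_add, smul_add] at hx hy ⊢
    rw [add_add_add_comm, hx, hy]
    abel
  | tmul p u => simp [TensorProduct.smul_tmul', Polynomial.coeff_X_mul]

end Coordinates

/-! ### The operators L_(0), L_(1) and N_(0). -/

section ESVOperators

variable {F : Type*} [Field F]

/-- The second hypothesis is an induction step and does not ask for F[∂]-linearity, so the principle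
also applies to L_(1), which does not commute with ∂. -/
theorem ESV.linearMap_ext {V : Type*} [AddCommGroup V] [Module F V] {f g : ESV F →ₗ[F] V}
    (hgen : ∀ c, f (ESV.gen F c) = g (ESV.gen F c))
    (hder : ∀ v, f v = g v → f (ESV.der F v) = g (ESV.der F v)) : f = g := by
  have h := ESV.generate F (LinearMap.eqLocus f g) (by rintro _ ⟨c, rfl⟩; exact hgen c)
    fun v hv => hder v hv
  exact LinearMap.eqLocus_eq_top.1 h

/-- The conformal weights of the generators. -/
def ESV.weight : ESVGen → F
  | .L => 2
  | .M => 1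
  | .Y => 3 / 2
  | .N => 1

/-- The charges of the generators, that is, the eigenvalues of `N_{(0)}`. -/
def ESV.charge : ESVGen → F
  | .L => 0
  | .M => 2
  | .Y => 1
  | .N => 0

theorem ESV.table_L (c : ESVGen) : ESV.table F .L c = ESV.lin F 1 (ESV.weight c) 0 c := by
  cases c <;> rfl

theorem ESV.actCoeff_lin (br : ESV F →ₗ[F] ESV F →ₗ[F] F[X] ⊗[F] ESV F) (a b : ESV F) (α β γ : F)
    (c : ESVGen) (h : br a b = ESV.lin F α β γ c) (n : ℕ) :
    actCoeff br n a b = (if n = 0 then α • ESV.der F (ESV.gen F c) + γ • ESV.gen F c else 0) +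
      if n = 1 then β • ESV.gen F c else 0 := by
  simp only [actCoeff, LinearMap.comp_apply, h, ESV.lin, map_add, map_smul,
    LinearMap.rTensor_tmul, Polynomial.lcoeff_apply, Polynomial.coeff_one, Polynomial.coeff_X,
    LinearEquiv.coe_coe, TensorProduct.lid_tmul]
  rcases n with _ | _ | n <;> simp

theorem ESV.der_apply (v : ESV F) (c : ESVGen) : ESV.der F v c = Polynomial.X * v c := rfl

theorem ESV.actCoeff_zero_L (v : ESV F) :
    actCoeff (ESV.bracket F) 0 (ESV.gen F .L) v = ESV.der F v := by
  revert v
  refine LinearMap.ext_iff.1 (ESV.linearMap_ext (fun c => ?_) fun v hv => ?_)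
  · rw [ESV.actCoeff_lin _ _ _ _ _ _ _ ((ESV.bracket_gen F _ _).trans (ESV.table_L c))]
    simp
  · rw [actCoeff_zero_der (ESV.bracket_der_right F), hv]

/-- The relation L_(1) ∂ = ∂ L_(1) + L_(0), with L_(0) = ∂, determines L_(1) from its values on
generators: it is the weight plus the Euler operator in ∂. -/
theorem ESV.actCoeff_one_L (v : ESV F) (c : ESVGen) :
    actCoeff (ESV.bracket F) 1 (ESV.gen F .L) v c =
      ESV.weight (F := F) c • v c + Polynomial.X * (v c).derivative := by
  let E : ESV F →ₗ[F] ESV F := LinearMap.pi fun c =>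
    (ESV.weight (F := F) c • LinearMap.id + LinearMap.mulLeft F (Polynomial.X : F[X]) ∘ₗ
      Polynomial.derivative) ∘ₗ LinearMap.proj c
  have h : actCoeff (ESV.bracket F) 1 (ESV.gen F .L) = E := by
    refine ESV.linearMap_ext (fun c => ?_) fun v hv => ?_
    · rw [ESV.actCoeff_lin _ _ _ _ _ _ _ ((ESV.bracket_gen F _ _).trans (ESV.table_L c))]
      funext d
      by_cases hd : d = c
      · subst hd; simp [E, ESV.gen]
      · simp [E, ESV.gen, Pi.single_eq_of_ne hd]
    · rw [actCoeff_succ_der (ESV.bracket_der_right F), hv, ESV.actCoeff_zero_L]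
      funext d
      simp [E, ESV.der_apply]
      rw [mul_add, mul_smul_comm, add_assoc]
      congr 1
      ring
  rw [h]
  simp [E]

theorem ESV.coeff_actCoeff_one_L (v : ESV F) (c : ESVGen) (k : ℕ) :
    (actCoeff (ESV.bracket F) 1 (ESV.gen F .L) v c).coeff k =
      (ESV.weight c + k) * (v c).coeff k := by
  rw [ESV.actCoeff_one_L]
  cases k with
  | zero => simp
  | succ k => simp [Polynomial.coeff_X_mul, Polynomial.coeff_derivative]; ring

theorem ESV.actCoeff_zero_N (v : ESV F) (c : ESVGen) :
    actCoeff (ESV.bracket F) 0 (ESV.gen F .N) v c = ESV.charge (F := F) c • v c := by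
  let E : ESV F →ₗ[F] ESV F := LinearMap.pi fun c =>
    (ESV.charge (F := F) c • LinearMap.id) ∘ₗ LinearMap.proj c
  have h : actCoeff (ESV.bracket F) 0 (ESV.gen F .N) = E := by
    refine ESV.linearMap_ext (fun c => ?_) fun v hv => ?_
    · have h0 : ∀ c, actCoeff (ESV.bracket F) 0 (ESV.gen F .N) (ESV.gen F c) =
          ESV.charge (F := F) c • ESV.gen F c := by
        intro c
        cases c
        · rw [ESV.actCoeff_lin _ _ _ 0 1 0 .N (ESV.bracket_gen F _ _)]
          simp [ESV.charge]
        · rw [ESV.actCoeff_lin _ _ _ 0 0 2 .M (ESV.bracket_gen F _ _)]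
          simp [ESV.charge]
        · rw [ESV.actCoeff_lin _ _ _ 0 0 1 .Y (ESV.bracket_gen F _ _)]
          simp [ESV.charge]
        · simp [actCoeff, ESV.bracket_gen, ESV.table, ESV.charge]
      rw [h0]
      funext d
      by_cases hd : d = c
      · subst hd; simp [E, ESV.gen]
      · simp [E, ESV.gen, Pi.single_eq_of_ne hd]
    · rw [actCoeff_zero_der (ESV.bracket_der_right F), hv]
      funext d
      simp [E, ESV.der_apply]
  rw [h]
  simp [E]

end ESVOperators
end
end LieConformal

namespace LieConformal

noncomputable section

/-! ### Explicit formulas for the modes 0 and 1 of the Lie derivative. -/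

section CoefficientFormulas

variable {F : Type*} [Field F]

theorem headCoeff_tailHom {q : ℕ} (n : ℕ) (p : MvPolynomial (Fin q) F) :
    headCoeff F n (tailHom F q p) = if n = 0 then p else 0 := by
  rw [headCoeff, LinearMap.comp_apply, AlgEquiv.toLinearMap_apply, finSuccEquiv_tailHom]
  exact Polynomial.coeff_C

theorem headCoeff_zero_mul {q : ℕ} (x y : MvPolynomial (Fin (q + 1)) F) :
    headCoeff F 0 (x * y) = headCoeff F 0 x * headCoeff F 0 y := by
  simp [headCoeff, Polynomial.mul_coeff_zero]

theorem headCoeff_one_mul {q : ℕ} (x y : MvPolynomial (Fin (q + 1)) F) :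
    headCoeff F 1 (x * y) =
      headCoeff F 0 x * headCoeff F 1 y + headCoeff F 1 x * headCoeff F 0 y := by
  simp [headCoeff, Polynomial.mul_coeff_one]

theorem headCoeff_X_zero {q : ℕ} (n : ℕ) :
    headCoeff F n (MvPolynomial.X 0 : MvPolynomial (Fin (q + 1)) F) = if n = 1 then 1 else 0 := by
  simp [headCoeff, MvPolynomial.finSuccEquiv_X_zero, Polynomial.coeff_X, eq_comm]

theorem headCoeff_X_succ {q : ℕ} (n : ℕ) (i : Fin q) :
    headCoeff F n (MvPolynomial.X i.succ : MvPolynomial (Fin (q + 1)) F) =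
      if n = 0 then MvPolynomial.X i else 0 := by
  rw [← headCoeff_tailHom, MvPolynomial.rename_X]

theorem headCoeff_C {q : ℕ} (n : ℕ) (r : F) :
    headCoeff F n (MvPolynomial.C r : MvPolynomial (Fin (q + 1)) F) =
      if n = 0 then MvPolynomial.C r else 0 := by
  rw [← headCoeff_tailHom, MvPolynomial.rename_C]

/-- The substitution `λ_i ↦ λ_0 + λ_i`. -/
def shiftVars (F : Type*) [Field F] {q : ℕ} (i : Fin q) :
    Fin q → MvPolynomial (Fin (q + 1)) F :=
  Function.update (tailVars F q) i (MvPolynomial.X 0 + tailVars F q i)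

theorem headCoeff_shiftVars {q : ℕ} (i j : Fin q) (n : ℕ) :
    headCoeff F n (shiftVars F i j) =
      if n = 0 then MvPolynomial.X j else
        if n = 1 then (Pi.single i 1 : Fin q → MvPolynomial (Fin q) F) j else 0 := by
  by_cases h : j = i
  · subst h
    simp only [shiftVars, Function.update_self, map_add, headCoeff_X_zero, headCoeff_X_succ,
      Pi.single_eq_same]
    split_ifs <;> simp_all
  · simp only [shiftVars, Function.update_of_ne h, headCoeff_X_succ, Pi.single_eq_of_ne h, ite_self]

theorem headCoeff_zero_aeval_shiftVars {q : ℕ} (i : Fin q) (p : MvPolynomial (Fin q) F) :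
    headCoeff F 0 (MvPolynomial.aeval (shiftVars F i) p) = p := by
  induction p using MvPolynomial.induction_on with
  | C r => simp [MvPolynomial.algebraMap_eq, headCoeff_C]
  | add x y hx hy => simp only [map_add, hx, hy]
  | mul_X x j hx =>
    rw [map_mul, headCoeff_zero_mul, hx, MvPolynomial.aeval_X, headCoeff_shiftVars, if_pos rfl]

/-- The linear term in λ_0 of the Taylor expansion of p at λ_i + λ_0. -/
theorem headCoeff_one_aeval_shiftVars {q : ℕ} (i : Fin q) (p : MvPolynomial (Fin q) F) :
    headCoeff F 1 (MvPolynomial.aeval (shiftVars F i) p) = MvPolynomial.pderiv i p := by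
  induction p using MvPolynomial.induction_on with
  | C r => simp [MvPolynomial.algebraMap_eq, headCoeff_C]
  | add x y hx hy => simp only [map_add, hx, hy]
  | mul_X x j hx =>
    rw [map_mul, headCoeff_one_mul, hx, MvPolynomial.aeval_X, headCoeff_shiftVars,
      headCoeff_shiftVars, headCoeff_zero_aeval_shiftVars, Derivation.leibniz,
      MvPolynomial.pderiv_X, if_pos rfl, if_neg one_ne_zero, if_pos rfl, smul_eq_mul, smul_eq_mul,
      mul_comm (MvPolynomial.X j)]

variable {A : Type*} [AddCommGroup A] [Module F A] {V : Type*} [AddCommGroup V] [Module F V]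
  {𝔤 : LieConformalAlgebra F A} (M : LCAModule 𝔤 V)

theorem update_one_tmul {S : Type*} [CommRing S] [Algebra F S] {q : ℕ} (w : Fin q → A) (i : Fin q)
    (b : A) : Function.update (fun j => (1 : S) ⊗ₜ[F] w j) i (1 ⊗ₜ b) =
      fun j => 1 ⊗ₜ Function.update w i b j := by
  funext j
  by_cases h : j = i
  · subst h; simp
  · simp [Function.update_of_ne h]

/-- The coefficient of `λ^n` of an element of `V[λ]`. -/
def lamCoeff (n : ℕ) : F[X] ⊗[F] V →ₗ[F] V :=
  (TensorProduct.lid F V).toLinearMap ∘ₗ (Polynomial.lcoeff F n).rTensor V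

theorem headCoeff_zero_ev_shift {q : ℕ} (f : PreCochain F A V q) (w : Fin q → A) (i : Fin q)
    (x : F[X] ⊗[F] A) :
    mapT V (headCoeff F 0) (ev f (shiftVars F i)
      (Function.update (fun j => 1 ⊗ₜ w j) i (evalLam (MvPolynomial.X 0) x))) =
      f (Function.update w i (lamCoeff 0 x)) := by
  induction x with
  | zero => 
    rw [map_zero, MultilinearMap.map_update_zero, map_zero, map_zero,
      MultilinearMap.map_update_zero]
  | add x y hx hy => simp only [map_add, MultilinearMap.map_update_add, hx, hy]
  | tmul p b =>
    have h : ∀ y : MvPolynomial (Fin q) F ⊗[F] V, mapT V (headCoeff F 0)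
        (Polynomial.aeval (MvPolynomial.X 0 : MvPolynomial (Fin (q + 1)) F) p •
          subst (shiftVars F i) y) = p.coeff 0 • y := by
      intro y
      induction y with
      | zero => simp
      | add x y hx hy => simp only [map_add, smul_add, hx, hy]
      | tmul r v =>
        simp only [subst, LinearMap.rTensor_tmul, AlgHom.toLinearMap_apply,
          TensorProduct.smul_tmul', mapT_tmul, smul_eq_mul, headCoeff_zero_mul, headCoeff_aeval_X,
          headCoeff_zero_aeval_shiftVars, MvPolynomial.C_mul']
    simp only [evalLam, LinearMap.rTensor_tmul, AlgHom.toLinearMap_apply]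
    rw [tmul_eq_smul_one_tmul, MultilinearMap.map_update_smul, update_one_tmul, ev_tmul, h]
    simp [lamCoeff]

/-- A product rule: the factor λ_0 comes either from the bracket x or from the shift λ_i ↦ λ_0 + λ_i
in f, which gives the partial derivative. -/
theorem headCoeff_one_ev_shift {q : ℕ} (f : PreCochain F A V q) (w : Fin q → A) (i : Fin q)
    (x : F[X] ⊗[F] A) :
    mapT V (headCoeff F 1) (ev f (shiftVars F i)
      (Function.update (fun j => 1 ⊗ₜ w j) i (evalLam (MvPolynomial.X 0) x))) =
      f (Function.update w i (lamCoeff 1 x)) +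
        mapT V (MvPolynomial.pderiv i).toLinearMap (f (Function.update w i (lamCoeff 0 x))) := by
  induction x with
  | zero => simp only [map_zero, MultilinearMap.map_update_zero, add_zero]
  | add x y hx hy =>
    simp only [map_add, MultilinearMap.map_update_add, hx, hy]
    abel
  | tmul p b =>
    have h : ∀ y : MvPolynomial (Fin q) F ⊗[F] V, mapT V (headCoeff F 1)
        (Polynomial.aeval (MvPolynomial.X 0 : MvPolynomial (Fin (q + 1)) F) p •
          subst (shiftVars F i) y) = p.coeff 1 • y +
            p.coeff 0 • mapT V (MvPolynomial.pderiv i).toLinearMap y := by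
      intro y
      induction y with
      | zero => simp
      | add x y hx hy => simp only [map_add, smul_add, hx, hy]; abel
      | tmul r v =>
        simp only [subst, LinearMap.rTensor_tmul, AlgHom.toLinearMap_apply,
          TensorProduct.smul_tmul', mapT_tmul, smul_eq_mul, headCoeff_one_mul, headCoeff_aeval_X,
          headCoeff_zero_aeval_shiftVars, headCoeff_one_aeval_shiftVars, MvPolynomial.C_mul',
          TensorProduct.add_tmul]
        rw [add_comm]
        rfl
    simp only [evalLam, LinearMap.rTensor_tmul, AlgHom.toLinearMap_apply]
    rw [tmul_eq_smul_one_tmul, MultilinearMap.map_update_smul, update_one_tmul, ev_tmul, h]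
    simp [lamCoeff]

theorem actCoeff_apply (act : A →ₗ[F] V →ₗ[F] F[X] ⊗[F] V) (n : ℕ) (a : A) (v : V) :
    actCoeff act n a v = lamCoeff n (act a v) := rfl

theorem ev_tailVars {q : ℕ} (f : PreCochain F A V q) (w : Fin q → A) :
    ev f (tailVars F q) (fun j => 1 ⊗ₜ w j) = mapT V (tailHom F q).toLinearMap (f w) := by
  have h : MvPolynomial.aeval (tailVars F q) = tailHom F q := MvPolynomial.algHom_ext (by simp)
  rw [ev_tmul]
  induction f w with
  | zero => simp
  | add x y hx hy => simp only [map_add, hx, hy]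
  | tmul r v =>
    simp only [subst, LinearMap.rTensor_tmul, mapT_tmul, AlgHom.toLinearMap_apply, h]

theorem prodAt_one_tmul {S : Type*} [CommRing S] [Algebra F S] (act : A →ₗ[F] V →ₗ[F] F[X] ⊗[F] V)
    (p : S) (a : A) (b : V) : prodAt act p (1 ⊗ₜ a) (1 ⊗ₜ b) = evalLam p (act a b) := by
  rw [prodAt_tmul, one_smul, one_smul]

theorem lieDer_zero_apply (a : A) {q : ℕ} (f : PreCochain F A V q) (w : Fin q → A) :
    lieDer M a 0 f w = (actCoeff M.act 0 a).lTensor _ (f w) -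
      ∑ i, f (Function.update w i (actCoeff 𝔤.bracket 0 a (w i))) := by
  rw [lieDer_apply, lieFam_apply, map_sub, map_sum, ev_tailVars, headCoeff_prodAt]
  congr 1
  refine Finset.sum_congr rfl fun i _ => ?_
  rw [prodAt_one_tmul, actCoeff_apply]
  exact headCoeff_zero_ev_shift f w i _

theorem lieDer_one_apply (a : A) {q : ℕ} (f : PreCochain F A V q) (w : Fin q → A) :
    lieDer M a 1 f w = (actCoeff M.act 1 a).lTensor _ (f w) -
      ∑ i, (f (Function.update w i (actCoeff 𝔤.bracket 1 a (w i))) +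
        mapT V (MvPolynomial.pderiv i).toLinearMap
          (f (Function.update w i (actCoeff 𝔤.bracket 0 a (w i))))) := by
  rw [lieDer_apply, lieFam_apply, map_sub, map_sum, ev_tailVars, headCoeff_prodAt]
  congr 1
  refine Finset.sum_congr rfl fun i _ => ?_
  rw [prodAt_one_tmul, actCoeff_apply, actCoeff_apply]
  exact headCoeff_one_ev_shift f w i _

/-- The coefficient of `λ_i^n` of a polynomial in `λ_1, …, λ_q`. -/
def coeffAt {q : ℕ} (i : Fin q) (n : ℕ) : MvPolynomial (Fin q) F →ₗ[F] MvPolynomial (Fin q) F :=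
  headCoeff F n ∘ₗ
    (MvPolynomial.aeval (Function.update (tailVars F q) i (MvPolynomial.X 0))).toLinearMap

/-- In the i-th summand a occupies slot i with parameter λ_0, while the outer product uses λ_i.
Hence `coeffAt` extracts a power of the i-th variable of f, and afterwards λ_i enters only through
the outer product. -/
theorem dPre_post_contract_apply (R : V →ₗ[F] V) (a : A) (n : ℕ) {q : ℕ}
    {f : PreCochain F A V (q + 1)} (hf : f ∈ M.cochains (q + 1)) (hd : dPre M f = 0)
    (w : Fin (q + 1) → A) :
    dPre M (post R (contract a n f)) w = R.lTensor _ (lieDer M a n f w) +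
      ∑ i, prodAt (commAct M R) (MvPolynomial.X i) (1 ⊗ₜ w i)
        (mapT V (coeffAt i n) (f (Function.update w i a))) := by
  rw [dPre_post_contract M R a n hf hd, homFam, map_add, mapT_baseChange, map_sum, lieDer_apply]
  congr 1
  refine Finset.sum_congr rfl fun i _ => ?_
  have h := mapT_coef_prodAt (tailHom F (q + 1)) (headCoeff F n) (headCoeff_tailHom_mul n)
    (commAct M R) (MvPolynomial.X i) (1 ⊗ₜ w i)
    (ev f (Function.update (tailVars F (q + 1)) i (MvPolynomial.X 0)) fun j =>
      1 ⊗ₜ Function.update w i a j)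
  rw [MvPolynomial.rename_X, mapT_tmul, AlgHom.toLinearMap_apply, map_one] at h
  rw [update_one_tmul, h, ev_tmul]
  congr 1
  induction f (Function.update w i a) with
  | zero => simp
  | add x y hx hy => simp only [map_add, hx, hy]
  | tmul r v => rfl

end CoefficientFormulas
end
end LieConformal

namespace LieConformal

noncomputable section

/-! ### The gradings of cochains by weight and by charge. -/

section Gradings

variable {F : Type*} [Field F]

/-- A tuple of generators. -/
abbrev ESV.gens (F : Type*) [Field F] {q : ℕ} (w : Fin q → ESVGen) : Fin q → ESV F :=
  fun i => ESV.gen F (w i)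

/-- The coefficient of `λ^n ∂^k c` of the value of a cochain on a tuple of generators. -/
def coordinate {q : ℕ} (f : PreCochain F (ESV F) (ESV F) q) (w : Fin q → ESVGen) (n : Fin q →₀ ℕ)
    (c : ESVGen) (k : ℕ) : F :=
  MvPolynomial.coeff n (polyCoord c k (f (ESV.gens F w)))

theorem coordinate_add {q : ℕ} (f g : PreCochain F (ESV F) (ESV F) q) (w : Fin q → ESVGen)
    (n : Fin q →₀ ℕ) (c : ESVGen) (k : ℕ) :
    coordinate (f + g) w n c k = coordinate f w n c k + coordinate g w n c k := by
  simp [coordinate]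

theorem coordinate_smul {q : ℕ} (r : F) (f : PreCochain F (ESV F) (ESV F) q) (w : Fin q → ESVGen)
    (n : Fin q →₀ ℕ) (c : ESVGen) (k : ℕ) :
    coordinate (r • f) w n c k = r * coordinate f w n c k := by
  have h : polyCoord c k (r • f (ESV.gens F w)) = r • polyCoord c k (f (ESV.gens F w)) := by
    rw [← algebraMap_smul (MvPolynomial (Fin q) F) r, map_smul, algebraMap_smul]
  rw [coordinate, smul_apply, h, MvPolynomial.coeff_smul]
  rfl

theorem coordinate_ext_gens {q : ℕ} {f g : PreCochain F (ESV F) (ESV F) q} {w : Fin q → ESVGen}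
    (h : ∀ n c k, coordinate f w n c k = coordinate g w n c k) :
    f (ESV.gens F w) = g (ESV.gens F w) :=
  polyCoord_ext fun c k => MvPolynomial.ext _ _ fun n => h n c k

/-- This finiteness lets a polynomial in a Lie derivative annihilate a given cochain. -/
theorem finite_coordinates {q : ℕ} (x : MvPolynomial (Fin q) F ⊗[F] ESV F) :
    {i : (Fin q →₀ ℕ) × ESVGen × ℕ | MvPolynomial.coeff i.1 (polyCoord i.2.1 i.2.2 x) ≠ 0}.Finite := by
  induction x with
  | zero => simp
  | add x y hx hy =>
    refine (hx.union hy).subset fun i hi => ?_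
    by_contra h
    simp only [Set.mem_union, Set.mem_ofPred_eq, not_or, not_not] at h
    exact hi (by rw [map_add, MvPolynomial.coeff_add, h.1, h.2, add_zero])
  | tmul r v =>
    refine ((r.support ×ˢ Finset.univ ×ˢ
      (Finset.univ.biUnion fun c => (v c).support)).finite_toSet).subset ?_
    rintro ⟨n, c, k⟩ hi
    rw [Set.mem_ofPred_eq, polyCoord_tmul, mul_comm, MvPolynomial.algebraMap_eq,
      MvPolynomial.coeff_C_mul] at hi
    simp only [Finset.coe_product, Set.mem_prod, Finset.mem_coe, MvPolynomial.mem_support_iff,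
      Finset.mem_univ, Finset.mem_biUnion, true_and, Polynomial.mem_support_iff]
    exact ⟨right_ne_zero_of_mul hi, c, left_ne_zero_of_mul hi⟩

theorem coordinate_contract {q : ℕ} (f : PreCochain F (ESV F) (ESV F) (q + 1)) (g : ESVGen) (m : ℕ)
    (w : Fin q → ESVGen) (n : Fin q →₀ ℕ) (c : ESVGen) (k : ℕ) :
    coordinate (contract (ESV.gen F g) m f) w n c k =
      coordinate f (Fin.cons g w) (n.cons m) c k := by
  have h : (Fin.cons (ESV.gen F g) (ESV.gens F w) : Fin (q + 1) → ESV F) =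
      ESV.gens F (Fin.cons g w) := by
    funext i
    cases i using Fin.cases <;> rfl
  rw [coordinate, contract_apply, polyCoord_mapT, h, coordinate,
    ← MvPolynomial.finSuccEquiv_coeff_coeff]
  rfl

/-- Twice the conformal weight of a generator. -/
def ESV.twoWeight : ESVGen → ℤ
  | .L => 4
  | .M => 2
  | .Y => 3
  | .N => 2

/-- The charge of a generator as an integer. -/
def ESV.intCharge : ESVGen → ℤ
  | .L => 0
  | .M => 2
  | .Y => 1
  | .N => 0

/-- Twice the eigenvalue of the Lie derivative along `L_{(1)}` on a coordinate. -/
def weightDefect {q : ℕ} (w : Fin q → ESVGen) (n : Fin q →₀ ℕ) (c : ESVGen) (k : ℕ) : ℤ :=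
  ∑ i, (2 * (n i : ℤ) + 2 - ESV.twoWeight (w i)) + 2 * k + ESV.twoWeight c

/-- The eigenvalue of the Lie derivative along `N_{(0)}` on a coordinate. -/
def chargeDefect {q : ℕ} (w : Fin q → ESVGen) (c : ESVGen) : ℤ :=
  ESV.intCharge c - ∑ i, ESV.intCharge (w i)

variable [CharZero F]

theorem ESV.two_mul_weight (c : ESVGen) : 2 * ESV.weight (F := F) c = ESV.twoWeight c := by
  cases c <;> simp [ESV.weight, ESV.twoWeight] <;> norm_num

theorem ESV.charge_eq (c : ESVGen) : ESV.charge (F := F) c = ESV.intCharge c := by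
  cases c <;> simp [ESV.charge, ESV.intCharge]

theorem ESV.actCoeff_one_L_gen (c : ESVGen) :
    actCoeff (ESV.bracket F) 1 (ESV.gen F .L) (ESV.gen F c) = ESV.weight (F := F) c • ESV.gen F c := by
  rw [ESV.actCoeff_lin _ _ _ _ _ _ _ ((ESV.bracket_gen F _ _).trans (ESV.table_L c))]
  simp

theorem ESV.actCoeff_zero_N_gen (c : ESVGen) :
    actCoeff (ESV.bracket F) 0 (ESV.gen F .N) (ESV.gen F c) = ESV.charge (F := F) c • ESV.gen F c := by
  funext d
  rw [ESV.actCoeff_zero_N]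
  by_cases hd : d = c
  · subst hd; rfl
  · simp [ESV.gen, Pi.single_eq_of_ne hd]

theorem coeff_X_mul_pderiv {q : ℕ} (i : Fin q) (n : Fin q →₀ ℕ) (p : MvPolynomial (Fin q) F) :
    MvPolynomial.coeff n (MvPolynomial.X i * MvPolynomial.pderiv i p) =
      n i * MvPolynomial.coeff n p := by
  induction p using MvPolynomial.induction_on' with
  | monomial m r =>
    rw [MvPolynomial.X_mul_pderiv_monomial, MvPolynomial.coeff_smul, MvPolynomial.coeff_monomial]
    split_ifs with h
    · subst h; simp
    · simp
  | add x y hx hy => simp only [map_add, mul_add, MvPolynomial.coeff_add, hx, hy]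

theorem map_update_der_gens {q : ℕ} {f : PreCochain F (ESV F) (ESV F) q}
    (hf : f ∈ (esv F).adjoint.cochains q) (w : Fin q → ESV F) (i : Fin q) :
    f (Function.update w i (ESV.der F (w i))) =
      -((MvPolynomial.X i : MvPolynomial (Fin q) F) • f w) := hf.1 w i

/-- In slot i, L_(1) gives the weight of the generator, and L_(0) = ∂ becomes -λ_i, so that the
derivative of λ_i p yields 1 + n_i. The value contributes its weight plus k. The factor 2 clears the
half-integral weight of Y. -/
theorem coordinate_lieDer_L {q : ℕ} {f : PreCochain F (ESV F) (ESV F) q}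
    (hf : f ∈ (esv F).adjoint.cochains q) (w : Fin q → ESVGen) (n : Fin q →₀ ℕ) (c : ESVGen)
    (k : ℕ) : 2 * coordinate (lieDer (esv F).adjoint (ESV.gen F .L) 1 f) w n c k =
      weightDefect w n c k * coordinate f w n c k := by
  have h1 : ∀ i, f (Function.update (ESV.gens F w) i
      (actCoeff (ESV.bracket F) 1 (ESV.gen F .L) (ESV.gen F (w i)))) =
      ESV.weight (F := F) (w i) • f (ESV.gens F w) := by
    intro i
    rw [ESV.actCoeff_one_L_gen, MultilinearMap.map_update_smul, Function.update_eq_self]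
  have h0 : ∀ i, f (Function.update (ESV.gens F w) i
      (actCoeff (ESV.bracket F) 0 (ESV.gen F .L) (ESV.gen F (w i)))) =
      -((MvPolynomial.X i : MvPolynomial (Fin q) F) • f (ESV.gens F w)) := by
    intro i
    rw [ESV.actCoeff_zero_L]
    exact map_update_der_gens hf _ i
  have h2 := lieDer_one_apply (esv F).adjoint (ESV.gen F .L) f (ESV.gens F w)
  change _ = (actCoeff (ESV.bracket F) 1 (ESV.gen F .L)).lTensor _ (f (ESV.gens F w)) -
    ∑ i, (f (Function.update (ESV.gens F w) i
      (actCoeff (ESV.bracket F) 1 (ESV.gen F .L) (ESV.gen F (w i)))) +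
        mapT _ (MvPolynomial.pderiv i).toLinearMap (f (Function.update (ESV.gens F w) i
          (actCoeff (ESV.bracket F) 0 (ESV.gen F .L) (ESV.gen F (w i)))))) at h2
  have hs : ∀ r : F, polyCoord c k (r • f (ESV.gens F w)) =
      r • polyCoord c k (f (ESV.gens F w)) := by
    intro r
    rw [← algebraMap_smul (MvPolynomial (Fin q) F) r, map_smul, algebraMap_smul]
  simp only [h1, h0] at h2
  rw [coordinate, coordinate, h2, map_sub, map_sum, polyCoord_lTensor _ c c k k (ESV.weight c + k : F)
    fun v => ESV.coeff_actCoeff_one_L v c k]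
  simp only [map_add, polyCoord_mapT, map_neg, map_smul, hs]
  generalize polyCoord c k (f (ESV.gens F w)) = p
  have h3 : ∀ i, MvPolynomial.coeff n ((MvPolynomial.pderiv i).toLinearMap
      (MvPolynomial.X i * p)) =
      MvPolynomial.coeff n p + n i * MvPolynomial.coeff n p := by
    intro i
    rw [← coeff_X_mul_pderiv]
    simp [add_comm]
  simp only [MvPolynomial.coeff_sub, MvPolynomial.coeff_sum, MvPolynomial.coeff_add,
    MvPolynomial.coeff_neg, MvPolynomial.coeff_smul, h3, smul_eq_mul, weightDefect, Int.cast_add,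
    Int.cast_sum, Int.cast_sub, Int.cast_mul, ← ESV.two_mul_weight]
  have h4 : ∀ i : Fin q, ESV.weight (w i) * MvPolynomial.coeff n p +
      -(MvPolynomial.coeff n p + n i * MvPolynomial.coeff n p) =
      (ESV.weight (w i) - 1 - n i) * MvPolynomial.coeff n p := fun i => by ring
  simp only [h4, ← Finset.sum_mul]
  have h5 : ∑ i : Fin q, (((2 : ℤ) : F) * ((n i : ℤ) : F) + ((2 : ℤ) : F) - 2 * ESV.weight (w i)) =
      -2 * ∑ i, (ESV.weight (w i) - 1 - (n i : F)) := by
    rw [Finset.mul_sum]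
    refine Finset.sum_congr rfl fun i _ => ?_
    push_cast
    ring
  rw [h5]
  push_cast
  ring

theorem coordinate_lieDer_N {q : ℕ} (f : PreCochain F (ESV F) (ESV F) q) (w : Fin q → ESVGen)
    (n : Fin q →₀ ℕ) (c : ESVGen) (k : ℕ) :
    coordinate (lieDer (esv F).adjoint (ESV.gen F .N) 0 f) w n c k =
      chargeDefect w c * coordinate f w n c k := by
  have h1 : ∀ i, f (Function.update (ESV.gens F w) i
      (actCoeff (ESV.bracket F) 0 (ESV.gen F .N) (ESV.gen F (w i)))) =
      ESV.charge (F := F) (w i) • f (ESV.gens F w) := by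
    intro i
    rw [ESV.actCoeff_zero_N_gen, MultilinearMap.map_update_smul, Function.update_eq_self]
  have h2 := lieDer_zero_apply (esv F).adjoint (ESV.gen F .N) f (ESV.gens F w)
  change _ = (actCoeff (ESV.bracket F) 0 (ESV.gen F .N)).lTensor _ (f (ESV.gens F w)) -
    ∑ i, f (Function.update (ESV.gens F w) i
      (actCoeff (ESV.bracket F) 0 (ESV.gen F .N) (ESV.gen F (w i)))) at h2
  have hs : ∀ r : F, polyCoord c k (r • f (ESV.gens F w)) =
      r • polyCoord c k (f (ESV.gens F w)) := by
    intro r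
    rw [← algebraMap_smul (MvPolynomial (Fin q) F) r, map_smul, algebraMap_smul]
  simp only [h1] at h2
  rw [coordinate, coordinate, h2, map_sub, map_sum, polyCoord_lTensor _ c c k k (ESV.charge c)
    fun v => by rw [ESV.actCoeff_zero_N]; simp]
  simp only [hs, MvPolynomial.coeff_sub, MvPolynomial.coeff_sum, MvPolynomial.coeff_smul,
    smul_eq_mul, ← Finset.sum_mul, chargeDefect, Int.cast_sub, Int.cast_sum, ← ESV.charge_eq]
  ring

/-- Induction on the set of slots not filled by generators: the kernel of f in one slot is stable
under ∂ by sesquilinearity and contains the generators. -/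
theorem cochain_eq_zero {q : ℕ} {f : PreCochain F (ESV F) (ESV F) q}
    (hf : f ∈ (esv F).adjoint.cochains q) (h : ∀ w, f (ESV.gens F w) = 0) : f = 0 := by
  suffices h : ∀ (I : Finset (Fin q)) (a : Fin q → ESV F),
      (∀ i ∉ I, ∃ c, a i = ESV.gen F c) → f a = 0 from
    MultilinearMap.ext fun a => h Finset.univ a (by simp)
  intro I
  induction I using Finset.induction_on with
  | empty =>
    intro a ha
    choose w hw using fun i => ha i (by simp)
    rw [show a = ESV.gens F w from funext hw, h]
  | insert j I hj ih =>
    intro a ha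
    have hP := ESV.generate F (LinearMap.ker (f.toLinearMap a j)) (by
      rintro _ ⟨c, rfl⟩
      refine ih _ fun i hi => ?_
      by_cases hij : i = j
      · subst hij; exact ⟨c, by simp⟩
      · rw [Function.update_of_ne hij]
        exact ha i (by simp [hij, hi])) fun x hx => by
      have h1 := map_update_der_gens hf (Function.update a j x) j
      rw [Function.update_self, Function.update_idem] at h1
      change f _ = 0
      rw [h1]
      change f _ = 0 at hx
      rw [hx, smul_zero, neg_zero]
    have : a j ∈ LinearMap.ker (f.toLinearMap a j) := by rw [hP]; trivial
    simpa using this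

theorem cochain_ext {q : ℕ} {f g : PreCochain F (ESV F) (ESV F) q}
    (hf : f ∈ (esv F).adjoint.cochains q) (hg : g ∈ (esv F).adjoint.cochains q)
    (h : ∀ w n c k, coordinate f w n c k = coordinate g w n c k) : f = g := by
  rw [← sub_eq_zero]
  refine cochain_eq_zero (sub_mem hf hg) fun w => ?_
  rw [sub_apply, coordinate_ext_gens (h w), sub_self]

theorem coordinate_comp_perm {q : ℕ} {f : PreCochain F (ESV F) (ESV F) q}
    (hf : f ∈ (esv F).adjoint.cochains q) (σ : Equiv.Perm (Fin q)) (w : Fin q → ESVGen)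
    (n : Fin q →₀ ℕ) (c : ESVGen) (k : ℕ) :
    coordinate f (w ∘ σ) n c k =
      ((Equiv.Perm.sign σ : ℤ) : F) * coordinate f w (n.mapDomain σ) c k := by
  have h1 := congrArg (fun x => MvPolynomial.coeff (n.mapDomain σ) (polyCoord c k x))
    (hf.2 σ (ESV.gens F w))
  have h2 : MvPolynomial.aeval (fun i => (MvPolynomial.X (σ i) : MvPolynomial (Fin q) F)) =
      MvPolynomial.rename σ := MvPolynomial.algHom_ext (by simp)
  simp only [polyCoord_subst, h2, MvPolynomial.coeff_rename_mapDomain _ σ.injective, map_zsmul,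
    MvPolynomial.coeff_smul] at h1
  rw [coordinate, coordinate, ← zsmul_eq_mul, ← h1]
  rfl

/-- A cochain of weight zero and charge zero. -/
def IsWeightZero {q : ℕ} (f : PreCochain F (ESV F) (ESV F) q) : Prop :=
  ∀ w n c k, coordinate f w n c k ≠ 0 → weightDefect w n c k = 0 ∧ chargeDefect w c = 0

/-- Both Lie derivatives are diagonal on coordinates; characteristic zero lets the integer defects
be recovered from their images in F. -/
theorem isWeightZero_iff {q : ℕ} {f : PreCochain F (ESV F) (ESV F) q}
    (hf : f ∈ (esv F).adjoint.cochains q) : IsWeightZero f ↔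
      lieDer (esv F).adjoint (ESV.gen F .L) 1 f = 0 ∧
        lieDer (esv F).adjoint (ESV.gen F .N) 0 f = 0 := by
  have h0 : ∀ w n c k, coordinate (0 : PreCochain F (ESV F) (ESV F) q) w n c k = 0 := by
    intro w n c k
    simp [coordinate]
  constructor
  · intro h
    constructor
    · refine cochain_ext (lieDer_mem _ _ _ hf) (zero_mem _) fun w n c k => ?_
      rw [h0, ← mul_right_inj' (two_ne_zero (α := F)), mul_zero, coordinate_lieDer_L hf]
      by_cases hc : coordinate f w n c k = 0
      · rw [hc, mul_zero]
      · rw [(h w n c k hc).1, Int.cast_zero, zero_mul]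
    · refine cochain_ext (lieDer_mem _ _ _ hf) (zero_mem _) fun w n c k => ?_
      rw [h0, coordinate_lieDer_N]
      by_cases hc : coordinate f w n c k = 0
      · rw [hc, mul_zero]
      · rw [(h w n c k hc).2, Int.cast_zero, zero_mul]
  · rintro ⟨hL, hN⟩ w n c k hc
    have h1 := coordinate_lieDer_L hf w n c k
    have h2 := coordinate_lieDer_N f w n c k
    rw [hL, h0, mul_zero] at h1
    rw [hN, h0] at h2
    exact ⟨by simpa [hc] using h1.symm, by simpa [hc] using h2.symm⟩

end Gradings
end
end LieConformal

namespace LieConformal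

noncomputable section

/-! ### Counting the coordinates that survive. -/

section Vanishing

variable {F : Type*} [Field F] [CharZero F]

/-- The transposition of i and j fixes both the tuple and the exponent, so the coordinate equals its
own negative. -/
theorem coordinate_eq_zero_of_repeated {q : ℕ} {f : PreCochain F (ESV F) (ESV F) q}
    (hf : f ∈ (esv F).adjoint.cochains q) {w : Fin q → ESVGen} {n : Fin q →₀ ℕ} {i j : Fin q}
    (hij : i ≠ j) (hw : w i = w j) (hn : n i = n j) (c : ESVGen) (k : ℕ) :
    coordinate f w n c k = 0 := by
  have h := coordinate_comp_perm hf (Equiv.swap i j) w n c k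
  have h1 : w ∘ Equiv.swap i j = w := by
    funext l
    rw [Function.comp_apply, Equiv.swap_apply_def]
    split_ifs with h1 h2
    · rw [h1, hw]
    · rw [h2, hw]
    · rfl
  have h2 : n.mapDomain (Equiv.swap i j) = n := by
    ext l
    rw [Finsupp.mapDomain_equiv_apply, Equiv.symm_swap, Equiv.swap_apply_def]
    split_ifs with h1 h2
    · rw [h1, hn]
    · rw [h2, hn]
    · rfl
  rw [h1, h2, Equiv.Perm.sign_swap hij] at h
  simp only [Units.val_neg, Units.val_one, Int.cast_neg, Int.cast_one, neg_mul, one_mul] at h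
  exact CharZero.eq_neg_self_iff.1 h

/-- Skew-symmetry carries slot i to the front, where the coordinate becomes one of the contraction.
-/
theorem coordinate_eq_zero_of_contract {q : ℕ} {f : PreCochain F (ESV F) (ESV F) (q + 1)}
    (hf : f ∈ (esv F).adjoint.cochains (q + 1)) {g : ESVGen} {m : ℕ}
    (h : contract (ESV.gen F g) m f = 0) {w : Fin (q + 1) → ESVGen} {n : Fin (q + 1) →₀ ℕ}
    {i : Fin (q + 1)} (hw : w i = g) (hn : n i = m) (c : ESVGen) (k : ℕ) :
    coordinate f w n c k = 0 := by
  have h0 : ∀ (w : Fin (q + 1) → ESVGen) (n : Fin (q + 1) →₀ ℕ), w 0 = g → n 0 = m →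
      coordinate f w n c k = 0 := by
    intro w n hw hn
    have h1 := coordinate_contract f g m (Fin.tail w) n.tail c k
    rw [h, ← hw, ← hn, Fin.cons_self_tail, Finsupp.cons_tail] at h1
    rw [← h1]
    simp [coordinate]
  have h1 := coordinate_comp_perm hf (Equiv.swap 0 i) w (n.mapDomain (Equiv.swap 0 i)) c k
  rw [h0 _ _ (by simpa using hw) (by simpa [Finsupp.mapDomain_equiv_apply] using hn),
    ← Finsupp.mapDomain_comp] at h1
  have h2 : (Equiv.swap 0 i ∘ Equiv.swap 0 i : Fin (q + 1) → Fin (q + 1)) = id := by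
    funext l
    simp
  rw [h2, Finsupp.mapDomain_id] at h1
  rcases Int.units_eq_one_or (Equiv.Perm.sign (Equiv.swap 0 i)) with h3 | h3 <;>
    simpa [h3] using h1.symm

theorem apply_gens_eq_zero_of_perm {q : ℕ} {f : PreCochain F (ESV F) (ESV F) q}
    (hf : f ∈ (esv F).adjoint.cochains q) (σ : Equiv.Perm (Fin q)) {w : Fin q → ESVGen}
    (h : f (ESV.gens F (w ∘ σ)) = 0) : f (ESV.gens F w) = 0 := by
  have h1 := hf.2 σ (ESV.gens F w)
  have h2 : ESV.gens F w ∘ σ = ESV.gens F (w ∘ σ) := rfl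
  rw [h2, h, map_zero] at h1
  rcases Int.units_eq_one_or (Equiv.Perm.sign σ) with h3 | h3
  · simpa [h3] using h1.symm
  · simpa [h3] using h1.symm

theorem sum_ite_le_one {q : ℕ} {P : Fin q → Prop} [DecidablePred P]
    (h : ∀ i j, P i → P j → i = j) : ∑ i, (if P i then 1 else 0 : ℤ) ≤ 1 := by
  rw [Finset.sum_boole]
  norm_cast
  refine Finset.card_le_one.2 fun i hi j hj => h i j ?_ ?_
  · simpa using hi
  · simpa using hj

/-- The modes that may occur in a coordinate of weight zero of a cochain which is annihilated by
the contractions with `L_{(1)}` and `N_{(0)}`. -/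
structure IsReduced {q : ℕ} (w : Fin q → ESVGen) (n : Fin q →₀ ℕ) (c : ESVGen) (k : ℕ) : Prop where
  weight_eq : weightDefect w n c k = 0
  charge_eq : chargeDefect w c = 0
  ne_L : ∀ i, w i = .L → n i ≠ 1
  ne_N : ∀ i, w i = .N → n i ≠ 0
  ne_of_ne : ∀ i j, i ≠ j → w i = w j → n i ≠ n j

/-- Count for each argument twice its weight contribution plus its charge. This is at least 2,
except for L and Y with exponent 0, which give -2 and 0 and occur at most once each by `ne_of_ne`.
The total is the charge of c minus twice the weight of ∂^k c, which is at most 0; so 2q ≤ 4 + 2. -/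
theorem IsReduced.le_three {q : ℕ} {w : Fin q → ESVGen} {n : Fin q →₀ ℕ} {c : ESVGen} {k : ℕ}
    (h : IsReduced w n c k) : q ≤ 3 := by
  have h1 : ∀ (g : ESVGen) (i j : Fin q), (w i = g ∧ n i = 0) → (w j = g ∧ n j = 0) → i = j := by
    intro g i j hi hj
    by_contra hij
    exact h.ne_of_ne i j hij (hi.1.trans hj.1.symm) (hi.2.trans hj.2.symm)
  have hL := sum_ite_le_one (h1 .L)
  have hY := sum_ite_le_one (h1 .Y)
  have h2 : ∀ i ∈ Finset.univ, (2 : ℤ) ≤ (2 * (n i : ℤ) + 2 - ESV.twoWeight (w i)) +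
      ESV.intCharge (w i) + 4 * (if w i = .L ∧ n i = 0 then 1 else 0) +
        2 * (if w i = .Y ∧ n i = 0 then 1 else 0) := by
    intro i _
    have hL := h.ne_L i
    have hN := h.ne_N i
    cases hw : w i <;> simp only [hw, ESV.twoWeight, ESV.intCharge, true_and, false_and, if_false,
      reduceCtorEq, true_imp_iff, false_imp_iff] at * <;> (try split_ifs) <;> omega
  have h3 := Finset.sum_le_sum h2
  simp only [Finset.sum_add_distrib, ← Finset.mul_sum, Finset.sum_const, Finset.card_univ,
    Fintype.card_fin, nsmul_eq_mul] at h3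
  have h4 := h.weight_eq
  have h5 := h.charge_eq
  simp only [weightDefect, chargeDefect] at h4 h5
  simp only [Finset.sum_sub_distrib, Finset.sum_add_distrib, ← Finset.mul_sum] at h3 h4
  cases c <;> simp only [ESV.twoWeight, ESV.intCharge] at h4 h5 h3 <;> omega

/-- The tuples of generators on which a reduced weight zero cochain may be non-zero, up to
permutations. -/
def criticalTuples : List (List ESVGen) := [[.L], [.L, .M], [.L, .Y], [.L, .Y, .Y]]

/-- In each degree up to 3 the conditions are linear inequalities for each choice of generators, and
a case analysis leaves only the entries of `criticalTuples` up to order. -/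
theorem isReduced_one {w : Fin 1 → ESVGen} {n : Fin 1 →₀ ℕ} {c : ESVGen} {k : ℕ}
    (h : IsReduced w n c k) : w 0 = .L := by
  have h1 := h.weight_eq
  have h2 := h.charge_eq
  have hL := h.ne_L 0
  have hN := h.ne_N 0
  simp only [weightDefect, chargeDefect, Fin.sum_univ_one] at h1 h2
  cases h0 : w 0 <;> cases c <;> simp only [h0, ESV.twoWeight, ESV.intCharge, reduceCtorEq,
    true_imp_iff, false_imp_iff] at * <;> omega

theorem isReduced_two {w : Fin 2 → ESVGen} {n : Fin 2 →₀ ℕ} {c : ESVGen} {k : ℕ}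
    (h : IsReduced w n c k) : (w 0 = .L ∧ (w 1 = .M ∨ w 1 = .Y)) ∨
      (w 1 = .L ∧ (w 0 = .M ∨ w 0 = .Y)) := by
  have h1 := h.weight_eq
  have h2 := h.charge_eq
  have hL := h.ne_L 0
  have hN := h.ne_N 0
  have hL' := h.ne_L 1
  have hN' := h.ne_N 1
  have hd := h.ne_of_ne 0 1 (by decide)
  simp only [weightDefect, chargeDefect, Fin.sum_univ_two] at h1 h2
  clear h
  cases h0 : w 0 <;> cases h0' : w 1 <;> simp only [h0, h0', ESV.twoWeight, ESV.intCharge,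
    reduceCtorEq, true_imp_iff, false_imp_iff, or_false, or_true, false_or, and_true, and_false]
    at * <;> cases c <;> simp only [ESV.twoWeight, ESV.intCharge] at * <;> omega

theorem isReduced_three {w : Fin 3 → ESVGen} {n : Fin 3 →₀ ℕ} {c : ESVGen} {k : ℕ}
    (h : IsReduced w n c k) : (w 0 = .L ∧ w 1 = .Y ∧ w 2 = .Y) ∨
      (w 0 = .Y ∧ w 1 = .L ∧ w 2 = .Y) ∨ (w 0 = .Y ∧ w 1 = .Y ∧ w 2 = .L) := by
  have h1 := h.weight_eq
  have h2 := h.charge_eq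
  have hL := h.ne_L 0
  have hN := h.ne_N 0
  have hL' := h.ne_L 1
  have hN' := h.ne_N 1
  have hL2 := h.ne_L 2
  have hN2 := h.ne_N 2
  have hd := h.ne_of_ne 0 1 (by decide)
  have hd' := h.ne_of_ne 0 2 (by decide)
  have hd2 := h.ne_of_ne 1 2 (by decide)
  simp only [weightDefect, chargeDefect, Fin.sum_univ_three] at h1 h2
  clear h
  cases h0 : w 0 <;> cases h0' : w 1 <;> cases h0'' : w 2 <;> simp only [h0, h0', h0'',
    ESV.twoWeight, ESV.intCharge, reduceCtorEq, true_imp_iff, false_imp_iff, or_false, or_true,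
    false_or, and_true, and_false] at * <;> cases c <;>
    simp only [ESV.twoWeight, ESV.intCharge] at * <;> omega

theorem IsReduced.exists_perm {q : ℕ} {w : Fin q → ESVGen} {n : Fin q →₀ ℕ} {c : ESVGen} {k : ℕ}
    (h : IsReduced w n c k) : ∃ σ : Equiv.Perm (Fin q), List.ofFn (w ∘ σ) ∈ criticalTuples := by
  have hq := h.le_three
  interval_cases q
  -- In degree zero the defect is twice the weight of ∂^k c, which is positive.
  · have h1 := h.weight_eq
    simp only [weightDefect, Fin.sum_univ_zero] at h1
    cases c <;> simp only [ESV.twoWeight] at h1 <;> omega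
  · exact ⟨1, by simp [List.ofFn_succ, isReduced_one h, criticalTuples]⟩
  · rcases isReduced_two h with ⟨h0, h1 | h1⟩ | ⟨h0, h1 | h1⟩
    · exact ⟨1, by simp [List.ofFn_succ, h0, h1, criticalTuples]⟩
    · exact ⟨1, by simp [List.ofFn_succ, h0, h1, criticalTuples]⟩
    · exact ⟨Equiv.swap 0 1, by simp [List.ofFn_succ, h0, h1, criticalTuples]⟩
    · exact ⟨Equiv.swap 0 1, by simp [List.ofFn_succ, h0, h1, criticalTuples]⟩
  · rcases isReduced_three h with ⟨h0, h1, h2⟩ | ⟨h0, h1, h2⟩ | ⟨h0, h1, h2⟩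
    · exact ⟨1, by simp [List.ofFn_succ, h0, h1, h2, criticalTuples]⟩
    · have : Equiv.swap (0 : Fin 3) 1 2 = 2 := by decide
      exact ⟨Equiv.swap 0 1, by simp [List.ofFn_succ, h0, h1, h2, criticalTuples, this]⟩
    · have : Equiv.swap (0 : Fin 3) 2 1 = 1 := by decide
      exact ⟨Equiv.swap 0 2, by simp [List.ofFn_succ, h0, h1, h2, criticalTuples, this]⟩

/-- The two contraction hypotheses exclude the arguments L with exponent 1 and N with exponent 0,
which contribute nothing to weight or charge and would otherwise leave the degree unbounded in the
count. -/
theorem eq_zero_of_isWeightZero {q : ℕ} {f : PreCochain F (ESV F) (ESV F) (q + 1)}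
    (hf : f ∈ (esv F).adjoint.cochains (q + 1)) (hw : IsWeightZero f)
    (hL : contract (ESV.gen F .L) 1 f = 0) (hN : contract (ESV.gen F .N) 0 f = 0)
    (hv : ∀ w, List.ofFn w ∈ criticalTuples → f (ESV.gens F w) = 0) : f = 0 := by
  refine cochain_ext hf (zero_mem _) fun w n c k => ?_
  have h0 : coordinate (0 : PreCochain F (ESV F) (ESV F) (q + 1)) w n c k = 0 := by
    simp [coordinate]
  rw [h0]
  by_contra hc
  have hr : IsReduced w n c k :=
    ⟨(hw w n c k hc).1, (hw w n c k hc).2,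
      fun i hi hn => hc (coordinate_eq_zero_of_contract hf hL hi hn c k),
      fun i hi hn => hc (coordinate_eq_zero_of_contract hf hN hi hn c k),
      fun i j hij h1 h2 => hc (coordinate_eq_zero_of_repeated hf hij h1 h2 c k)⟩
  obtain ⟨σ, hσ⟩ := hr.exists_perm
  refine hc ?_
  rw [coordinate, apply_gens_eq_zero_of_perm hf σ (hv _ hσ), map_zero, MvPolynomial.coeff_zero]

end Vanishing
end
end LieConformal

namespace LieConformal

noncomputable section

/-! ### Values on the critical tuples and the definition of the homotopy. -/

section Evaluation

variable {F : Type*} [Field F]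

/-- The `F[∂]`-linear map which maps `c₁` to `c₂` and the other generators to zero. -/
def ESV.matrixUnit (F : Type*) [Field F] (c₁ c₂ : ESVGen) : ESV F →ₗ[F] ESV F :=
  LinearMap.single F (fun _ => F[X]) c₂ ∘ₗ LinearMap.proj c₁

theorem ESV.matrixUnit_gen (c₁ c₂ c : ESVGen) :
    ESV.matrixUnit F c₁ c₂ (ESV.gen F c) = if c₁ = c then ESV.gen F c₂ else 0 := by
  by_cases h : c₁ = c
  · subst h; simp [ESV.matrixUnit, ESV.gen]
  · simp [ESV.matrixUnit, ESV.gen, h]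

theorem update_gens {q : ℕ} (w : Fin q → ESVGen) (i : Fin q) (c : ESVGen) :
    Function.update (ESV.gens F w) i (ESV.gen F c) = ESV.gens F (Function.update w i c) := by
  funext j
  by_cases h : j = i
  · subst h; simp [ESV.gens]
  · simp [ESV.gens, Function.update_of_ne h]

theorem ESV.actCoeff_eq (n : ℕ) (g h : ESVGen) (α β γ : F) (c : ESVGen)
    (ht : ESV.table F g h = ESV.lin F α β γ c) :
    actCoeff (ESV.bracket F) n (ESV.gen F g) (ESV.gen F h) =
      (if n = 0 then α • ESV.der F (ESV.gen F c) + γ • ESV.gen F c else 0) +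
        if n = 1 then β • ESV.gen F c else 0 :=
  ESV.actCoeff_lin _ _ _ _ _ _ _ ((ESV.bracket_gen F _ _).trans ht) n

theorem ESV.actCoeff_eq_zero (n : ℕ) (g h : ESVGen) (ht : ESV.table F g h = 0) :
    actCoeff (ESV.bracket F) n (ESV.gen F g) (ESV.gen F h) = 0 := by
  rw [actCoeff_apply, ESV.bracket_gen, ht, map_zero]

theorem coeffAt_zero_C {q : ℕ} (i : Fin q) (r : F) :
    coeffAt i 0 (MvPolynomial.C r) = MvPolynomial.C r := by
  simp [coeffAt, MvPolynomial.algebraMap_eq, headCoeff_C]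

theorem coeffAt_one_C {q : ℕ} (i : Fin q) (r : F) :
    coeffAt i 1 (MvPolynomial.C r) = 0 := by
  simp [coeffAt, MvPolynomial.algebraMap_eq, headCoeff_C]

theorem coeffAt_one_X {q : ℕ} (i j : Fin q) :
    coeffAt i 1 (MvPolynomial.X j : MvPolynomial (Fin q) F) = if j = i then 1 else 0 := by
  rw [coeffAt, LinearMap.comp_apply, AlgHom.toLinearMap_apply, MvPolynomial.aeval_X]
  by_cases h : j = i
  · subst h; simp [headCoeff_X_zero]
  · rw [Function.update_of_ne h, headCoeff_X_succ, if_neg h, if_neg one_ne_zero]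

variable [CharZero F]

theorem apply_gens_eq_zero {q : ℕ} {f : PreCochain F (ESV F) (ESV F) q} (hf : IsWeightZero f)
    {w : Fin q → ESVGen} (h : ∀ n c k, weightDefect w n c k = 0 → chargeDefect w c = 0 → False) :
    f (ESV.gens F w) = 0 := by
  refine coordinate_ext_gens (g := 0) fun n c k => ?_
  have h0 : coordinate (0 : PreCochain F (ESV F) (ESV F) q) w n c k = 0 := by simp [coordinate]
  rw [h0]
  by_contra hc
  exact h n c k (hf w n c k hc).1 (hf w n c k hc).2

theorem exists_apply_gens_eq {q : ℕ} {f : PreCochain F (ESV F) (ESV F) q} (hf : IsWeightZero f)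
    {w : Fin q → ESVGen} (c₀ : ESVGen)
    (h : ∀ n c k, weightDefect w n c k = 0 → chargeDefect w c = 0 →
      c = c₀ ∧ k = 0 ∧ ∀ i, n i = 0) :
    f (ESV.gens F w) = (MvPolynomial.C (coordinate f w 0 c₀ 0)) ⊗ₜ ESV.gen F c₀ := by
  refine polyCoord_ext fun c k => MvPolynomial.ext _ _ fun n => ?_
  change coordinate f w n c k = _
  rw [polyCoord_tmul, MvPolynomial.algebraMap_eq, ← map_mul, MvPolynomial.coeff_C]
  by_cases hc : coordinate f w n c k = 0
  · rw [hc]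
    split_ifs with hn
    · subst hn
      by_cases h1 : c = c₀
      · subst h1
        cases k with
        | zero => rw [hc, zero_mul]
        | succ k => simp [ESV.gen, Polynomial.coeff_one]
      · simp [ESV.gen, Pi.single_eq_of_ne h1]
    · rfl
  · obtain ⟨rfl, rfl, hn⟩ := h n c k (hf w n c k hc).1 (hf w n c k hc).2
    obtain rfl : n = 0 := Finsupp.ext hn
    simp [ESV.gen]

/-- Charge zero forces c = M, and weight zero then reads n_0 + n_1 + n_2 + k = 1. Skew-symmetry in
the two arguments Y excludes n_1 = n_2, so only multiples of λ_1 - λ_2 remain. -/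
theorem isWeightZero_LYY {f : PreCochain F (ESV F) (ESV F) 3}
    (hf : f ∈ (esv F).adjoint.cochains 3) (hw : IsWeightZero f) :
    f (ESV.gens F ![.L, .Y, .Y]) =
      (MvPolynomial.C (coordinate f ![.L, .Y, .Y] (Finsupp.single 1 1) .M 0) *
        (MvPolynomial.X 1 - MvPolynomial.X 2)) ⊗ₜ ESV.gen F .M := by
  refine polyCoord_ext fun c k => MvPolynomial.ext _ _ fun n => ?_
  change coordinate f _ n c k = _
  have h21 : coordinate f ![.L, .Y, .Y] (Finsupp.single 2 1) .M 0 =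
      -coordinate f ![.L, .Y, .Y] (Finsupp.single 1 1) .M 0 := by
    have h := coordinate_comp_perm hf (Equiv.swap 1 2) ![.L, .Y, .Y] (Finsupp.single 2 1) .M 0
    have h1 : (![.L, .Y, .Y] : Fin 3 → ESVGen) ∘ Equiv.swap 1 2 = ![.L, .Y, .Y] := by decide
    rw [h1, Finsupp.mapDomain_single, Equiv.swap_apply_right,
      Equiv.Perm.sign_swap (by decide)] at h
    simpa using h
  rw [polyCoord_tmul, MvPolynomial.algebraMap_eq, mul_comm, MvPolynomial.coeff_C_mul,
    MvPolynomial.coeff_C_mul, MvPolynomial.coeff_sub, MvPolynomial.coeff_X, MvPolynomial.coeff_X]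
  by_cases hcM : c = .M
  · subst hcM
    cases k with
    | succ k =>
      simp only [ESV.gen, Pi.single_eq_same, Polynomial.coeff_one, Nat.add_eq_zero_iff, one_ne_zero,
        and_false, if_false, zero_mul]
      by_contra hc
      have h1 := (hw _ n _ _ hc).1
      simp only [weightDefect, Fin.sum_univ_three, ESV.twoWeight, Matrix.cons_val] at h1
      -- A positive power of ∂ uses up the whole weight, so all exponents are zero and those of the
      -- two arguments Y coincide.
      exact hc (coordinate_eq_zero_of_repeated hf (i := 1) (j := 2) (by decide) rfl (by omega) _ _)
    | zero =>
      simp only [ESV.gen, Pi.single_eq_same, Polynomial.coeff_one, if_true, one_mul]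
      split_ifs with h1 h2 h2
      · rw [← h2] at h1
        have := DFunLike.congr_fun h1 1
        simp at this
      · rw [← h1]; simp
      · rw [← h2, h21]; simp
      · rw [sub_zero, mul_zero]
        by_contra hc
        have h3 := (hw _ n _ _ hc).1
        simp only [weightDefect, Fin.sum_univ_three, ESV.twoWeight, Matrix.cons_val] at h3
        have h4 : n 1 ≠ n 2 := fun h => hc
          (coordinate_eq_zero_of_repeated hf (i := 1) (j := 2) (by decide) rfl h _ _)
        have h5 : (n 1 = 1 ∧ n 0 = 0 ∧ n 2 = 0) ∨ (n 1 = 0 ∧ n 0 = 0 ∧ n 2 = 1) := by omega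
        rcases h5 with ⟨ha, hb, hd⟩ | ⟨ha, hb, hd⟩
        · refine h1 (Finsupp.ext fun i => ?_)
          fin_cases i <;> simp [ha, hb, hd, Finsupp.single_apply]
        · refine h2 (Finsupp.ext fun i => ?_)
          fin_cases i <;> simp [ha, hb, hd, Finsupp.single_apply]
  · simp only [ESV.gen, Pi.single_eq_of_ne hcM, Polynomial.coeff_zero, zero_mul]
    by_contra hc
    have h1 := (hw _ n _ _ hc).2
    simp only [chargeDefect, Fin.sum_univ_three, Matrix.cons_val] at h1
    cases c <;> simp [ESV.intCharge] at h1 hcM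

/-- The contraction of a cochain with `Y_{(1)}` and then the matrix unit `M ↦ Y`, subtracted from
the contraction with `M_{(0)}` and the matrix unit `M ↦ N`. -/
def homotopy {q : ℕ} : PreCochain F (ESV F) (ESV F) (q + 1) →ₗ[F] PreCochain F (ESV F) (ESV F) q :=
  post (ESV.matrixUnit F .M .N) ∘ₗ contract (ESV.gen F .M) 0 -
    post (ESV.matrixUnit F .M .Y) ∘ₗ contract (ESV.gen F .Y) 1

theorem homotopy_apply {q : ℕ} (f : PreCochain F (ESV F) (ESV F) (q + 1)) :
    homotopy f = post (ESV.matrixUnit F .M .N) (contract (ESV.gen F .M) 0 f) -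
      post (ESV.matrixUnit F .M .Y) (contract (ESV.gen F .Y) 1 f) := rfl

/-- The bracket [M_λ L] = λM has no constant term and M commutes with M and Y, so only arguments N
could contribute slot terms. -/
theorem lieDer_M_gens {q : ℕ} (f : PreCochain F (ESV F) (ESV F) q) {w : Fin q → ESVGen}
    (hN : ∀ i, w i ≠ .N) : lieDer (esv F).adjoint (ESV.gen F .M) 0 f (ESV.gens F w) =
      (actCoeff (ESV.bracket F) 0 (ESV.gen F .M)).lTensor _ (f (ESV.gens F w)) := by
  rw [lieDer_zero_apply]
  refine (sub_eq_self.2 (Finset.sum_eq_zero fun i _ => ?_))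
  have h : actCoeff (ESV.bracket F) 0 (ESV.gen F .M) (ESV.gen F (w i)) = 0 := by
    cases h : w i
    · rw [ESV.actCoeff_eq 0 .M .L 0 1 0 .M rfl]; simp
    · exact ESV.actCoeff_eq_zero 0 .M .M rfl
    · exact ESV.actCoeff_eq_zero 0 .M .Y rfl
    · exact absurd h (hN i)
  change f (Function.update _ i (actCoeff (ESV.bracket F) 0 (ESV.gen F .M) (ESV.gen F (w i)))) = 0
  rw [h, MultilinearMap.map_update_zero]

/-- The contribution of the `i`-th argument to the Lie derivative along `Y_{(1)}`. -/
def slotY {q : ℕ} (f : PreCochain F (ESV F) (ESV F) q) (w : Fin q → ESVGen) (i : Fin q) :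
    MvPolynomial (Fin q) F ⊗[F] ESV F :=
  f (Function.update (ESV.gens F w) i
    (actCoeff (ESV.bracket F) 1 (ESV.gen F .Y) (ESV.gen F (w i)))) +
    mapT _ (MvPolynomial.pderiv i).toLinearMap (f (Function.update (ESV.gens F w) i
      (actCoeff (ESV.bracket F) 0 (ESV.gen F .Y) (ESV.gen F (w i)))))

theorem lieDer_Y_gens {q : ℕ} (f : PreCochain F (ESV F) (ESV F) q) (w : Fin q → ESVGen) :
    lieDer (esv F).adjoint (ESV.gen F .Y) 1 f (ESV.gens F w) =
      (actCoeff (ESV.bracket F) 1 (ESV.gen F .Y)).lTensor _ (f (ESV.gens F w)) -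
        ∑ i, slotY f w i := lieDer_one_apply _ _ _ _

theorem map_update_der_gen {q : ℕ} {f : PreCochain F (ESV F) (ESV F) q}
    (hf : f ∈ (esv F).adjoint.cochains q) (w : Fin q → ESVGen) (i : Fin q) (c : ESVGen) :
    f (Function.update (ESV.gens F w) i (ESV.der F (ESV.gen F c))) =
      -((MvPolynomial.X i : MvPolynomial (Fin q) F) • f (ESV.gens F (Function.update w i c))) := by
  have h := map_update_der_gens hf (Function.update (ESV.gens F w) i (ESV.gen F c)) i
  rwa [Function.update_self, Function.update_idem, update_gens] at h

/-- Y_(1)L and Y_(0)L are multiples of Y and ∂Y, so both summands see f only with Y placed in slot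
i. -/
theorem slotY_L {q : ℕ} {f : PreCochain F (ESV F) (ESV F) q}
    (hf : f ∈ (esv F).adjoint.cochains q) {w : Fin q → ESVGen} {i : Fin q} (hi : w i = .L)
    (h : f (ESV.gens F (Function.update w i .Y)) = 0) : slotY f w i = 0 := by
  rw [slotY, hi, ESV.actCoeff_eq 1 .Y .L (1 / 2) (3 / 2) 0 .Y rfl,
    ESV.actCoeff_eq 0 .Y .L (1 / 2) (3 / 2) 0 .Y rfl]
  simp only [one_ne_zero, if_false, if_true, zero_ne_one, zero_smul, add_zero, zero_add,
    MultilinearMap.map_update_smul, update_gens, map_update_der_gen hf, h, smul_zero, neg_zero,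
    map_zero]

theorem slotY_M {q : ℕ} (f : PreCochain F (ESV F) (ESV F) q) {w : Fin q → ESVGen} {i : Fin q}
    (hi : w i = .M) : slotY f w i = 0 := by
  rw [slotY, hi, ESV.actCoeff_eq_zero 1 .Y .M rfl, ESV.actCoeff_eq_zero 0 .Y .M rfl]
  simp only [MultilinearMap.map_update_zero, map_zero, add_zero]

/-- Y_(1)Y = 2M contributes 2, while Y_(0)Y = ∂M contributes the derivative of -λ_i, that is -1; the
net factor is 1. -/
theorem slotY_Y {q : ℕ} {f : PreCochain F (ESV F) (ESV F) q}
    (hf : f ∈ (esv F).adjoint.cochains q) {w : Fin q → ESVGen} {i : Fin q} (hi : w i = .Y)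
    {r : F} {v : ESV F}
    (h : f (ESV.gens F (Function.update w i .M)) = MvPolynomial.C r ⊗ₜ v) :
    slotY f w i = MvPolynomial.C r ⊗ₜ v := by
  rw [slotY, hi, ESV.actCoeff_eq 1 .Y .Y 1 2 0 .M rfl, ESV.actCoeff_eq 0 .Y .Y 1 2 0 .M rfl]
  simp only [one_ne_zero, if_false, if_true, zero_ne_one, zero_smul, add_zero, zero_add, one_smul,
    MultilinearMap.map_update_smul, update_gens, map_update_der_gen hf, h,
    TensorProduct.smul_tmul', map_neg, mapT_tmul, smul_eq_mul]
  have : (MvPolynomial.pderiv i).toLinearMap (MvPolynomial.X i * MvPolynomial.C r :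
      MvPolynomial (Fin q) F) = MvPolynomial.C r := by
    simp [mul_comm]
  rw [this, two_smul, TensorProduct.add_tmul]
  exact add_neg_cancel_right _ _

end Evaluation
end
end LieConformal

namespace LieConformal

noncomputable section

/-! ### The homotopy identity on the critical tuples. -/

section Homotopy

variable {F : Type*} [Field F]

theorem dPre_sub {A : Type*} [AddCommGroup A] [Module F A] {V : Type*} [AddCommGroup V] [Module F V]
    {𝔤 : LieConformalAlgebra F A} (M : LCAModule 𝔤 V) {q : ℕ} (f g : PreCochain F A V q) :
    dPre M (f - g) = dPre M f - dPre M g := by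
  have h := dPre_add M (f - g) g
  rw [sub_add_cancel] at h
  rw [h, add_sub_cancel_right]

variable [CharZero F]

theorem prodAt_commAct_gens {q : ℕ} (c₁ c₂ a b : ESVGen) (p r : MvPolynomial (Fin q) F) :
    prodAt (commAct (esv F).adjoint (ESV.matrixUnit F c₁ c₂)) p (1 ⊗ₜ ESV.gen F a)
      (r ⊗ₜ ESV.gen F b) = r • evalLam p (ESV.bracket F (ESV.gen F a)
        (ESV.matrixUnit F c₁ c₂ (ESV.gen F b)) -
          (ESV.matrixUnit F c₁ c₂).lTensor F[X] (ESV.table F a b)) := by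
  rw [prodAt_tmul, one_smul, ← ESV.bracket_gen]
  rfl

/-- M and Y commute with M, so only the brackets with N, the image of M under the matrix unit,
remain: [M_λ N] = -2M and [Y_λ N] = -Y. -/
theorem prodAt_commAct_N {q : ℕ} (a : ESVGen) (ha : a = .M ∨ a = .Y) (p r : MvPolynomial (Fin q) F) :
    prodAt (commAct (esv F).adjoint (ESV.matrixUnit F .M .N)) p (1 ⊗ₜ ESV.gen F a)
      (r ⊗ₜ ESV.gen F .M) = -(ESV.intCharge a • r ⊗ₜ ESV.gen F a) := by
  rw [prodAt_commAct_gens, ESV.matrixUnit_gen, if_pos rfl, ESV.bracket_gen]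
  rcases ha with rfl | rfl <;>
    simp [ESV.table, ESV.lin, ESV.intCharge, evalLam, TensorProduct.smul_tmul', two_smul,
      TensorProduct.add_tmul, TensorProduct.neg_tmul]

/-- Since [Y_λ M] = 0, only [Y_λ Y] = (∂ + 2λ)M remains. -/
theorem prodAt_commAct_Y {q : ℕ} (p r : MvPolynomial (Fin q) F) :
    prodAt (commAct (esv F).adjoint (ESV.matrixUnit F .M .Y)) p (1 ⊗ₜ ESV.gen F .Y)
      (r ⊗ₜ ESV.gen F .M) = r ⊗ₜ ESV.der F (ESV.gen F .M) + (2 * r * p) ⊗ₜ ESV.gen F .M := by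
  rw [prodAt_commAct_gens, ESV.matrixUnit_gen, if_pos rfl, ESV.bracket_gen]
  simp only [ESV.table, map_zero, sub_zero, ESV.evalLam_lin, smul_add, TensorProduct.smul_tmul',
    smul_eq_mul, map_one, one_mul, mul_one, zero_mul, TensorProduct.zero_tmul, add_zero, map_ofNat,
    mul_zero]
  congr 2
  ring

theorem dPre_homotopy_gens {q : ℕ} {f : PreCochain F (ESV F) (ESV F) (q + 1)}
    (hf : f ∈ (esv F).adjoint.cochains (q + 1)) (hd : dPre (esv F).adjoint f = 0)
    {w : Fin (q + 1) → ESVGen} (hN : ∀ i, w i ≠ .N) :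
    dPre (esv F).adjoint (homotopy f) (ESV.gens F w) =
      ((ESV.matrixUnit F .M .N).lTensor _
        ((actCoeff (ESV.bracket F) 0 (ESV.gen F .M)).lTensor _ (f (ESV.gens F w))) +
        ∑ i, prodAt (commAct (esv F).adjoint (ESV.matrixUnit F .M .N)) (MvPolynomial.X i)
          (1 ⊗ₜ ESV.gen F (w i))
          (mapT _ (coeffAt i 0) (f (ESV.gens F (Function.update w i .M))))) -
      ((ESV.matrixUnit F .M .Y).lTensor _
        ((actCoeff (ESV.bracket F) 1 (ESV.gen F .Y)).lTensor _ (f (ESV.gens F w)) -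
          ∑ i, slotY f w i) +
        ∑ i, prodAt (commAct (esv F).adjoint (ESV.matrixUnit F .M .Y)) (MvPolynomial.X i)
          (1 ⊗ₜ ESV.gen F (w i))
          (mapT _ (coeffAt i 1) (f (ESV.gens F (Function.update w i .Y))))) := by
  rw [homotopy_apply, dPre_sub, sub_apply, dPre_post_contract_apply _ _ _ _ hf hd,
    dPre_post_contract_apply _ _ _ _ hf hd, lieDer_M_gens f hN, lieDer_Y_gens]
  simp only [update_gens]

/-- The value is rN. M_(0)N = -2M, carried back to N by the matrix unit, gives the factor -2; Y_(1)N
= 0, and the values on M and on Y vanish for reasons of weight and charge. -/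
theorem dPre_homotopy_L {f : PreCochain F (ESV F) (ESV F) 1}
    (hf : f ∈ (esv F).adjoint.cochains 1) (hd : dPre (esv F).adjoint f = 0) (hw : IsWeightZero f) :
    (dPre (esv F).adjoint (homotopy f) + 2 • f) (ESV.gens F ![.L]) = 0 := by
  have hL := exists_apply_gens_eq hw (w := ![.L]) .N fun n c k h1 h2 => by
    cases c <;> simp [weightDefect, chargeDefect, ESV.twoWeight, ESV.intCharge] at h1 h2 ⊢ <;> omega
  have hM : f (ESV.gens F (Function.update ![.L] 0 .M)) = 0 :=
    apply_gens_eq_zero hw fun n c k h1 h2 => by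
      cases c <;> simp [weightDefect, chargeDefect, ESV.twoWeight, ESV.intCharge] at h1 h2 ⊢ <;> omega
  have hY : f (ESV.gens F (Function.update ![.L] 0 .Y)) = 0 :=
    apply_gens_eq_zero hw fun n c k h1 h2 => by
      cases c <;> simp [weightDefect, chargeDefect, ESV.twoWeight, ESV.intCharge] at h1 h2 ⊢ <;> omega
  generalize coordinate f _ _ _ _ = r at hL
  rw [add_apply, smul_apply, dPre_homotopy_gens hf hd (by decide), Fin.sum_univ_one,
    Fin.sum_univ_one, Fin.sum_univ_one, hM, hY, slotY_L hf rfl hY, hL]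
  simp only [LinearMap.lTensor_tmul, ESV.actCoeff_eq 1 .Y .N 0 0 (-1) .Y rfl, map_zero, add_zero, sub_zero,
    ESV.actCoeff_eq 0 .M .N 0 0 (-2) .M rfl]
  simp only [zero_ne_one, one_ne_zero, if_true, if_false, reduceIte, zero_smul, one_smul, zero_add, add_zero,
    map_smul, map_sub, LinearMap.lTensor_tmul, ESV.matrixUnit_gen, TensorProduct.tmul_smul, smul_zero, TensorProduct.tmul_zero, sub_zero,
    map_zero]
  module

/-- The values of weight zero on the tuples in question, with at most one non-zero coordinate. -/
theorem exists_value_LM {f : PreCochain F (ESV F) (ESV F) 2} (hw : IsWeightZero f) :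
    f (ESV.gens F ![.L, .M]) =
      MvPolynomial.C (coordinate f ![.L, .M] 0 .M 0) ⊗ₜ ESV.gen F .M :=
  exists_apply_gens_eq hw .M fun n c k h1 h2 => by
    cases c <;> simp [weightDefect, chargeDefect, ESV.twoWeight, ESV.intCharge] at h1 h2 ⊢ <;> omega

theorem exists_value_LY {f : PreCochain F (ESV F) (ESV F) 2} (hw : IsWeightZero f) :
    f (ESV.gens F ![.L, .Y]) =
      MvPolynomial.C (coordinate f ![.L, .Y] 0 .Y 0) ⊗ₜ ESV.gen F .Y :=
  exists_apply_gens_eq hw .Y fun n c k h1 h2 => by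
    cases c <;> simp [weightDefect, chargeDefect, ESV.twoWeight, ESV.intCharge] at h1 h2 ⊢ <;> omega

/-- Weight and charge exclude every case but (Y, Y), where weight zero makes both exponents 0 and
skew-symmetry applies. -/
theorem value_eq_zero_two {f : PreCochain F (ESV F) (ESV F) 2}
    (hf : f ∈ (esv F).adjoint.cochains 2) (hw : IsWeightZero f) {w : Fin 2 → ESVGen}
    (h0 : w 0 = .M ∨ w 0 = .Y) (h1 : w 1 = .M ∨ w 1 = .Y) : f (ESV.gens F w) = 0 := by
  by_cases h : w 0 = .Y ∧ w 1 = .Y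
  · refine coordinate_ext_gens (g := 0) fun n c k => ?_
    have hz : coordinate (0 : PreCochain F (ESV F) (ESV F) 2) w n c k = 0 := by simp [coordinate]
    rw [hz]
    by_contra hc
    obtain ⟨h1, h2⟩ := hw _ _ _ _ hc
    refine hc (coordinate_eq_zero_of_repeated hf (i := 0) (j := 1) (by decide)
      (h.1.trans h.2.symm) ?_ c k)
    cases c <;> simp [weightDefect, chargeDefect, ESV.twoWeight, ESV.intCharge, h] at h1 h2 ⊢ <;>
      omega
  · refine apply_gens_eq_zero hw fun n c k h2 h3 => ?_
    rcases h0 with h0 | h0 <;> rcases h1 with h1 | h1 <;> cases c <;>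
      simp [weightDefect, chargeDefect, ESV.twoWeight, ESV.intCharge, h0, h1] at h h2 h3 ⊢ <;> omega

/-- No generator has charge greater than 2. -/
theorem value_eq_zero_three {f : PreCochain F (ESV F) (ESV F) 3} (hw : IsWeightZero f)
    {w : Fin 3 → ESVGen} (h : ∑ i, ESV.intCharge (w i) = 3 ∨ ∑ i, ESV.intCharge (w i) = 4) :
    f (ESV.gens F w) = 0 :=
  apply_gens_eq_zero hw fun n c k h2 h3 => by
    simp only [chargeDefect] at h3
    cases c <;> simp only [ESV.intCharge] at h3 h <;> omega

/-- The factor -2 is the commutator of M with the matrix unit M ↦ N in slot 1. The Y part vanishes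
because the value on (L, Y) is constant in λ. -/
theorem dPre_homotopy_LM {f : PreCochain F (ESV F) (ESV F) 2}
    (hf : f ∈ (esv F).adjoint.cochains 2) (hd : dPre (esv F).adjoint f = 0) (hw : IsWeightZero f) :
    (dPre (esv F).adjoint (homotopy f) + 2 • f) (ESV.gens F ![.L, .M]) = 0 := by
  have u1 : Function.update ![.L, .M] 1 ESVGen.M = ![.L, .M] := by decide
  have u2 : Function.update ![.L, .M] 1 ESVGen.Y = ![.L, .Y] := by decide
  have hLM := exists_value_LM hw
  have hLY := exists_value_LY hw
  have hMM : f (ESV.gens F (Function.update ![.L, .M] 0 .M)) = 0 :=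
    value_eq_zero_two hf hw (by decide) (by decide)
  have hYM : f (ESV.gens F (Function.update ![.L, .M] 0 .Y)) = 0 :=
    value_eq_zero_two hf hw (by decide) (by decide)
  generalize coordinate f _ _ _ _ = r at hLM
  generalize coordinate f _ _ _ _ = s at hLY
  rw [add_apply, smul_apply, dPre_homotopy_gens hf hd (by decide), Fin.sum_univ_two,
    Fin.sum_univ_two, Fin.sum_univ_two, hMM, hYM, slotY_L hf rfl hYM, slotY_M f rfl, u1, u2, hLM, hLY]
  simp only [LinearMap.lTensor_tmul, ESV.actCoeff_eq_zero 1 .Y .M rfl,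
    ESV.actCoeff_eq_zero 0 .M .M rfl, map_zero, add_zero, sub_zero, zero_add,
    mapT_tmul, coeffAt_zero_C, coeffAt_one_C, TensorProduct.zero_tmul, TensorProduct.tmul_zero]
  change prodAt _ _ (1 ⊗ₜ ESV.gen F .M) _ + _ = _
  rw [prodAt_commAct_N _ (Or.inl rfl)]
  simp only [ESV.intCharge]
  module

/-- Let the values on (L, M) and (L, Y) be rM and sY. The M part gives -rY and the Y part gives (2s
- r)Y, so their difference is -2sY and r drops out. -/
theorem dPre_homotopy_LY {f : PreCochain F (ESV F) (ESV F) 2}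
    (hf : f ∈ (esv F).adjoint.cochains 2) (hd : dPre (esv F).adjoint f = 0) (hw : IsWeightZero f) :
    (dPre (esv F).adjoint (homotopy f) + 2 • f) (ESV.gens F ![.L, .Y]) = 0 := by
  have u1 : Function.update ![.L, .Y] 1 ESVGen.M = ![.L, .M] := by decide
  have u2 : Function.update ![.L, .Y] 1 ESVGen.Y = ![.L, .Y] := by decide
  have hLM := exists_value_LM hw
  have hLY := exists_value_LY hw
  have hMY : f (ESV.gens F (Function.update ![.L, .Y] 0 .M)) = 0 :=
    value_eq_zero_two hf hw (by decide) (by decide)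
  have hYY : f (ESV.gens F (Function.update ![.L, .Y] 0 .Y)) = 0 :=
    value_eq_zero_two hf hw (by decide) (by decide)
  generalize coordinate f _ _ _ _ = r at hLM
  generalize coordinate f _ _ _ _ = s at hLY
  rw [add_apply, smul_apply, dPre_homotopy_gens hf hd (by decide), Fin.sum_univ_two,
    Fin.sum_univ_two, Fin.sum_univ_two, hMY, hYY, slotY_L hf rfl hYY,
    slotY_Y hf (i := 1) rfl (by rw [u1]; exact hLM), u1, u2, hLM, hLY]
  simp only [LinearMap.lTensor_tmul, ESV.actCoeff_eq 1 .Y .Y 1 2 0 .M rfl,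
    ESV.actCoeff_eq_zero 0 .M .Y rfl, map_zero, add_zero, sub_zero, zero_add,
    mapT_tmul, coeffAt_zero_C, coeffAt_one_C, TensorProduct.zero_tmul, TensorProduct.tmul_zero]
  change prodAt _ _ (1 ⊗ₜ ESV.gen F .Y) _ - _ + _ = _
  rw [prodAt_commAct_N _ (Or.inr rfl)]
  simp only [ESV.intCharge, zero_ne_one, one_ne_zero, if_true, if_false, reduceIte, zero_smul, one_smul, zero_add, add_zero,
    map_smul, map_sub, LinearMap.lTensor_tmul, ESV.matrixUnit_gen, TensorProduct.tmul_smul, smul_zero, TensorProduct.tmul_zero, sub_zero,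
    map_zero]
  module

/-- With value r(λ_1 - λ_2)M, the slots 1 and 2 of the Y part give r(∂ + 2λ_1)M and -r(∂ + 2λ_2)M.
The terms in ∂ cancel and the sum is 2r(λ_1 - λ_2)M, entering with a minus sign. -/
theorem dPre_homotopy_LYY {f : PreCochain F (ESV F) (ESV F) 3}
    (hf : f ∈ (esv F).adjoint.cochains 3) (hd : dPre (esv F).adjoint f = 0) (hw : IsWeightZero f) :
    (dPre (esv F).adjoint (homotopy f) + 2 • f) (ESV.gens F ![.L, .Y, .Y]) = 0 := by
  have u1 : Function.update ![.L, .Y, .Y] 1 ESVGen.Y = ![.L, .Y, .Y] := by decide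
  have u2 : Function.update ![.L, .Y, .Y] 2 ESVGen.Y = ![.L, .Y, .Y] := by decide
  have hLYY := isWeightZero_LYY hf hw
  have h0M : f (ESV.gens F (Function.update ![.L, .Y, .Y] 0 .M)) = 0 :=
    value_eq_zero_three hw (by decide)
  have h1M : f (ESV.gens F (Function.update ![.L, .Y, .Y] 1 .M)) = 0 :=
    value_eq_zero_three hw (by decide)
  have h2M : f (ESV.gens F (Function.update ![.L, .Y, .Y] 2 .M)) = 0 :=
    value_eq_zero_three hw (by decide)
  have h0Y : f (ESV.gens F (Function.update ![.L, .Y, .Y] 0 .Y)) = 0 :=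
    value_eq_zero_three hw (by decide)
  -- Zero is put in the form of a constant tensor so that `slotY_Y` applies.
  have hz : ∀ x : MvPolynomial (Fin 3) F ⊗[F] ESV F, x = 0 → x = MvPolynomial.C 0 ⊗ₜ[F] 0 := by
    intro x hx; rw [hx, TensorProduct.tmul_zero]
  generalize coordinate f _ _ _ _ = r at hLYY
  rw [add_apply, smul_apply, dPre_homotopy_gens hf hd (by decide), Fin.sum_univ_three,
    Fin.sum_univ_three, Fin.sum_univ_three, h0M, h1M, h2M, h0Y, slotY_L hf rfl h0Y,
    slotY_Y hf (i := 1) rfl (hz _ h1M), slotY_Y hf (i := 2) rfl (hz _ h2M), u1, u2, hLYY]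
  have h1 : coeffAt (1 : Fin 3) 1 (MvPolynomial.C r * (MvPolynomial.X 1 - MvPolynomial.X 2)) =
      MvPolynomial.C r := by
    rw [MvPolynomial.C_mul', map_smul, map_sub, coeffAt_one_X, coeffAt_one_X]
    simp [MvPolynomial.C_eq_smul_one]
  have h2 : coeffAt (2 : Fin 3) 1 (MvPolynomial.C r * (MvPolynomial.X 1 - MvPolynomial.X 2)) =
      -MvPolynomial.C r := by
    rw [MvPolynomial.C_mul', map_smul, map_sub, coeffAt_one_X, coeffAt_one_X]
    simp [MvPolynomial.C_eq_smul_one]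
  simp only [LinearMap.lTensor_tmul, ESV.actCoeff_eq_zero 1 .Y .M rfl,
    ESV.actCoeff_eq_zero 0 .M .M rfl, map_zero, add_zero, sub_zero, zero_add,
    mapT_tmul, h1, h2, TensorProduct.zero_tmul, TensorProduct.tmul_zero]
  change 0 - (prodAt _ _ (1 ⊗ₜ ESV.gen F .Y) _ + prodAt _ _ (1 ⊗ₜ ESV.gen F .Y) _) + _ = _
  rw [prodAt_commAct_Y, prodAt_commAct_Y]
  simp only [neg_mul, mul_neg, TensorProduct.neg_tmul, mul_sub, TensorProduct.sub_tmul, mul_assoc,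
    two_mul, add_mul, TensorProduct.add_tmul]
  module

theorem dPre_homotopy_critical {q : ℕ} {f : PreCochain F (ESV F) (ESV F) (q + 1)}
    (hf : f ∈ (esv F).adjoint.cochains (q + 1)) (hd : dPre (esv F).adjoint f = 0)
    (hw : IsWeightZero f) {w : Fin (q + 1) → ESVGen} (h : List.ofFn w ∈ criticalTuples) :
    (dPre (esv F).adjoint (homotopy f) + 2 • f) (ESV.gens F w) = 0 := by
  simp only [criticalTuples, List.mem_cons, List.not_mem_nil, or_false] at h
  rcases h with h | h | h | h
  · have hl := congrArg List.length h
    simp only [List.length_ofFn, List.length_cons, List.length_nil] at hl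
    obtain rfl : q = 0 := by omega
    rw [List.ofFn_injective (h.trans (by simp [List.ofFn_succ] : _ = List.ofFn ![ESVGen.L]))]
    exact dPre_homotopy_L hf hd hw
  · have hl := congrArg List.length h
    simp only [List.length_ofFn, List.length_cons, List.length_nil] at hl
    obtain rfl : q = 1 := by omega
    rw [List.ofFn_injective (h.trans (by simp [List.ofFn_succ] : _ = List.ofFn ![ESVGen.L, .M]))]
    exact dPre_homotopy_LM hf hd hw
  · have hl := congrArg List.length h
    simp only [List.length_ofFn, List.length_cons, List.length_nil] at hl
    obtain rfl : q = 1 := by omega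
    rw [List.ofFn_injective (h.trans (by simp [List.ofFn_succ] : _ = List.ofFn ![ESVGen.L, .Y]))]
    exact dPre_homotopy_LY hf hd hw
  · have hl := congrArg List.length h
    simp only [List.length_ofFn, List.length_cons, List.length_nil] at hl
    obtain rfl : q = 2 := by omega
    rw [List.ofFn_injective (h.trans (by simp [List.ofFn_succ] :
      _ = List.ofFn ![ESVGen.L, .Y, .Y]))]
    exact dPre_homotopy_LYY hf hd hw

end Homotopy
end
end LieConformal

namespace LieConformal

noncomputable section

/-! ### The homotopy identity in all degrees, and spectral projections. -/

section BasicCohomologyVanishing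

variable {F : Type*} [Field F] [CharZero F]

theorem coordinate_post_matrixUnit {q : ℕ} (c₁ c₂ : ESVGen) (f : PreCochain F (ESV F) (ESV F) q)
    (w : Fin q → ESVGen) (n : Fin q →₀ ℕ) (c : ESVGen) (k : ℕ) :
    coordinate (post (ESV.matrixUnit F c₁ c₂) f) w n c k =
      if c = c₂ then coordinate f w n c₁ k else 0 := by
  rw [coordinate, post_apply, polyCoord_lTensor _ c c₁ k k (if c = c₂ then 1 else 0)]
  · split_ifs <;> simp [coordinate]
  · intro v
    by_cases h : c = c₂
    · subst h; simp [ESV.matrixUnit]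
    · simp [ESV.matrixUnit, h, Pi.single_eq_of_ne h]

theorem homotopy_mem {q : ℕ} {f : PreCochain F (ESV F) (ESV F) (q + 1)}
    (hf : f ∈ (esv F).adjoint.cochains (q + 1)) : homotopy f ∈ (esv F).adjoint.cochains q :=
  sub_mem (post_mem _ _ (contract_mem _ _ _ hf)) (post_mem _ _ (contract_mem _ _ _ hf))

theorem coordinate_sub {q : ℕ} (f g : PreCochain F (ESV F) (ESV F) q) (w : Fin q → ESVGen)
    (n : Fin q →₀ ℕ) (c : ESVGen) (k : ℕ) :
    coordinate (f - g) w n c k = coordinate f w n c k - coordinate g w n c k := by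
  simp [coordinate, sub_apply]

theorem coordinate_homotopy {q : ℕ} (f : PreCochain F (ESV F) (ESV F) (q + 1))
    (w : Fin q → ESVGen) (n : Fin q →₀ ℕ) (c : ESVGen) (k : ℕ) :
    coordinate (homotopy f) w n c k =
      (if c = .N then coordinate f (Fin.cons .M w) (n.cons 0) .M k else 0) -
        if c = .Y then coordinate f (Fin.cons .Y w) (n.cons 1) .M k else 0 := by
  rw [homotopy_apply, coordinate_sub, coordinate_post_matrixUnit, coordinate_post_matrixUnit,
    coordinate_contract, coordinate_contract]

theorem weightDefect_cons {q : ℕ} (g : ESVGen) (m : ℕ) (w : Fin q → ESVGen) (n : Fin q →₀ ℕ)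
    (c : ESVGen) (k : ℕ) : weightDefect (Fin.cons g w : Fin (q + 1) → ESVGen) (n.cons m) c k =
      2 * m + 2 - ESV.twoWeight g + weightDefect w n c k := by
  simp only [weightDefect, Fin.sum_univ_succ, Fin.cons_zero, Fin.cons_succ, Finsupp.cons_zero,
    Finsupp.cons_succ]
  ring

theorem chargeDefect_cons {q : ℕ} (g : ESVGen) (w : Fin q → ESVGen) (c : ESVGen) :
    chargeDefect (Fin.cons g w : Fin (q + 1) → ESVGen) c = chargeDefect w c - ESV.intCharge g := by
  simp only [chargeDefect, Fin.sum_univ_succ, Fin.cons_zero, Fin.cons_succ]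
  ring

/-- Contraction with M_(0) has weight 0 and is paired with M ↦ N, which preserves the weight.
Contraction with Y_(1) shifts the doubled weight by 1, as does M ↦ Y. The charges match likewise. -/
theorem isWeightZero_homotopy {q : ℕ} {f : PreCochain F (ESV F) (ESV F) (q + 1)}
    (hf : IsWeightZero f) : IsWeightZero (homotopy f) := by
  intro w n c k hc
  rw [coordinate_homotopy] at hc
  have h1 : c = .N ∨ c = .Y := by
    by_contra h
    rw [not_or] at h
    rw [if_neg h.1, if_neg h.2, sub_zero] at hc
    exact hc rfl
  rcases h1 with rfl | rfl
  · simp only [if_true, reduceCtorEq, if_false, sub_zero] at hc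
    have h := hf _ _ _ _ hc
    rw [weightDefect_cons, chargeDefect_cons] at h
    simpa [weightDefect, chargeDefect, ESV.twoWeight, ESV.intCharge] using h
  · simp only [if_true, reduceCtorEq, if_false, zero_sub, neg_ne_zero] at hc
    have h := hf _ _ _ _ hc
    rw [weightDefect_cons, chargeDefect_cons] at h
    simp only [weightDefect, chargeDefect, ESV.twoWeight, ESV.intCharge] at h ⊢
    constructor <;> push_cast at h ⊢ <;> omega

theorem isWeightZero_contract {q : ℕ} {f : PreCochain F (ESV F) (ESV F) (q + 1)}
    (hf : IsWeightZero f) {g : ESVGen} {m : ℕ} (hm : 2 * m + 2 = ESV.twoWeight g)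
    (hg : ESV.intCharge g = 0) : IsWeightZero (contract (ESV.gen F g) m f) := by
  intro w n c k hc
  rw [coordinate_contract] at hc
  have h := hf _ _ _ _ hc
  rw [weightDefect_cons, chargeDefect_cons, hm, hg] at h
  simpa using h

theorem eq_zero_of_isWeightZero_zero {f : PreCochain F (ESV F) (ESV F) 0}
    (hf : f ∈ (esv F).adjoint.cochains 0) (hw : IsWeightZero f) : f = 0 := by
  refine cochain_eq_zero hf fun w => apply_gens_eq_zero hw fun n c k h _ => ?_
  simp only [weightDefect, Fin.sum_univ_zero] at h
  cases c <;> simp only [ESV.twoWeight] at h <;> omega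

theorem coordinate_neg {q : ℕ} (f : PreCochain F (ESV F) (ESV F) q) (w : Fin q → ESVGen)
    (n : Fin q →₀ ℕ) (c : ESVGen) (k : ℕ) :
    coordinate (-f) w n c k = -coordinate f w n c k := by
  simp [coordinate, neg_apply]

/-- Two contractions anticommute by skew-symmetry, and the matrix units act only on values. -/
theorem homotopy_contract {q : ℕ} {f : PreCochain F (ESV F) (ESV F) (q + 2)}
    (hf : f ∈ (esv F).adjoint.cochains (q + 2)) (g : ESVGen) (m : ℕ) :
    homotopy (contract (ESV.gen F g) m f) = -contract (ESV.gen F g) m (homotopy f) := by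
  refine cochain_ext (homotopy_mem (contract_mem _ _ _ hf))
    (neg_mem (contract_mem _ _ _ (homotopy_mem hf))) fun w n c k => ?_
  have h0 : ∀ i : Fin q, Equiv.swap (0 : Fin (q + 2)) 1 i.succ.succ = i.succ.succ := fun i =>
    Equiv.swap_apply_of_ne_of_ne (Fin.succ_ne_zero _)
      fun h => Fin.succ_ne_zero _ (Fin.succ_injective _ h)
  have h : ∀ (g' : ESVGen) (m' : ℕ),
      coordinate f (Fin.cons g (Fin.cons g' w)) ((n.cons m').cons m) .M k =
        -coordinate f (Fin.cons g' (Fin.cons g w)) ((n.cons m).cons m') .M k := by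
    intro g' m'
    have h1 := coordinate_comp_perm hf (Equiv.swap 0 1)
      (Fin.cons g' (Fin.cons g w) : Fin (q + 2) → ESVGen) ((n.cons m').cons m) .M k
    have h2 : (Fin.cons g' (Fin.cons g w) : Fin (q + 2) → ESVGen) ∘ Equiv.swap 0 1 =
        Fin.cons g (Fin.cons g' w) := by
      funext i
      cases i using Fin.cases with
      | zero => rw [Function.comp_apply, Equiv.swap_apply_left]; rfl
      | succ i =>
        cases i using Fin.cases with
        | zero =>
          have : (Fin.succ 0 : Fin (q + 2)) = 1 := rfl
          rw [this, Function.comp_apply, Equiv.swap_apply_right]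
          rfl
        | succ i =>
          rw [Function.comp_apply, h0]
          rfl
    have h3 : ((n.cons m').cons m).mapDomain (Equiv.swap (0 : Fin (q + 2)) 1) =
        (n.cons m).cons m' := by
      ext i
      rw [Finsupp.mapDomain_equiv_apply, Equiv.symm_swap]
      cases i using Fin.cases with
      | zero => rw [Equiv.swap_apply_left]; rfl
      | succ i =>
        cases i using Fin.cases with
        | zero =>
          have : (Fin.succ 0 : Fin (q + 2)) = 1 := rfl
          rw [this, Equiv.swap_apply_right]
          rfl
        | succ i =>
          rw [h0]
          rfl
    rw [h2, h3, Equiv.Perm.sign_swap (by simp)] at h1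
    simpa using h1
  rw [coordinate_neg, coordinate_homotopy, coordinate_contract, coordinate_contract,
    coordinate_contract, coordinate_homotopy, h, h]
  split_ifs <;> ring

theorem dPre_zero {q : ℕ} :
    dPre (esv F).adjoint (0 : PreCochain F (ESV F) (ESV F) q) = 0 := by
  have h := dPre_sub (esv F).adjoint (0 : PreCochain F (ESV F) (ESV F) q) 0
  rwa [sub_self, sub_self] at h

theorem dPre_homotopy_add_mem {q : ℕ} {f : PreCochain F (ESV F) (ESV F) (q + 1)}
    (hf : f ∈ (esv F).adjoint.cochains (q + 1)) (hd : dPre (esv F).adjoint f = 0) :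
    dPre (esv F).adjoint (homotopy f) + 2 • f ∈ (esv F).adjoint.cochains (q + 1) := by
  rw [homotopy_apply, dPre_sub]
  exact add_mem (sub_mem (dPre_post_contract_mem _ _ _ _ hf hd)
    (dPre_post_contract_mem _ _ _ _ hf hd)) (nsmul_mem hf 2)

/-- The common part of both induction steps: the critical values are known, so only the contractions
with L_(1) and N_(0), the modes described by the numerical conditions on g and m, remain to be
checked. -/
theorem dPre_homotopy_of_contract {q : ℕ} {f : PreCochain F (ESV F) (ESV F) (q + 1)}
    (hf : f ∈ (esv F).adjoint.cochains (q + 1)) (hd : dPre (esv F).adjoint f = 0)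
    (hw : IsWeightZero f)
    (hc : ∀ (g : ESVGen) (m : ℕ), 2 * m + 2 = ESV.twoWeight g → ESV.intCharge g = 0 →
      lieDer (esv F).adjoint (ESV.gen F g) m (homotopy f) = 0 →
      lieDer (esv F).adjoint (ESV.gen F g) m f = 0 →
        contract (ESV.gen F g) m (dPre (esv F).adjoint (homotopy f) + 2 • f) = 0) :
    dPre (esv F).adjoint (homotopy f) + 2 • f = 0 := by
  have h1 := (isWeightZero_iff (homotopy_mem hf)).1 (isWeightZero_homotopy hw)
  have h2 := (isWeightZero_iff hf).1 hw
  refine eq_zero_of_isWeightZero (dPre_homotopy_add_mem hf hd) ?_ (hc .L 1 rfl rfl h1.1 h2.1)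
    (hc .N 0 rfl rfl h1.2 h2.2) fun w h => dPre_homotopy_critical hf hd hw h
  rw [isWeightZero_iff (dPre_homotopy_add_mem hf hd), map_add, map_add, map_nsmul, map_nsmul,
    lieDer_dPre, lieDer_dPre, h1.1, h1.2, h2.1, h2.2, dPre_zero, smul_zero, add_zero]
  exact ⟨rfl, rfl⟩

/-- On cocycles of weight zero, `-1 / 2` times the homotopy inverts the differential. -/
theorem dPre_homotopy {q : ℕ} : ∀ {f : PreCochain F (ESV F) (ESV F) (q + 1)},
    f ∈ (esv F).adjoint.cochains (q + 1) → dPre (esv F).adjoint f = 0 → IsWeightZero f →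
      dPre (esv F).adjoint (homotopy f) + 2 • f = 0 := by
  induction q with
  | zero =>
    intro f hf hd hw
    refine dPre_homotopy_of_contract hf hd hw fun g m hm hg h1 _ => ?_
    rw [map_add, contract_dPre_zero, h1, zero_add, map_nsmul,
      eq_zero_of_isWeightZero_zero (contract_mem _ _ _ hf) (isWeightZero_contract hw hm hg),
      smul_zero]
  | succ q ih =>
    intro f hf hd hw
    refine dPre_homotopy_of_contract hf hd hw fun g m hm hg h1 h2 => ?_
    -- With h the homotopy and the Lie derivatives zero, ι d h f = -d ι h f = d h ι f. Since ι f is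
    -- again a cocycle of weight zero, the induction hypothesis makes this -2 ι f.
    have h3 := contract_dPre (esv F).adjoint (ESV.gen F g) m (homotopy_mem hf)
    have h4 := contract_dPre (esv F).adjoint (ESV.gen F g) m hf
    rw [hd, map_zero, zero_add, h2] at h4
    have h5 := ih (contract_mem _ _ _ hf) h4 (isWeightZero_contract hw hm hg)
    rw [homotopy_contract hf, ← zero_sub, dPre_sub, dPre_zero, zero_sub] at h5
    rw [h1] at h3
    rw [map_add, eq_neg_of_add_eq_zero_left h3, map_nsmul, h5]

/-- The element Q(θ)f / Q(0) is killed by θ, and it differs from f by an element of θ(S), because Q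
- Q(0) is divisible by the variable. No eigenspace decomposition is needed. -/
theorem exists_of_aeval_eq_zero {C : Type*} [AddCommGroup C] [Module F C] (θ : C →ₗ[F] C)
    {S B : Submodule F C} (hS : ∀ f ∈ S, θ f ∈ S) (hB : ∀ f ∈ S, θ f ∈ B) {f : C} (hf : f ∈ S)
    {Q : F[X]} (hQ : Q.coeff 0 ≠ 0)
    (h : Polynomial.aeval θ (Polynomial.X * Q) f = 0) : ∃ g ∈ S, θ g = 0 ∧ f - g ∈ B := by
  have hmem : ∀ (P : F[X]) (f : C), f ∈ S → Polynomial.aeval θ P f ∈ S := by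
    intro P
    induction P using Polynomial.induction_on' with
    | add x y hx hy =>
      intro f hf
      rw [map_add, LinearMap.add_apply]
      exact add_mem (hx f hf) (hy f hf)
    | monomial n r =>
      intro f hf
      rw [Polynomial.aeval_monomial, Module.End.mul_apply, Module.algebraMap_end_apply]
      refine S.smul_mem r ?_
      induction n with
      | zero => simpa using hf
      | succ n ih => rw [pow_succ', Module.End.mul_apply]; exact hS _ ih
  refine ⟨(Q.coeff 0)⁻¹ • Polynomial.aeval θ Q f, S.smul_mem _ (hmem Q f hf), ?_, ?_⟩
  · rw [map_mul, Polynomial.aeval_X, Module.End.mul_apply] at h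
    rw [map_smul, h, smul_zero]
  · have h1 : Polynomial.aeval θ Q f = θ (Polynomial.aeval θ Q.divX f) + Q.coeff 0 • f := by
      conv_lhs => rw [← Polynomial.X_mul_divX_add Q]
      rw [map_add, map_mul, Polynomial.aeval_X, Polynomial.aeval_C, LinearMap.add_apply,
        Module.End.mul_apply, Module.algebraMap_end_apply]
    rw [h1, smul_add, inv_smul_smul₀ hQ, sub_add_cancel_right]
    exact neg_mem (B.smul_mem _ (hB _ (hmem _ f hf)))

theorem coordinate_aeval {q : ℕ}
    (θ : PreCochain F (ESV F) (ESV F) q →ₗ[F] PreCochain F (ESV F) (ESV F) q)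
    (hmem : ∀ f ∈ (esv F).adjoint.cochains q, θ f ∈ (esv F).adjoint.cochains q)
    (e : (Fin q → ESVGen) → (Fin q →₀ ℕ) → ESVGen → ℕ → F)
    (he : ∀ f ∈ (esv F).adjoint.cochains q, ∀ w n c k,
      coordinate (θ f) w n c k = e w n c k * coordinate f w n c k) (P : F[X]) :
    ∀ f ∈ (esv F).adjoint.cochains q, Polynomial.aeval θ P f ∈ (esv F).adjoint.cochains q ∧
      ∀ w n c k, coordinate (Polynomial.aeval θ P f) w n c k =
        P.eval (e w n c k) * coordinate f w n c k := by
  induction P using Polynomial.induction_on' with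
  | add x y hx hy =>
    intro f hf
    refine ⟨?_, fun w n c k => ?_⟩
    · rw [map_add, LinearMap.add_apply]
      exact add_mem (hx f hf).1 (hy f hf).1
    · rw [map_add, LinearMap.add_apply, coordinate_add, (hx f hf).2, (hy f hf).2,
        Polynomial.eval_add, add_mul]
  | monomial m r =>
    intro f hf
    have h : (θ ^ m) f ∈ (esv F).adjoint.cochains q ∧ ∀ w n c k,
        coordinate ((θ ^ m) f) w n c k = e w n c k ^ m * coordinate f w n c k := by
      induction m with
      | zero => simpa using hf
      | succ m ih =>
        rw [pow_succ', Module.End.mul_apply]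
        refine ⟨hmem _ ih.1, fun w n c k => ?_⟩
        rw [he _ ih.1, ih.2]
        ring
    rw [Polynomial.aeval_monomial, Module.End.mul_apply, Module.algebraMap_end_apply]
    refine ⟨Submodule.smul_mem _ _ h.1, fun w n c k => ?_⟩
    rw [coordinate_smul, h.2, Polynomial.eval_monomial, mul_assoc]

theorem exists_polynomial {q : ℕ}
    (θ : PreCochain F (ESV F) (ESV F) q →ₗ[F] PreCochain F (ESV F) (ESV F) q)
    (hmem : ∀ f ∈ (esv F).adjoint.cochains q, θ f ∈ (esv F).adjoint.cochains q)
    (e : (Fin q → ESVGen) → (Fin q →₀ ℕ) → ESVGen → ℕ → F)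
    (he : ∀ f ∈ (esv F).adjoint.cochains q, ∀ w n c k,
      coordinate (θ f) w n c k = e w n c k * coordinate f w n c k)
    {f : PreCochain F (ESV F) (ESV F) q} (hf : f ∈ (esv F).adjoint.cochains q) :
    ∃ Q : F[X], Q.coeff 0 ≠ 0 ∧ Polynomial.aeval θ (Polynomial.X * Q) f = 0 := by
  classical
  -- The non-zero eigenvalues that occur in f; erasing 0 makes Q(0) non-zero, and the factor X in
  -- the statement accounts for the eigenvalue 0.
  let T : Finset F := (Finset.univ.biUnion fun w =>
    (finite_coordinates (f (ESV.gens F w))).toFinset.image fun i => e w i.1 i.2.1 i.2.2).erase 0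
  refine ⟨∏ t ∈ T, (Polynomial.X - Polynomial.C t), ?_, ?_⟩
  · rw [Polynomial.coeff_zero_eq_eval_zero, Polynomial.eval_prod, Finset.prod_ne_zero_iff]
    intro t ht
    simpa using (Finset.mem_erase.1 ht).1
  · have h := coordinate_aeval θ hmem e he
      (Polynomial.X * ∏ t ∈ T, (Polynomial.X - Polynomial.C t)) f hf
    refine cochain_ext h.1 (zero_mem _) fun w n c k => ?_
    have h0 : coordinate (0 : PreCochain F (ESV F) (ESV F) q) w n c k = 0 := by simp [coordinate]
    rw [h.2, h0]
    by_cases hc : coordinate f w n c k = 0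
    · rw [hc, mul_zero]
    · rw [Polynomial.eval_mul, Polynomial.eval_X, Polynomial.eval_prod]
      by_cases hz : e w n c k = 0
      · rw [hz, zero_mul, zero_mul]
      · rw [Finset.prod_eq_zero (i := e w n c k), mul_zero, zero_mul]
        · refine Finset.mem_erase.2 ⟨hz, Finset.mem_biUnion.2 ⟨w, Finset.mem_univ _,
            Finset.mem_image.2 ⟨(n, c, k), ?_, rfl⟩⟩⟩
          rw [Set.Finite.mem_toFinset]
          exact hc
        · simp

end BasicCohomologyVanishing
end
end LieConformal

namespace LieConformal

noncomputable section

/-! ### Cocycles and coboundaries in terms of the multilinear differential. -/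

section Cocycles

variable {F : Type*} [Field F] {A : Type*} [AddCommGroup A] [Module F A]
  {V : Type*} [AddCommGroup V] [Module F V] {𝔤 : LieConformalAlgebra F A} (M : LCAModule 𝔤 V)

theorem coe_dPre {q : ℕ} (f : PreCochain F A V q) : ⇑(dPre M f) = M.d q f :=
  funext fun w => dPre_apply M f w

theorem mem_basicCocycles_iff {q : ℕ} {f : PreCochain F A V q} :
    f ∈ M.basicCocycles q ↔ f ∈ M.cochains q ∧ dPre M f = 0 := by
  rw [LCAModule.basicCocycles, Submodule.mem_inf, LinearMap.mem_ker, ← coe_dPre]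
  refine and_congr_right fun _ => ⟨fun h => MultilinearMap.ext fun w => congrFun h w, fun h => ?_⟩
  rw [h]
  rfl

theorem mem_basicCoboundaries_succ_iff {q : ℕ} {f : PreCochain F A V (q + 1)} :
    f ∈ M.basicCoboundaries (q + 1) ↔
      f ∈ M.cochains (q + 1) ∧ ∃ g ∈ M.cochains q, dPre M g = f := by
  change f ∈ M.cochains (q + 1) ∧ (∃ g ∈ M.cochains q, M.d q g = ⇑f) ↔ _
  refine and_congr_right fun _ => exists_congr fun g => and_congr_right fun _ => ?_
  rw [← coe_dPre]
  exact DFunLike.coe_fn_eq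

theorem lieDer_mem_basicCocycles (a : A) (n : ℕ) {q : ℕ} {f : PreCochain F A V q}
    (hf : f ∈ M.basicCocycles q) : lieDer M a n f ∈ M.basicCocycles q := by
  rw [mem_basicCocycles_iff] at hf ⊢
  refine ⟨lieDer_mem M a n hf.1, ?_⟩
  rw [← lieDer_dPre, hf.2, map_zero]

/-- On a cocycle Cartan's formula reduces to ℒ f = d ι f. -/
theorem lieDer_mem_basicCoboundaries (a : A) (n : ℕ) {q : ℕ} {f : PreCochain F A V (q + 1)}
    (hf : f ∈ M.basicCocycles (q + 1)) : lieDer M a n f ∈ M.basicCoboundaries (q + 1) := by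
  rw [mem_basicCocycles_iff] at hf
  rw [mem_basicCoboundaries_succ_iff]
  refine ⟨lieDer_mem M a n hf.1, contract a n f, contract_mem M a n hf.1, ?_⟩
  rw [← contract_dPre M a n hf.1, hf.2, map_zero, zero_add]

end Cocycles

/-! ### Vanishing of the basic cohomology. -/

section BasicCohomology

variable {F : Type*} [Field F] [CharZero F]

theorem exists_isWeightZero {q : ℕ} {f : PreCochain F (ESV F) (ESV F) (q + 1)}
    (hf : f ∈ (esv F).adjoint.basicCocycles (q + 1)) :
    ∃ g ∈ (esv F).adjoint.basicCocycles (q + 1), IsWeightZero g ∧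
      f - g ∈ (esv F).adjoint.basicCoboundaries (q + 1) := by
  let θ := lieDer (esv F).adjoint (ESV.gen F .L) 1 (q := q + 1)
  let η := lieDer (esv F).adjoint (ESV.gen F .N) 0 (q := q + 1)
  have hθ : ∀ f ∈ (esv F).adjoint.cochains (q + 1), ∀ w n c k, coordinate (θ f) w n c k =
      (weightDefect w n c k / 2 : F) * coordinate f w n c k := by
    intro f hf w n c k
    have h := coordinate_lieDer_L hf w n c k
    rw [div_mul_eq_mul_div, ← h, mul_div_cancel_left₀ _ two_ne_zero]
  have hη : ∀ f ∈ (esv F).adjoint.cochains (q + 1), ∀ w n c k, coordinate (η f) w n c k =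
      (chargeDefect w c : F) * coordinate f w n c k :=
    fun f _ w n c k => coordinate_lieDer_N f w n c k
  have hcomm : ∀ f ∈ (esv F).adjoint.cochains (q + 1), θ (η f) = η (θ f) := by
    intro f hf
    refine cochain_ext (lieDer_mem _ _ _ (lieDer_mem _ _ _ hf))
      (lieDer_mem _ _ _ (lieDer_mem _ _ _ hf)) fun w n c k => ?_
    rw [hθ _ (lieDer_mem _ _ _ hf), hη _ hf, hη _ (lieDer_mem _ _ _ hf), hθ _ hf]
    ring
  obtain ⟨Q, hQ, hQf⟩ := exists_polynomial θ (fun f hf => lieDer_mem _ _ _ hf) _ hθ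
    ((mem_basicCocycles_iff _).1 hf).1
  obtain ⟨g, hg, hθg, hfg⟩ := exists_of_aeval_eq_zero θ
    (fun f hf => lieDer_mem_basicCocycles _ _ _ hf)
    (fun f hf => lieDer_mem_basicCoboundaries _ _ _ hf) hf hQ hQf
  obtain ⟨Q', hQ', hQg⟩ := exists_polynomial η (fun f hf => lieDer_mem _ _ _ hf) _ hη
    ((mem_basicCocycles_iff _).1 hg).1
  -- The second projection is carried out inside the kernel of θ, so that weight zero is not lost;
  -- this kernel is stable under η because the two operators commute.
  obtain ⟨g', hg', hηg, hgg⟩ := exists_of_aeval_eq_zero η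
    (S := (esv F).adjoint.basicCocycles (q + 1) ⊓ LinearMap.ker θ)
    (fun f hf => ⟨lieDer_mem_basicCocycles _ _ _ hf.1, by
      have h : θ f = 0 := hf.2
      change θ (η f) = 0
      rw [hcomm _ ((mem_basicCocycles_iff _).1 hf.1).1, h, map_zero]⟩)
    (fun f hf => lieDer_mem_basicCoboundaries _ _ _ hf.1) ⟨hg, hθg⟩ hQ' hQg
  refine ⟨g', hg'.1, (isWeightZero_iff ((mem_basicCocycles_iff _).1 hg'.1).1).2 ⟨hg'.2, hηg⟩, ?_⟩
  rw [← sub_add_sub_cancel f g g']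
  exact add_mem hfg hgg

theorem basicCocycles_le_basicCoboundaries (q : ℕ) :
    (esv F).adjoint.basicCocycles q ≤ (esv F).adjoint.basicCoboundaries q := by
  intro f hf
  cases q with
  | zero =>
    rw [mem_basicCocycles_iff] at hf
    -- In degree zero ℒ f = ι d f, so a cocycle has weight zero without any correction, and hence
    -- vanishes.
    have h : ∀ (a : ESV F) (n : ℕ), lieDer (esv F).adjoint a n f = 0 := fun a n => by
      rw [← contract_dPre_zero, hf.2, map_zero]
    rw [eq_zero_of_isWeightZero_zero hf.1 ((isWeightZero_iff hf.1).2 ⟨h _ _, h _ _⟩)]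
    exact zero_mem _
  | succ q =>
    obtain ⟨g, hg, hw, hfg⟩ := exists_isWeightZero hf
    have hg' := (mem_basicCocycles_iff _).1 hg
    have h := dPre_homotopy hg'.1 hg'.2 hw
    have hB : dPre (esv F).adjoint (homotopy g) = (-2 : F) • g := by
      rw [eq_neg_of_add_eq_zero_left h]
      module
    rw [← sub_add_cancel f g]
    refine add_mem hfg ((mem_basicCoboundaries_succ_iff _).2 ⟨hg'.1, (-1 / 2 : F) • homotopy g,
      Submodule.smul_mem _ _ (homotopy_mem hg'.1), ?_⟩)
    rw [dPre_smul, hB, smul_smul]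
    norm_num

theorem subsingleton_basicCohomology (q : ℕ) :
    Subsingleton ((esv F).adjoint.BasicCohomology q) := by
  rw [LCAModule.BasicCohomology, Submodule.Quotient.subsingleton_iff]
  exact Submodule.comap_subtype_eq_top.2 (basicCocycles_le_basicCoboundaries q)

end BasicCohomology

/-! ### Compatibility of ∂ with the differential. -/

section TotalDerivative

variable {F : Type*} [Field F] {A : Type*} [AddCommGroup A] [Module F A]
  (𝔤 : LieConformalAlgebra F A) {S : Type*} [CommRing S] [Algebra F S]

/-- The operator `∂ + s_1 + ⋯ + s_q` on families. -/
def totalDerFam {q : ℕ} (E : Family F A A S q) : Family F A A S q := fun s =>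
  (𝔤.der.baseChange S).compMultilinearMap (E s) + (∑ i, s i) • E s

theorem totalDerFam_apply {q : ℕ} (E : Family F A A S q) (s : Fin q → S) (W : Fin q → S ⊗[F] A) :
    totalDerFam 𝔤 E s W = 𝔤.der.baseChange S (E s W) + (∑ i, s i) • E s W := rfl

/-- In an action term, moving ∂ out of the product adds the missing parameter s_k to the sum of the
others. In a bracket term the parameter s_k + s_l already keeps the total unchanged. -/
theorem dFam_totalDerFam {q : ℕ} (E : Family F A A S q) (s : Fin (q + 1) → S)
    (W : Fin (q + 1) → S ⊗[F] A) :
    dFam 𝔤.adjoint (totalDerFam 𝔤 E) s W = totalDerFam 𝔤 (dFam 𝔤.adjoint E) s W := by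
  have h1 : ∀ k, actFam 𝔤.adjoint.act (totalDerFam 𝔤 E) s k W =
      𝔤.der.baseChange S (actFam 𝔤.adjoint.act E s k W) +
        (∑ i, s i) • actFam 𝔤.adjoint.act E s k W := by
    intro k
    rw [actFam_apply, actFam_apply, totalDerFam_apply, map_add, map_smul,
      Fin.sum_univ_succAbove s k, add_smul, ← add_assoc]
    congr 1
    exact prodAt_der_right 𝔤.der 𝔤.bracket 𝔤.bracket_der_right _ _ _
  rw [totalDerFam_apply]
  cases q with
  | zero => simp only [dFam_zero_apply, h1]
  | succ n =>
    have h2 : ∀ (k : Fin (n + 2)) (j : Fin (n + 1)), brFam 𝔤.bracket (totalDerFam 𝔤 E) s k j W =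
        𝔤.der.baseChange S (brFam 𝔤.bracket E s k j W) +
          (∑ i, s i) • brFam 𝔤.bracket E s k j W := by
      intro k j
      rw [brFam_apply, brFam_apply, totalDerFam_apply, Fin.sum_univ_succ, Fin.sum_univ_succAbove s k,
        Fin.sum_univ_succAbove _ j, ← add_assoc]
      rfl
    have hz : ∀ (r : S) (m : ℤ) (x : S ⊗[F] A), r • m • x = m • r • x :=
      fun r m x => smul_comm r m x
    simp only [dFam_succ_apply, h1, h2, smul_add, Finset.sum_add_distrib, map_add, map_sum,
      map_zsmul, Finset.smul_sum, apply_ite (𝔤.der.baseChange S), map_zero,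
      smul_ite, smul_zero, hz, ← Finset.sum_filter]
    abel

theorem ev_derCochain {q : ℕ} (h : 𝔤.adjoint.cochains q) :
    (ev (𝔤.adjoint.derCochain q h).1 : Family F A A S q) = totalDerFam 𝔤 (ev h.1) := by
  funext s
  refine tensor_multilinear_ext fun w => ?_
  rw [ev_tmul, totalDerFam_apply, ev_tmul]
  change subst s (𝔤.adjoint.totalDer q (h.1 w)) = _
  induction h.1 w with
  | zero => simp
  | add x y hx hy => simp only [map_add, hx, hy, smul_add]; abel
  | tmul r v =>
    simp only [LCAModule.totalDer, LinearMap.add_apply, LinearMap.lTensor_tmul, Algebra.lsmul_coe,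
      TensorProduct.smul_tmul', smul_eq_mul, subst]
    generalize hp : (∑ i, MvPolynomial.X i : MvPolynomial (Fin q) F) = p
    simp only [map_add, LinearMap.rTensor_tmul, AlgHom.toLinearMap_apply, map_mul, LinearMap.baseChange_tmul]
    rw [← hp, map_sum (MvPolynomial.aeval s)]
    simp only [MvPolynomial.aeval_X]
    rfl

theorem dPre_derCochain {q : ℕ} (h : 𝔤.adjoint.cochains q) (w : Fin (q + 1) → A) :
    dPre 𝔤.adjoint (𝔤.adjoint.derCochain q h).1 w =
      𝔤.adjoint.totalDer (q + 1) (dPre 𝔤.adjoint h.1 w) := by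
  rw [dPre_apply, d_apply, ev_derCochain, dFam_totalDerFam, totalDerFam_apply, dPre_apply, d_apply]
  rfl

end TotalDerivative

/-! ### Vanishing of the reduced cohomology. -/

section ReducedCohomology

variable {F : Type*} [Field F] [CharZero F]

theorem polyCoord_eventually_zero {S : Type*} [CommRing S] [Algebra F S] (c : ESVGen)
    (x : S ⊗[F] ESV F) : ∃ K, ∀ k ≥ K, polyCoord c k x = 0 := by
  induction x with
  | zero => exact ⟨0, fun k _ => map_zero _⟩
  | add x y hx hy =>
    obtain ⟨K, hK⟩ := hx
    obtain ⟨K', hK'⟩ := hy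
    refine ⟨max K K', fun k hk => ?_⟩
    rw [map_add, hK k (le_trans (le_max_left _ _) hk), hK' k (le_trans (le_max_right _ _) hk),
      add_zero]
  | tmul r v =>
    refine ⟨(v c).natDegree + 1, fun k hk => ?_⟩
    rw [polyCoord_tmul, Polynomial.coeff_eq_zero_of_natDegree_lt (by omega), map_zero, mul_zero]

/-- The coefficient of ∂^k is determined by that of ∂^(k + 1), and high coefficients vanish, so
descending induction kills them all. This uses that the algebra is free over F[∂], and it includes q
= 0. -/
theorem totalDer_injective {q : ℕ} {x : MvPolynomial (Fin q) F ⊗[F] ESV F}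
    (h : (esv F).adjoint.totalDer q x = 0) : x = 0 := by
  refine polyCoord_ext fun c => ?_
  have h1 : ∀ k, polyCoord c k x = -((∑ i, MvPolynomial.X i) * polyCoord c (k + 1) x) := by
    intro k
    have h2 := congrArg (polyCoord c (k + 1)) h
    rw [LCAModule.totalDer, LinearMap.add_apply, map_add, Algebra.lsmul_coe, map_smul, map_zero,
      smul_eq_mul, polyCoord_lTensor _ c c (k + 1) k 1, one_smul] at h2
    · exact eq_neg_of_add_eq_zero_left h2
    · intro v
      change (Polynomial.X * v c).coeff (k + 1) = _
      rw [Polynomial.coeff_X_mul, one_mul]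
  obtain ⟨K, hK⟩ := polyCoord_eventually_zero c x
  have h2 : ∀ m k, K ≤ k + m → polyCoord c k x = 0 := by
    intro m
    induction m with
    | zero => exact fun k hk => hK k hk
    | succ m ih =>
      intro k hk
      rw [h1, ih (k + 1) (by omega), mul_zero, neg_zero]
  intro k
  rw [h2 K k (by omega), map_zero]

/-- A reduced cocycle satisfies d f = ∂h. Then ∂ d h = d d f = 0, so d h = 0 by injectivity and h =
d k. Now f - ∂k is a basic cocycle, hence a coboundary, in the same reduced class as f. -/
theorem subsingleton_reducedCohomology (q : ℕ) :
    Subsingleton ((esv F).adjoint.ReducedCohomology q) := by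
  rw [LCAModule.ReducedCohomology, Submodule.Quotient.subsingleton_iff]
  refine Submodule.comap_subtype_eq_top.2 ?_
  rintro _ ⟨⟨f, hf⟩, ⟨⟨h, hh⟩, hfh⟩, rfl⟩
  have h1 : dPre (esv F).adjoint f = ((esv F).adjoint.derCochain (q + 1) ⟨h, hh⟩).1 := by
    refine DFunLike.coe_injective ?_
    rw [coe_dPre]
    exact hfh.symm
  have h2 : dPre (esv F).adjoint h = 0 := by
    have h3 := dPre_dPre (esv F).adjoint hf (Subtype.property _) h1
    refine MultilinearMap.ext fun w => ?_
    refine totalDer_injective ?_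
    rw [← dPre_derCochain (esv F) ⟨h, hh⟩, h3]
    rfl
  have h3 := basicCocycles_le_basicCoboundaries (q + 1)
    ((mem_basicCocycles_iff (esv F).adjoint).2 ⟨hh, h2⟩)
  obtain ⟨-, k, hk, hkh⟩ := (mem_basicCoboundaries_succ_iff (esv F).adjoint).1 h3
  have h4 : f - ((esv F).adjoint.derCochain q ⟨k, hk⟩).1 ∈ (esv F).adjoint.basicCocycles q := by
    refine (mem_basicCocycles_iff _).2 ⟨sub_mem hf (Subtype.property _), ?_⟩
    refine MultilinearMap.ext fun w => ?_
    rw [dPre_sub, sub_apply, h1, dPre_derCochain (esv F) ⟨k, hk⟩, hkh]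
    exact sub_self _
  refine ⟨⟨_, ((mem_basicCocycles_iff _).1 h4).1⟩, basicCocycles_le_basicCoboundaries q h4, ?_⟩
  rw [Submodule.mkQ_apply, Submodule.mkQ_apply, Submodule.Quotient.eq]
  refine ⟨-⟨k, hk⟩, ?_⟩
  rw [map_neg]
  ext w : 2
  simp

end ReducedCohomology
end
end LieConformal

namespace LieConformal

noncomputable section

/-! ### Modes of the bracket and derivations in general. -/

section Derivations

variable {F : Type*} [Field F] {A : Type*} [AddCommGroup A] [Module F A]
  (𝔤 : LieConformalAlgebra F A)

theorem ad_eq_actCoeff (a b : A) : 𝔤.ad a b = actCoeff 𝔤.bracket 0 a b := by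
  rw [actCoeff_apply]
  change TensorProduct.lid F A (evalLam (0 : F) (𝔤.bracket a b)) = _
  induction 𝔤.bracket a b with
  | zero => simp
  | add x y hx hy => simp only [map_add, hx, hy]
  | tmul p v => simp [evalLam, lamCoeff, Polynomial.coeff_zero_eq_aeval_zero]

theorem lamCoeff_zero_X_smul (x : F[X] ⊗[F] A) :
    lamCoeff 0 ((Polynomial.X : F[X]) • x) = 0 := by
  induction x with
  | zero => simp
  | add x y hx hy => simp only [smul_add, map_add, hx, hy, add_zero]
  | tmul p v => simp [lamCoeff, TensorProduct.smul_tmul']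

theorem lamCoeff_succ_X_smul (n : ℕ) (x : F[X] ⊗[F] A) :
    lamCoeff (n + 1) ((Polynomial.X : F[X]) • x) = lamCoeff n x := by
  induction x with
  | zero => simp
  | add x y hx hy => simp only [smul_add, map_add, hx, hy]
  | tmul p v => simp [lamCoeff, TensorProduct.smul_tmul', Polynomial.coeff_X_mul]

theorem lamCoeff_lTensor (n : ℕ) (D : A →ₗ[F] A) (x : F[X] ⊗[F] A) :
    lamCoeff n (D.lTensor F[X] x) = D (lamCoeff n x) := by
  induction x with
  | zero => simp
  | add x y hx hy => simp only [map_add, hx, hy]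
  | tmul p v => simp [lamCoeff]

theorem actCoeff_succ_der_left (n : ℕ) (a b : A) :
    actCoeff 𝔤.bracket (n + 1) (𝔤.der a) b = -actCoeff 𝔤.bracket n a b := by
  rw [actCoeff_apply, 𝔤.bracket_der_left, map_neg, lamCoeff_succ_X_smul, actCoeff_apply]

theorem LieConformalAlgebra.IsDerivation.map_actCoeff {D : A →ₗ[F] A} (hD : 𝔤.IsDerivation D)
    (n : ℕ) (a b : A) : D (actCoeff 𝔤.bracket n a b) =
      actCoeff 𝔤.bracket n (D a) b + actCoeff 𝔤.bracket n a (D b) := by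
  rw [actCoeff_apply, actCoeff_apply, actCoeff_apply, ← map_add, ← hD.2, lamCoeff_lTensor]

end Derivations

/-! ### Casimir elements and derivations of the algebra. -/

section ESVDerivations

variable {F : Type*} [Field F] [CharZero F]

/-- The coefficients of `a_{(0)} g` for generators `g`, in terms of the constant coefficients
of `a`. -/
def ESV.adTable (r : ESVGen → F) : ESVGen → ESVGen → ℕ → F
  | .L, .L, 1 => r .L
  | .L, .Y, 1 => r .Y / 2
  | .M, .M, 1 => r .L
  | .M, .M, 0 => 2 * r .N
  | .Y, .Y, 1 => r .L
  | .Y, .M, 1 => r .Y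
  | .Y, .Y, 0 => r .N
  | .N, .N, 1 => r .L
  | .N, .M, 0 => -2 * r .M
  | .N, .Y, 0 => -r .Y
  | _, _, _ => 0

theorem ESV.sum_gen (f : ESVGen → ESV F) : ∑ g, f g = f .L + f .M + f .Y + f .N := by
  change ∑ g ∈ ({.L, .M, .Y, .N} : Finset ESVGen), f g = _
  rw [Finset.sum_insert (by decide), Finset.sum_insert (by decide), Finset.sum_insert (by decide),
    Finset.sum_singleton]
  abel

theorem ESV.eq_sum_add_der (a : ESV F) : a = ∑ g, (a g).coeff 0 • ESV.gen F g +
    ESV.der F fun g => (a g).divX := by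
  funext c
  rw [Pi.add_apply, ESV.der_apply, Finset.sum_apply, Finset.sum_eq_single c]
  · simp only [Pi.smul_apply, ESV.gen, Pi.single_eq_same, Polynomial.smul_eq_C_mul, mul_one]
    rw [add_comm, Polynomial.X_mul_divX_add]
  · intro g _ hg
    simp [ESV.gen, Pi.single_eq_of_ne' hg]
  · simp

theorem ESV.coeff_gen (g c : ESVGen) (k : ℕ) :
    (ESV.gen F g c).coeff k = if g = c ∧ k = 0 then 1 else 0 := by
  by_cases h : c = g
  · subst h; simp [ESV.gen, Polynomial.coeff_one]
  · simp [ESV.gen, Pi.single_eq_of_ne h, Ne.symm h]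

theorem ESV.coeff_der_gen (g c : ESVGen) (k : ℕ) :
    (ESV.der F (ESV.gen F g) c).coeff k = if g = c ∧ k = 1 then 1 else 0 := by
  rw [ESV.der_apply]
  cases k with
  | zero => simp
  | succ k => rw [Polynomial.coeff_X_mul, ESV.coeff_gen]; simp

theorem ESV.coeff_actCoeff_zero (g h : ESVGen) (α β γ : F) (e : ESVGen)
    (ht : ESV.table F g h = ESV.lin F α β γ e) (c : ESVGen) (k : ℕ) :
    (actCoeff (ESV.bracket F) 0 (ESV.gen F g) (ESV.gen F h) c).coeff k =
      if e = c then if k = 1 then α else if k = 0 then γ else 0 else 0 := by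
  rw [ESV.actCoeff_eq 0 g h α β γ e ht]
  simp only [if_true, zero_ne_one, if_false, add_zero, Pi.add_apply, Pi.smul_apply,
    Polynomial.coeff_add, Polynomial.coeff_smul, ESV.coeff_gen, ESV.coeff_der_gen, smul_eq_mul]
  by_cases h1 : e = c
  · rcases k with _ | _ | k <;> simp [h1]
  · simp [h1]

/-- Multiples of ∂ in a do not contribute, because (∂u)_(0) = 0; only the constant coefficients
matter. -/
theorem ESV.coeff_ad (a : ESV F) (g c : ESVGen) (k : ℕ) :
    (actCoeff (ESV.bracket F) 0 a (ESV.gen F g) c).coeff k =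
      ESV.adTable (fun h => (a h).coeff 0) g c k := by
  have h : actCoeff (ESV.bracket F) 0 a (ESV.gen F g) =
      ∑ h, (a h).coeff 0 • actCoeff (ESV.bracket F) 0 (ESV.gen F h) (ESV.gen F g) := by
    simp only [actCoeff_apply]
    conv_lhs => rw [ESV.eq_sum_add_der a]
    rw [map_add, map_sum, LinearMap.add_apply, map_add, LinearMap.sum_apply, map_sum]
    simp only [map_smul, LinearMap.smul_apply]
    rw [ESV.bracket_der_left, map_neg, lamCoeff_zero_X_smul, neg_zero, add_zero]
  rw [h, ESV.sum_gen]
  have hz : ∀ (h g : ESVGen), ESV.table F h g = 0 →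
      (actCoeff (ESV.bracket F) 0 (ESV.gen F h) (ESV.gen F g) c).coeff k = 0 := fun h g ht => by
    rw [ESV.actCoeff_eq_zero 0 h g ht, Pi.zero_apply, Polynomial.coeff_zero]
  simp only [Pi.add_apply, Pi.smul_apply, Polynomial.coeff_add, Polynomial.coeff_smul, smul_eq_mul]
  cases g
  · rw [ESV.coeff_actCoeff_zero .L .L 1 2 0 .L rfl, ESV.coeff_actCoeff_zero .M .L 0 1 0 .M rfl,
      ESV.coeff_actCoeff_zero .Y .L (1 / 2) (3 / 2) 0 .Y rfl,
      ESV.coeff_actCoeff_zero .N .L 0 1 0 .N rfl]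
    rcases k with _ | _ | k <;> cases c <;> simp [ESV.adTable, div_eq_mul_inv]
  · rw [ESV.coeff_actCoeff_zero .L .M 1 1 0 .M rfl, hz .M .M rfl, hz .Y .M rfl,
      ESV.coeff_actCoeff_zero .N .M 0 0 2 .M rfl]
    rcases k with _ | _ | k <;> cases c <;> simp [ESV.adTable, mul_comm]
  · rw [ESV.coeff_actCoeff_zero .L .Y 1 (3 / 2) 0 .Y rfl, hz .M .Y rfl,
      ESV.coeff_actCoeff_zero .Y .Y 1 2 0 .M rfl, ESV.coeff_actCoeff_zero .N .Y 0 0 1 .Y rfl]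
    rcases k with _ | _ | k <;> cases c <;> simp [ESV.adTable]
  · rw [ESV.coeff_actCoeff_zero .L .N 1 1 0 .N rfl, ESV.coeff_actCoeff_zero .M .N 0 0 (-2) .M rfl,
      ESV.coeff_actCoeff_zero .Y .N 0 0 (-1) .Y rfl, hz .N .N rfl]
    rcases k with _ | _ | k <;> cases c <;> simp [ESV.adTable, mul_comm]

/-- The constant coefficients of a at L and Y are visible in a_(0)L, that at M in a_(0)N, and that
at N in a_(0)M. When all four vanish, a is divisible by ∂. -/
theorem ESV.exists_eq_der_of_ad_eq_zero {a : ESV F}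
    (h : ∀ b, actCoeff (ESV.bracket F) 0 a b = 0) : ∃ u, a = ESV.der F u := by
  have h1 : ∀ g c k, ESV.adTable (fun h => (a h).coeff 0) g c k = 0 := fun g c k => by
    rw [← ESV.coeff_ad, h, Pi.zero_apply, Polynomial.coeff_zero]
  have hL := h1 .L .L 1
  have hY := h1 .L .Y 1
  have hM := h1 .N .M 0
  have hN := h1 .M .M 0
  simp only [ESV.adTable, div_eq_zero_iff, mul_eq_zero, neg_eq_zero, OfNat.ofNat_ne_zero, or_false,
    false_or] at hL hY hM hN
  refine ⟨fun g => (a g).divX, ?_⟩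
  conv_lhs => rw [ESV.eq_sum_add_der a]
  rw [ESV.sum_gen, hL, hY, hM, hN]
  simp

theorem casimir_eq_bot : (esv F).casimir = ⊥ := by
  rw [eq_bot_iff]
  rintro _ ⟨a, ha, rfl⟩
  obtain ⟨u, rfl⟩ := ESV.exists_eq_der_of_ad_eq_zero (a := a) fun b => by
    have h := LinearMap.congr_fun (LinearMap.mem_ker.1 ha) b
    rwa [ad_eq_actCoeff] at h
  exact (Submodule.Quotient.mk_eq_zero _).2 ⟨u, rfl⟩

theorem ESV.actCoeff_zero_Y_M (v : ESV F) :
    actCoeff (ESV.bracket F) 0 (ESV.gen F .Y) v .M = Polynomial.X * v .Y := by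
  have h : LinearMap.proj (φ := fun _ => F[X]) ESVGen.M ∘ₗ
      actCoeff (ESV.bracket F) 0 (ESV.gen F .Y) =
      LinearMap.mulLeft F (Polynomial.X : F[X]) ∘ₗ LinearMap.proj ESVGen.Y := by
    refine ESV.linearMap_ext (fun c => ?_) fun v hv => ?_
    · refine Polynomial.ext fun k => ?_
      change (actCoeff (ESV.bracket F) 0 (ESV.gen F .Y) (ESV.gen F c) .M).coeff k =
        (Polynomial.X * ESV.gen F c .Y).coeff k
      rw [ESV.coeff_ad]
      cases c <;> rcases k with _ | _ | k <;>
        simp [ESV.adTable, ESV.gen, Polynomial.coeff_X]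
    · simp only [LinearMap.comp_apply, LinearMap.proj_apply, LinearMap.mulLeft_apply] at hv ⊢
      rw [actCoeff_zero_der (ESV.bracket_der_right F), ESV.der_apply, hv, ESV.der_apply]
  exact LinearMap.congr_fun h v

/-- The coefficients of D on generators are compared with those of a_(0). Compatibility with L_(1)
fixes every coefficient whose weight differs from that of the generator; the finitely many others
come from D(L), N_(0)M = 2M and Y_(0)Y = ∂M. -/
theorem isInner_of_isDerivation {D : ESV F →ₗ[F] ESV F} (hD : (esv F).IsDerivation D) :
    (esv F).IsInner D := by
  have hder : ∀ v, D (ESV.der F v) = ESV.der F (D v) := hD.1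
  have hmap : ∀ n a b, D (actCoeff (ESV.bracket F) n a b) =
      actCoeff (ESV.bracket F) n (D a) b + actCoeff (ESV.bracket F) n a (D b) :=
    hD.map_actCoeff (esv F)
  -- Applying D to L_(0)b = ∂b, with D commuting with ∂, leaves D(L)_(0)b = 0.
  obtain ⟨u, hu⟩ := ESV.exists_eq_der_of_ad_eq_zero (a := D (ESV.gen F .L)) fun b => by
    have h := hmap 0 (ESV.gen F .L) b
    rw [ESV.actCoeff_zero_L, ESV.actCoeff_zero_L, hder] at h
    exact right_eq_add.1 h
  -- Apply D to L_(1)g = weight · g and use D(L)_(1) = (∂u)_(1) = -u_(0).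
  have key : ∀ g c k, (ESV.weight c + k - ESV.weight g) * (D (ESV.gen F g) c).coeff k =
      ESV.adTable (fun h => (u h).coeff 0) g c k := by
    intro g c k
    have h := hmap 1 (ESV.gen F .L) (ESV.gen F g)
    have h1 : actCoeff (ESV.bracket F) 1 (ESV.der F u) (ESV.gen F g) =
        -actCoeff (ESV.bracket F) 0 u (ESV.gen F g) := actCoeff_succ_der_left (esv F) 0 u _
    rw [ESV.actCoeff_one_L_gen, map_smul, hu, h1] at h
    have h2 := congrArg (fun v : ESV F => (v c).coeff k) h
    simp only [Pi.add_apply, Pi.neg_apply, Pi.smul_apply, Polynomial.coeff_add,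
      Polynomial.coeff_neg, Polynomial.coeff_smul, ESV.coeff_ad, ESV.coeff_actCoeff_one_L,
      smul_eq_mul] at h2
    linear_combination -h2
  have hDL0 : ∀ c, (D (ESV.gen F .L) c).coeff 0 = 0 := fun c => by
    rw [hu, ESV.der_apply, Polynomial.coeff_X_mul_zero]
  have hDL1 : ∀ c, (D (ESV.gen F .L) c).coeff 1 = (u c).coeff 0 := fun c => by
    rw [hu, ESV.der_apply, Polynomial.coeff_X_mul]
  have hN := hmap 0 (ESV.gen F .N) (ESV.gen F .M)
  have hN' : ∀ c k, (2 - ESV.charge c) * (D (ESV.gen F .M) c).coeff k =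
      ESV.adTable (fun h => (D (ESV.gen F .N) h).coeff 0) .M c k := by
    intro c k
    rw [ESV.actCoeff_zero_N_gen, map_smul] at hN
    have h2 := congrArg (fun v : ESV F => (v c).coeff k) hN
    simp only [Pi.add_apply, Pi.smul_apply, Polynomial.coeff_add, Polynomial.coeff_smul,
      ESV.coeff_ad, ESV.actCoeff_zero_N, smul_eq_mul] at h2
    have h3 : ESV.charge (F := F) .M = 2 := rfl
    rw [h3] at h2
    linear_combination h2
  -- This is the coefficient of ∂M after applying D to Y_(0)Y = ∂M; each of the two factors Y
  -- contributes once.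
  have hY : (D (ESV.gen F .M) .M).coeff 0 = 2 * (D (ESV.gen F .Y) .Y).coeff 0 := by
    have h := hmap 0 (ESV.gen F .Y) (ESV.gen F .Y)
    rw [ESV.actCoeff_eq 0 .Y .Y 1 2 0 .M rfl] at h
    simp only [if_true, zero_ne_one, if_false, one_smul, zero_smul, add_zero, hder] at h
    have h2 := congrArg (fun v : ESV F => (v .M).coeff 1) h
    simp only [Pi.add_apply, Polynomial.coeff_add, ESV.coeff_ad, ESV.actCoeff_zero_Y_M,
      ESV.der_apply, Polynomial.coeff_X_mul, ESV.adTable] at h2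
    linear_combination h2
  -- M and N have equal weight, so the left side of `key` vanishes and forces the constant
  -- coefficient to be zero.
  have huM : (u .M).coeff 0 = 0 := by
    have h := key .N .M 0
    simpa [ESV.weight, ESV.adTable] using h
  have huN : (u .N).coeff 0 = 0 := by
    have h := key .M .M 0
    simpa [ESV.weight, ESV.adTable] using h
  -- The constant coefficients of the element that induces D. Those at L and Y are read from D(L) =
  -- ∂u, the 2 because a_(0)L contains only half of r_Y. Those at M and N are read from the
  -- M-coefficients of D(N) and D(M), using M_(0)N = -2M and N_(0)M = 2M.
  let r : ESVGen → F := fun g => match g with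
    | .L => (u .L).coeff 0
    | .M => -(D (ESV.gen F .N) .M).coeff 0 / 2
    | .Y => 2 * (u .Y).coeff 0
    | .N => (D (ESV.gen F .M) .M).coeff 0 / 2
  -- The generic entries: off the diagonal of weights `key` forces zero. Doubled weights turn the
  -- condition into one about integers.
  have hz : ∀ g c k, ESV.adTable (fun h => (u h).coeff 0) g c k = 0 → ESV.adTable r g c k = 0 →
      ESV.twoWeight c + 2 * (k : ℤ) - ESV.twoWeight g ≠ 0 →
      (D (ESV.gen F g) c).coeff k = ESV.adTable r g c k := by
    intro g c k h1 h2 h3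
    have h4 := key g c k
    rw [h1] at h4
    rw [h2]
    refine (mul_eq_zero.1 h4).resolve_left fun h5 => h3 ?_
    have h6 : ((ESV.twoWeight c + 2 * (k : ℤ) - ESV.twoWeight g : ℤ) : F) = 0 := by
      push_cast
      rw [← ESV.two_mul_weight, ← ESV.two_mul_weight]
      linear_combination 2 * h5
    exact_mod_cast h6
  have hr : ∀ g c k, (D (ESV.gen F g) c).coeff k = ESV.adTable r g c k := by
    have s1 : (D (ESV.gen F .L) .L).coeff 0 = ESV.adTable r .L .L 0 := hDL0 _
    have s2 : (D (ESV.gen F .L) .M).coeff 1 = ESV.adTable r .L .M 1 := (hDL1 _).trans huM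
    have s3 : (D (ESV.gen F .L) .N).coeff 1 = ESV.adTable r .L .N 1 := (hDL1 _).trans huN
    have s4 : (D (ESV.gen F .M) .M).coeff 0 = ESV.adTable r .M .M 0 := by
      simp only [ESV.adTable, r]; ring
    have s5 : (D (ESV.gen F .M) .N).coeff 0 = ESV.adTable r .M .N 0 := by
      have h := hN' .N 0
      simpa [ESV.charge, ESV.adTable] using h
    have s6 : (D (ESV.gen F .Y) .Y).coeff 0 = ESV.adTable r .Y .Y 0 := by
      simp only [ESV.adTable, r, hY]; ring
    have s7 : (D (ESV.gen F .N) .M).coeff 0 = ESV.adTable r .N .M 0 := by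
      simp only [ESV.adTable, r]; ring
    have s8 : (D (ESV.gen F .N) .N).coeff 0 = ESV.adTable r .N .N 0 := by
      have h := hN' .M 0
      simpa [ESV.charge, ESV.adTable] using h.symm
    have s9 : ∀ g, (D (ESV.gen F g) g).coeff 1 = ESV.adTable r g g 1 := by
      intro g
      have h := key g g 1
      cases g <;> simp only [ESV.weight, ESV.adTable, r] at h ⊢ <;> push_cast at h <;>
        linear_combination h
    have s10 : (D (ESV.gen F .L) .Y).coeff 1 = ESV.adTable r .L .Y 1 := by
      have h := key .L .Y 1
      simp only [ESV.weight, ESV.adTable, r] at h ⊢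
      push_cast at h
      linear_combination 2 * h
    have s11 : (D (ESV.gen F .Y) .M).coeff 1 = ESV.adTable r .Y .M 1 := by
      have h := key .Y .M 1
      simp only [ESV.weight, ESV.adTable, r] at h ⊢
      push_cast at h
      linear_combination 2 * h
    have s12 : (D (ESV.gen F .N) .Y).coeff 0 = ESV.adTable r .N .Y 0 := by
      have h := key .N .Y 0
      simp only [ESV.weight, ESV.adTable, r] at h ⊢
      push_cast at h
      linear_combination 2 * h
    intro g c k
    cases g <;> cases c <;> rcases k with _ | _ | k <;>
      first
      | assumption
      | exact s9 _
      | exact hz _ _ _ rfl rfl (by simp only [ESV.twoWeight]; omega)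
  -- The constants r_g suffice as a witness, since a_(0) ignores higher powers of ∂ in a.
  refine ⟨fun g => Polynomial.C (r g), ESV.linearMap_ext (fun g => ?_) fun v hv => ?_⟩
  · rw [ad_eq_actCoeff]
    refine funext fun c => Polynomial.ext fun k => ?_
    rw [hr]
    refine Eq.trans ?_ (ESV.coeff_ad _ g c k).symm
    simp only [Polynomial.coeff_C_zero]
  · rw [hder, hv, ad_eq_actCoeff, ad_eq_actCoeff]
    exact (actCoeff_zero_der (ESV.bracket_der_right F) _ _).symm

end ESVDerivations
end
end LieConformal

theorem mainTheorem8 (F : Type*) [Field F] [CharZero F] :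
    (∀ q : ℕ, Subsingleton ((LieConformal.esv F).adjoint.BasicCohomology q)) ∧
    (∀ q : ℕ, Subsingleton ((LieConformal.esv F).adjoint.ReducedCohomology q)) ∧
    (LieConformal.esv F).casimir = ⊥ ∧
    (∀ D : LieConformal.ESV F →ₗ[F] LieConformal.ESV F,
      (LieConformal.esv F).IsDerivation D → (LieConformal.esv F).IsInner D) := by
  exact ⟨LieConformal.subsingleton_basicCohomology, LieConformal.subsingleton_reducedCohomology,
    LieConformal.casimir_eq_bot, fun _ hD => LieConformal.isInner_of_isDerivation hD⟩
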